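/- **Setting.** Let $T=(V,E)$ be a tree with $n$ vertices; call $U\subseteq V$ a subtree if it induces a (nonempty) tree. A function $f:2^V\times V\to[0,\infty]$ is a *relaxed minmax monotone* cost on $T$ if 1. $f(\{s\},s)=0$ for every $s \in V$, and $f(U,s)=\infty$ if $U$ is not a subtree or $s\notin U$; 2. (set monotonicity) $f(U_1,s)\le f(U_2,s)$ for all subtrees $U_1\subseteq U_2$ with $s\in U_1$; 3. (max tree composition) for every subtree $U$ and $s\in U$, $f(U,s)=\max_i f(U_i\cup\{s\},s)$, where $U_1,\dots,U_m$ are the vertex sets of the components of $U\setminus\{s\}$ (the maximum over no components being $0$). (No path monotonicity is required.) For $S\subseteq V$ with $|S|=k\ge1$, let $\Lambda[S]$ be the set of partitions $\mathcal P=\{P_s\}_{s\in S}$ of $V$ into subtrees with $S\cap P_s=\{s\}$ for all $s \in S$, and put $f(\mathcal P,S)=\max_{s\in S}f(P_s,s)$. In the *minmax $k$ fixed-sink problem* the input is $T$ and $S$ (so $n$ and $k$ vary), and the output has to be a $\mathcal P\in\Lambda[S]$ with $f(\mathcal P,S)=\min_{\mathcal Q\in\Lambda[S]}f(\mathcal Q,S)$.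 Algorithms are uniform-cost random access machine programs. They access $f$ only through an oracle that, given a list of the vertices of a subtree $U$ and a vertex $s\in U$, returns $f(U,s)$; an oracle call with a list of $m$ vertices takes time $t_{\mathcal A}(m)$ (apart from one unit of time for the instruction). Costs can be copied and compared. The time bound $t_{\mathcal A}:\mathbb N\to[0,\infty)$ is *asymptotically subadditive* if it is non-decreasing, $t_{\mathcal A}(n)=\Omega(n)$, $t_{\mathcal A}(n+1)=O(t_{\mathcal A}(n))$, and there is a constant $C$ with $\sum_i t_{\mathcal A}(n_i)\le C\,t_{\mathcal A}\bigl(\sum_i n_i\bigr)$ for all finite families of positive integers $n_i$. **Theorem.** There is one algorithm, not depending on $f$ or $t_{\mathcal A}$, with the following properties. (a) For every relaxed minmax monotone cost $f$ it solves the minmax $k$ fixed-sink problem; and if $t_{\mathcal A}$ is asymptotically subadditive and $t_{\mathcal A}(2n)=O(t_{\mathcal A}(n))$, then its running time is $O\bigl(k^2\,t_{\mathcal A}(n)\log^2 n\bigr)$, with constants depending only on $t_{\mathcal A}$. (b) Let every vertex $v$ of the tree have a supply $w_v\ge0$, and every edge $e$ a capacity $c_e\ge0$ and a travel time $\tau_e\ge0$;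 let $f(U,s)$ be the minimum time in which a dynamic flow within the subtree $U \ni s$ can move all supplies of $U$ to $s$, where at most $c_e$ units of flow can enter $e$ per unit of time and flow entering $e$ at time $x$ leaves it at time $x+\tau_e$ ($f(U,s)=\infty$ if there is no such flow, if $U$ is not a subtree or if $s\notin U$). With an oracle for this $f$ that takes $O(n\log^2n)$ time, the algorithm solves the fixed-sink evacuation problem in time $O(n\,k^2\log^4 n)$, with constants depending only on the oracle's time bound. -/

import Mathlib

open Filter Asymptotics
open scoped ENNReal NNReal

namespace SinkPartition

/-! ### Trees, partitions and relaxed minmax monotone cost functions -/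

section Costs

variable {V : Type*} [Fintype V] [DecidableEq V]

/-- The vertex set `U` induces a subtree of `T` (in particular `U` is nonempty). -/
def IsSubtree (T : SimpleGraph V) (U : Finset V) : Prop :=
  (T.induce (U : Set V)).IsTree

open Classical in
/-- The component of `U \ {s}` that contains `u`: the vertices that can be reached from `u` by a
walk of `T` that stays in `U` and avoids `s`. -/
noncomputable def slice (T : SimpleGraph V) (U : Finset V) (s u : V) : Finset V :=
  Finset.univ.filter fun v => ∃ p : T.Walk u v, ∀ x ∈ p.support, x ∈ U ∧ x ≠ s

open Classical in
/-- Relaxed minmax monotone atomic cost functions `f : 2^V × V → [0, ∞]` on the tree `T`. -/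
structure IsRelaxedMinmaxMonotone (T : SimpleGraph V) (f : Finset V → V → ℝ≥0∞) : Prop where
  singleton : ∀ s, f {s} s = 0
  not_subtree : ∀ U s, ¬ IsSubtree T U → f U s = ⊤
  not_mem : ∀ U s, s ∉ U → f U s = ⊤
  set_monotone : ∀ U₁ U₂ s, IsSubtree T U₁ → IsSubtree T U₂ → s ∈ U₁ → U₁ ⊆ U₂ →
    f U₁ s ≤ f U₂ s
  max_composition : ∀ U s, IsSubtree T U → s ∈ U →
    f U s = (U.filter fun u => T.Adj s u).sup fun u => f (insert s (slice T U s u)) s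

/-- `P`, read as the family `(P s)` for `s ∈ S`, is a partition of the vertex set into subtrees of
`T` such that the only element of `S` in the block `P s` is `s`. -/
structure IsSinkPartition (T : SimpleGraph V) (S : Finset V) (P : V → Finset V) : Prop where
  subtree : ∀ s ∈ S, IsSubtree T (P s)
  sink : ∀ s ∈ S, S ∩ P s = {s}
  disjoint : ∀ s ∈ S, ∀ s' ∈ S, s ≠ s' → Disjoint (P s) (P s')
  cover : S.biUnion P = Finset.univ

/-- The cost of a partition is the largest cost of a block. -/
noncomputable def partitionCost (f : Finset V → V → ℝ≥0∞) (S : Finset V) (P : V → Finset V) :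
    ℝ≥0∞ :=
  S.sup fun s => f (P s) s

/-- `P` solves the minmax fixed-sink problem for the tree `T`, the sinks `S` and the cost `f`. -/
def IsOptimalPartition (T : SimpleGraph V) (f : Finset V → V → ℝ≥0∞) (S : Finset V)
    (P : V → Finset V) : Prop :=
  IsSinkPartition T S P ∧
    ∀ Q, IsSinkPartition T S Q → partitionCost f S P ≤ partitionCost f S Q

/-! ### The evacuation cost -/

open Classical in
/-- A dynamic flow in the subtree `U` of `T` that evacuates all supplies to the sink `s` by time
`θ`. Here `D v x` is the amount of flow that has entered the edge from `v` towards `s` up to time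
`x`. On an edge `e`, at most `c e` units of flow can enter per unit of time, and flow entering at
time `x` leaves at time `x + τ e`. Initially there are `w v` units of flow at `v`. -/
structure IsEvacuation (T : SimpleGraph V) (w : V → ℝ≥0) (c τ : Sym2 V → ℝ≥0)
    (U : Finset V) (s : V) (θ : ℝ) (D : V → ℝ → ℝ) : Prop where
  start : ∀ v ∈ U, v ≠ s → ∀ x ≤ 0, D v x = 0
  monotone : ∀ v ∈ U, v ≠ s → Monotone (D v)
  capacity : ∀ v ∈ U, v ≠ s → ∀ p, T.Adj v p → T.dist p s < T.dist v s →
    ∀ x y, x ≤ y → D v y - D v x ≤ (c s(v, p) : ℝ) * (y - x)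
  /- Only flow that started at `v` or has already arrived there can leave `v`. -/
  conservation : ∀ v ∈ U, v ≠ s → ∀ x,
    D v x ≤ w v + ∑ u ∈ U.filter (fun u => T.Adj u v ∧ T.dist v s < T.dist u s),
      D u (x - τ s(u, v))
  /- At time `θ` the whole supply of `U` has arrived at `s`. -/
  completion : w s + ∑ u ∈ U.filter (fun u => T.Adj u s), D u (θ - τ s(u, s)) =
    ∑ v ∈ U, (w v : ℝ)

open Classical in
/-- The evacuation cost of `U` with sink `s`: the least time in which all supplies of the vertices
of `U` can be moved to `s` inside `U` (`∞` if this is impossible, or if `U` is not a subtree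
containing `s`). -/
noncomputable def evacuationCost (T : SimpleGraph V) (w : V → ℝ≥0) (c τ : Sym2 V → ℝ≥0)
    (U : Finset V) (s : V) : ℝ≥0∞ :=
  if IsSubtree T U ∧ s ∈ U then
    ⨅ θ : {θ : ℝ≥0 // ∃ D, IsEvacuation T w c τ U s θ D}, ((θ : ℝ≥0) : ℝ≥0∞)
  else ⊤

end Costs

/-! ### Time bounds of oracles -/

/-- Asymptotic subadditivity of a running time. -/
structure IsAsymptoticallySubadditive (t : ℕ → ℝ) : Prop where
  nonneg : ∀ n, 0 ≤ t n
  monotone : Monotone t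
  linear_lower : (fun n : ℕ => (n : ℝ)) =O[atTop] t
  subadditive : ∃ C : ℝ, ∀ (m : ℕ) (a : Fin m → ℕ), (∀ i, 0 < a i) →
    ∑ i, t (a i) ≤ C * t (∑ i, a i)
  succ : (fun n : ℕ => t (n + 1)) =O[atTop] t

/-! ### The machine: a structured random access machine with a cost oracle

The machine has registers and arrays of natural numbers, and registers and arrays of costs, which
are elements of `[0, ∞]`. A program names a fixed finite number of them. Natural numbers can be
added, subtracted, halved, compared and used as addresses. Costs can only be copied and compared;
new costs are obtained from the oracle. -/

/-- Word-valued expressions. -/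
inductive Exp where
  | lit (m : ℕ)
  | reg (x : ℕ)
  | arr (a : ℕ) (i : Exp)
  | add (e₁ e₂ : Exp)
  | sub (e₁ e₂ : Exp)
  | half (e : Exp)

/-- Cost-valued expressions. -/
inductive CostExp where
  | zero
  | top
  | reg (y : ℕ)
  | arr (b : ℕ) (i : Exp)

/-- Tests. -/
inductive Test where
  | le (e₁ e₂ : Exp)
  | costLe (c₁ c₂ : CostExp)
  | not (b : Test)
  | and (b₁ b₂ : Test)

/-- Programs. -/
inductive Program where
  | skip
  | set (x : ℕ) (e : Exp)
  | store (a : ℕ) (i e : Exp)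
  | setCost (y : ℕ) (c : CostExp)
  | storeCost (b : ℕ) (i : Exp) (c : CostExp)
  /-- `query y a len v` puts into the cost register `y` the oracle's answer `f (U, v)`, where `U`
  is the set of vertices listed in the first `len` cells of the array `a`. -/
  | query (y a : ℕ) (len v : Exp)
  | seq (p₁ p₂ : Program)
  | cond (b : Test) (p₁ p₂ : Program)
  | loop (b : Test) (p : Program)

/-- The contents of the memory. -/
structure State where
  reg : ℕ → ℕ
  arr : ℕ → ℕ → ℕ
  costReg : ℕ → ℝ≥0∞
  costArr : ℕ → ℕ → ℝ≥0∞

def Exp.eval (σ : State) : Exp → ℕ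
  | .lit m => m
  | .reg x => σ.reg x
  | .arr a i => σ.arr a (i.eval σ)
  | .add e₁ e₂ => e₁.eval σ + e₂.eval σ
  | .sub e₁ e₂ => e₁.eval σ - e₂.eval σ
  | .half e => e.eval σ / 2

noncomputable def CostExp.eval (σ : State) : CostExp → ℝ≥0∞
  | .zero => 0
  | .top => ⊤
  | .reg y => σ.costReg y
  | .arr b i => σ.costArr b (i.eval σ)

def Test.holds (σ : State) : Test → Prop
  | .le e₁ e₂ => e₁.eval σ ≤ e₂.eval σ
  | .costLe c₁ c₂ => c₁.eval σ ≤ c₂.eval σ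
  | .not b => ¬ b.holds σ
  | .and b₁ b₂ => b₁.holds σ ∧ b₂.holds σ

def State.setReg (σ : State) (x m : ℕ) : State :=
  { σ with reg := Function.update σ.reg x m }

def State.setArr (σ : State) (a i m : ℕ) : State :=
  { σ with arr := Function.update σ.arr a (Function.update (σ.arr a) i m) }

noncomputable def State.setCostReg (σ : State) (y : ℕ) (r : ℝ≥0∞) : State :=
  { σ with costReg := Function.update σ.costReg y r }

noncomputable def State.setCostArr (σ : State) (b i : ℕ) (r : ℝ≥0∞) : State :=
  { σ with costArr := Function.update σ.costArr b (Function.update (σ.costArr b) i r) }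

/-- `Exec T f t p σ r σ'`: the program `p`, started in the memory `σ`, halts in time `r` with
memory `σ'`. Every command and every test takes one unit of time (the expressions in it have a
size fixed by the program). An oracle call on a list of `m` vertices takes `t m` additional units
of time; it is possible only if the list represents a subtree that contains the given sink
(otherwise the machine has no next step, so that it does not halt). -/
inductive Exec {n : ℕ} (T : SimpleGraph (Fin n)) (f : Finset (Fin n) → Fin n → ℝ≥0∞)
    (t : ℕ → ℝ) : Program → State → ℝ → State → Prop where
  | skip (σ) : Exec T f t .skip σ 1 σ
  | set (x e σ) : Exec T f t (.set x e) σ 1 (σ.setReg x (e.eval σ))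
  | store (a i e σ) : Exec T f t (.store a i e) σ 1 (σ.setArr a (i.eval σ) (e.eval σ))
  | setCost (y c σ) : Exec T f t (.setCost y c) σ 1 (σ.setCostReg y (c.eval σ))
  | storeCost (b i c σ) :
      Exec T f t (.storeCost b i c) σ 1 (σ.setCostArr b (i.eval σ) (c.eval σ))
  | query (y a len v σ) (U : Finset (Fin n)) (s : Fin n)
      (hU : U.image Fin.val = (Finset.range (len.eval σ)).image (σ.arr a))
      (hs : v.eval σ = s.val) (hsub : IsSubtree T U) (hmem : s ∈ U) :
      Exec T f t (.query y a len v) σ (1 + t (len.eval σ)) (σ.setCostReg y (f U s))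
  | seq {p₁ p₂ σ σ' σ'' r r'} (h₁ : Exec T f t p₁ σ r σ') (h₂ : Exec T f t p₂ σ' r' σ'') :
      Exec T f t (.seq p₁ p₂) σ (r + r') σ''
  | cond_true {b p₁ p₂ σ σ' r} (hb : b.holds σ) (h : Exec T f t p₁ σ r σ') :
      Exec T f t (.cond b p₁ p₂) σ (1 + r) σ'
  | cond_false {b p₁ p₂ σ σ' r} (hb : ¬ b.holds σ) (h : Exec T f t p₂ σ r σ') :
      Exec T f t (.cond b p₁ p₂) σ (1 + r) σ'
  | loop_done {b p σ} (hb : ¬ b.holds σ) : Exec T f t (.loop b p) σ 1 σ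
  | loop_step {b p σ σ' σ'' r r'} (hb : b.holds σ) (h : Exec T f t p σ r σ')
      (h' : Exec T f t (.loop b p) σ' r' σ'') :
      Exec T f t (.loop b p) σ (1 + r + r') σ''

/-! ### The fixed-sink problem as a computational problem -/

/-- An input with `n` vertices and `k` sinks: a tree, given by a list of its `n - 1` edges in any
order and orientation, and a list of `k` distinct vertices. -/
structure Input (n k : ℕ) where
  tree : SimpleGraph (Fin n)
  isTree : tree.IsTree
  edge : Fin (n - 1) → Fin n × Fin n
  adj_iff : ∀ u v, tree.Adj u v ↔ ∃ i, edge i = (u, v) ∨ edge i = (v, u)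
  sink : Fin k ↪ Fin n

/-- The set of sinks of the input. -/
def Input.sinks {n k : ℕ} (I : Input n k) : Finset (Fin n) := Finset.univ.map I.sink

/-- The initial memory: `n` and `k` are in the registers 0 and 1, the two ends of the edges in the
arrays 0 and 1, the sinks in the array 2; everything else is zero. -/
noncomputable def Input.init {n k : ℕ} (I : Input n k) : State where
  reg x := if x = 0 then n else if x = 1 then k else 0
  arr a i :=
    if a = 0 then (if h : i < n - 1 then ((I.edge ⟨i, h⟩).1 : ℕ) else 0)
    else if a = 1 then (if h : i < n - 1 then ((I.edge ⟨i, h⟩).2 : ℕ) else 0)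
    else if a = 2 then (if h : i < k then (I.sink ⟨i, h⟩ : ℕ) else 0)
    else 0
  costReg _ := 0
  costArr _ _ := 0

/-- The output is read from the array 3, whose cell `v` holds the sink that `v` is assigned to. -/
def State.output (σ : State) (n : ℕ) (s : Fin n) : Finset (Fin n) :=
  Finset.univ.filter fun v : Fin n => σ.arr 3 v = s

/-- With an oracle for `f` that needs time `t m` on subtrees given by `m` vertices, the program `p`
solves the fixed-sink problem on the input `I` in time `r`. -/
def Solves {n k : ℕ} (p : Program) (I : Input n k) (f : Finset (Fin n) → Fin n → ℝ≥0∞)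
    (t : ℕ → ℝ) (r : ℝ) : Prop :=
  ∃ σ, Exec I.tree f t p I.init r σ ∧ IsOptimalPartition I.tree f I.sinks (σ.output n)

end SinkPartition

open SinkPartition

/-!
# An algorithm for the minmax fixed-sink problem on trees

Root the tree at a sink. For a threshold `c`, whether some partition has cost at most `c` is decided
greedily from the leaves to the root: a vertex `x` is *served* if there is a sink `s` below `x`,
with no other sink on the path from `s` to `x`, such that the block of `s` up to `x` costs at most
`c`.
The block consists of the path from `s` to `x` and of everything that hangs from it by unserved
vertices; these have no other choice than to join the part of their parent. If some partition has
cost at most `c`, then the part that contains both `s` and `x` contains this block, so by set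
monotonicity all sinks are served (`served_of_partition`); conversely, if all sinks are served, then
assigning blocks from the root to the leaves yields a partition of cost at most `c`
(`AssignInv.isSinkPartition`).

The cost of the block of `s` up to `x` increases with `x` along a path. Call `v` a key vertex if it
is a sink or if it has two children with sinks below them. There are at most `2 * k` key vertices
(`card_key_le`). On the chain that leads from a key vertex to the next one, all vertices have the
same sinks below them, so the last vertex on the chain that one sink can serve is found by binary
search, with `O(log n)` oracle calls. A sink whose search ends before the end of the chain is
finished, since no block that goes further can be cheap enough; and when a sink reaches the end of
a chain, no other sink need be tried on it. Hence there are `O(k)` searches (`run_greedy`).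

The optimum is found by running the same greedy algorithm once more, with the unknown optimum as the
threshold (`isCmp_optimum`): whether a cost `c` is smaller than the optimum is decided by a greedy
run with threshold `c`, and the least feasible cost met on the way is kept. No cost other than an
answer of the oracle is ever needed. After the run this least cost is the optimum
(`GreedyResult.le_of_partition`): a partition cheaper than it would have all its greedy blocks
judged cheaper than the optimum, so that these would form a partition cheaper than the optimum. The two
levels make `O(k log n)` comparisons with `O(k log n)` oracle calls each, whence the time
`O(k² t(n) log² n)`. Neither path monotonicity nor max composition of the cost enters.

For the second part it remains to show that the evacuation cost is relaxed minmax monotone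
(`evacuationCost_isRelaxedMinmaxMonotone`). If supplies are removed, then a flow can be repaired by
letting the flow out of each vertex start later, by the amount that was removed below the vertex
(`Evac.restrict`); and flows on the branches at the sink can be joined (`Evac.join`).

Programs are analysed with a predicate `Run` that tracks the clock and the memory, and for which
there is one rule for each construct of the language. The greedy algorithm is one program `greedy`,
with the comparison as a parameter, and with its variables shifted by an offset `o`, so that one run
can be nested in another.
-/

namespace SinkPartition

set_option linter.unusedSimpArgs false

/-! ### Symbolic execution -/

@[simp] theorem State.setReg_reg (σ : State) (x m y : ℕ) :
    (σ.setReg x m).reg y = if y = x then m else σ.reg y := by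
  simp [State.setReg, Function.update_apply]
@[simp] theorem State.setReg_arr (σ : State) (x m : ℕ) : (σ.setReg x m).arr = σ.arr := rfl
@[simp] theorem State.setReg_costReg (σ : State) (x m : ℕ) :
    (σ.setReg x m).costReg = σ.costReg := rfl
@[simp] theorem State.setArr_reg (σ : State) (a i m : ℕ) : (σ.setArr a i m).reg = σ.reg := rfl
@[simp] theorem State.setArr_arr (σ : State) (a i m b : ℕ) :
    (σ.setArr a i m).arr b = if b = a then Function.update (σ.arr a) i m else σ.arr b := by
  simp [State.setArr, Function.update_apply]
@[simp] theorem State.setCostReg_reg (σ : State) (y : ℕ) (c : ℝ≥0∞) :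
    (σ.setCostReg y c).reg = σ.reg := rfl
@[simp] theorem State.setCostReg_arr (σ : State) (y : ℕ) (c : ℝ≥0∞) :
    (σ.setCostReg y c).arr = σ.arr := rfl
@[simp] theorem State.setCostReg_costReg (σ : State) (x : ℕ) (c : ℝ≥0∞) (y : ℕ) :
    (σ.setCostReg x c).costReg y = if y = x then c else σ.costReg y := by
  simp [State.setCostReg, Function.update_apply]

attribute [simp] Exp.eval CostExp.eval Test.holds

/-- The test `e₁ < e₂`. -/
def Test.lt (e₁ e₂ : Exp) : Test := .not (.le e₂ e₁)

/-- The test `e₁ = e₂`. -/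
def Test.eq (e₁ e₂ : Exp) : Test := .and (.le e₁ e₂) (.le e₂ e₁)

@[simp] theorem Test.lt_holds (σ : State) (e₁ e₂ : Exp) :
    (Test.lt e₁ e₂).holds σ ↔ e₁.eval σ < e₂.eval σ := by simp [Test.lt]
@[simp] theorem Test.eq_holds (σ : State) (e₁ e₂ : Exp) :
    (Test.eq e₁ e₂).holds σ ↔ e₁.eval σ = e₂.eval σ := by simp [Test.eq, le_antisymm_iff]

/-- The register `x` occurs as a target of an assignment in the program. -/
@[simp] def Program.writesReg (x : ℕ) : Program → Prop
  | .set y _ => x = y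
  | .seq p q => p.writesReg x ∨ q.writesReg x
  | .cond _ p q => p.writesReg x ∨ q.writesReg x
  | .loop _ p => p.writesReg x
  | _ => False

/-- The array `a` occurs as a target of an assignment in the program. -/
@[simp] def Program.writesArr (a : ℕ) : Program → Prop
  | .store b _ _ => a = b
  | .seq p q => p.writesArr a ∨ q.writesArr a
  | .cond _ p q => p.writesArr a ∨ q.writesArr a
  | .loop _ p => p.writesArr a
  | _ => False

/-- The cost register `x` occurs as a target of an assignment in the program. -/
@[simp] def Program.writesCost (x : ℕ) : Program → Prop
  | .setCost y _ => x = y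
  | .query y _ _ _ => x = y
  | .seq p q => p.writesCost x ∨ q.writesCost x
  | .cond _ p q => p.writesCost x ∨ q.writesCost x
  | .loop _ p => p.writesCost x
  | _ => False

/-- `σ'` agrees with `σ` wherever the program `p` does not write. -/
structure Frame (p : Program) (σ σ' : State) : Prop where
  reg : ∀ x, ¬ p.writesReg x → σ'.reg x = σ.reg x
  arr : ∀ a, ¬ p.writesArr a → σ'.arr a = σ.arr a
  cost : ∀ x, ¬ p.writesCost x → σ'.costReg x = σ.costReg x

theorem Frame.refl (p : Program) (σ : State) : Frame p σ σ :=
  ⟨fun _ _ => rfl, fun _ _ => rfl, fun _ _ => rfl⟩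

theorem Frame.trans {p : Program} {σ σ' σ'' : State} (h : Frame p σ σ') (h' : Frame p σ' σ'') :
    Frame p σ σ'' :=
  ⟨fun x hx => (h'.reg x hx).trans (h.reg x hx), fun x hx => (h'.arr x hx).trans (h.arr x hx),
    fun x hx => (h'.cost x hx).trans (h.cost x hx)⟩

theorem Frame.weaken {p q : Program} {σ σ' : State} (h : Frame p σ σ')
    (h₁ : ∀ x, p.writesReg x → q.writesReg x) (h₂ : ∀ x, p.writesArr x → q.writesArr x)
    (h₃ : ∀ x, p.writesCost x → q.writesCost x) : Frame q σ σ' :=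
  ⟨fun x hx => h.reg x (mt (h₁ x) hx), fun x hx => h.arr x (mt (h₂ x) hx),
    fun x hx => h.cost x (mt (h₃ x) hx)⟩

section

variable {n : ℕ} {T : SimpleGraph (Fin n)} {f : Finset (Fin n) → Fin n → ℝ≥0∞} {t : ℕ → ℝ}

theorem Exec.frame {p : Program} {σ σ' : State} {r : ℝ} (h : Exec T f t p σ r σ') :
    Frame p σ σ' := by
  induction h with
  | skip σ => exact Frame.refl _ _
  | set x e σ => exact ⟨fun y hy => by simp_all, fun _ _ => rfl, fun _ _ => rfl⟩
  | store a i e σ => exact ⟨fun _ _ => rfl, fun y hy => by simp_all, fun _ _ => rfl⟩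
  | setCost y c σ => exact ⟨fun _ _ => rfl, fun _ _ => rfl, fun y hy => by simp_all⟩
  | storeCost b i c σ => exact ⟨fun _ _ => rfl, fun _ _ => rfl, fun _ _ => rfl⟩
  | query y a len v σ U s hU hs hsub hmem =>
    exact ⟨fun _ _ => rfl, fun _ _ => rfl, fun y hy => by simp_all⟩
  | seq h₁ h₂ ih₁ ih₂ =>
    exact (ih₁.weaken (by simp_all) (by simp_all) (by simp_all)).trans
      (ih₂.weaken (by simp_all) (by simp_all) (by simp_all))
  | cond_true hb h ih => exact ih.weaken (by simp_all) (by simp_all) (by simp_all)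
  | cond_false hb h ih => exact ih.weaken (by simp_all) (by simp_all) (by simp_all)
  | loop_done hb => exact Frame.refl _ _
  | loop_step hb h h' ih ih' =>
    exact (ih.weaken (by simp_all) (by simp_all) (by simp_all)).trans ih'

variable (T f t) in
/-- Started in the memory `σ` when the clock shows `c`, the program halts, and then the clock and
the memory satisfy `Q`. -/
def Run (p : Program) (c : ℝ) (σ : State) (Q : ℝ → State → Prop) : Prop :=
  ∃ r σ', Exec T f t p σ r σ' ∧ Q (c + r) σ'

variable {p q : Program} {c : ℝ} {σ : State} {Q Q' : ℝ → State → Prop}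

theorem Run.mono (h : Run T f t p c σ Q) (hQ : ∀ c' σ', Frame p σ σ' → Q c' σ' → Q' c' σ') :
    Run T f t p c σ Q' := by
  obtain ⟨r, σ', h₁, h₂⟩ := h
  exact ⟨r, σ', h₁, hQ _ _ h₁.frame h₂⟩

theorem run_skip : Run T f t .skip c σ Q ↔ Q (c + 1) σ :=
  ⟨fun ⟨_, _, h, h'⟩ => by cases h; exact h', fun h => ⟨_, _, .skip _, h⟩⟩

theorem run_set {x : ℕ} {e : Exp} :
    Run T f t (.set x e) c σ Q ↔ Q (c + 1) (σ.setReg x (e.eval σ)) :=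
  ⟨fun ⟨_, _, h, h'⟩ => by cases h; exact h', fun h => ⟨_, _, .set .., h⟩⟩

theorem run_store {a : ℕ} {i e : Exp} :
    Run T f t (.store a i e) c σ Q ↔ Q (c + 1) (σ.setArr a (i.eval σ) (e.eval σ)) :=
  ⟨fun ⟨_, _, h, h'⟩ => by cases h; exact h', fun h => ⟨_, _, .store .., h⟩⟩

theorem run_setCost {x : ℕ} {e : CostExp} :
    Run T f t (.setCost x e) c σ Q ↔ Q (c + 1) (σ.setCostReg x (e.eval σ)) :=
  ⟨fun ⟨_, _, h, h'⟩ => by cases h; exact h', fun h => ⟨_, _, .setCost .., h⟩⟩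

theorem run_seq :
    Run T f t (.seq p q) c σ Q ↔ Run T f t p c σ fun c' σ' => Run T f t q c' σ' Q := by
  constructor
  · rintro ⟨_, _, h, h'⟩
    cases h with
    | seq h₁ h₂ => exact ⟨_, _, h₁, _, _, h₂, by rwa [add_assoc]⟩
  · rintro ⟨r, σ', h, r', σ'', h', hQ⟩
    exact ⟨_, _, .seq h h', by rwa [← add_assoc]⟩

theorem run_cond {b : Test} :
    Run T f t (.cond b p q) c σ Q ↔
      (b.holds σ → Run T f t p (c + 1) σ Q) ∧ (¬ b.holds σ → Run T f t q (c + 1) σ Q) := by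
  constructor
  · rintro ⟨_, _, h, h'⟩
    cases h with
    | cond_true hb h₁ => exact ⟨fun _ => ⟨_, _, h₁, by rwa [add_assoc]⟩, fun h => absurd hb h⟩
    | cond_false hb h₁ => exact ⟨fun h => absurd h hb, fun _ => ⟨_, _, h₁, by rwa [add_assoc]⟩⟩
  · rintro ⟨h₁, h₂⟩
    by_cases hb : b.holds σ
    · obtain ⟨r, σ', h, hQ⟩ := h₁ hb
      exact ⟨_, _, .cond_true hb h, by rwa [← add_assoc]⟩
    · obtain ⟨r, σ', h, hQ⟩ := h₂ hb
      exact ⟨_, _, .cond_false hb h, by rwa [← add_assoc]⟩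

theorem run_query {y a : ℕ} {len v : Exp} (U : Finset (Fin n)) (s : Fin n)
    (hU : U.image Fin.val = (Finset.range (len.eval σ)).image (σ.arr a))
    (hs : v.eval σ = s.val) (hsub : IsSubtree T U) (hmem : s ∈ U)
    (h : Q (c + (1 + t (len.eval σ))) (σ.setCostReg y (f U s))) :
    Run T f t (.query y a len v) c σ Q :=
  ⟨_, _, .query y a len v σ U s hU hs hsub hmem, h⟩

/-- The rule for loops. The invariant `Inv m c σ` relates the clock and the memory to a natural
number that decreases in each round. -/
theorem Run.loop {b : Test} (Inv : ℕ → ℝ → State → Prop) (m : ℕ) (h₀ : Inv m c σ)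
    (step : ∀ m c' σ', Frame p σ σ' → Inv m c' σ' → b.holds σ' →
      Run T f t p (c' + 1) σ' fun c'' σ'' => ∃ m' < m, Inv m' c'' σ'')
    (done : ∀ m c' σ', Frame p σ σ' → Inv m c' σ' → ¬ b.holds σ' → Q (c' + 1) σ') :
    Run T f t (.loop b p) c σ Q := by
  suffices H : ∀ m c' σ', Frame p σ σ' → Inv m c' σ' → Run T f t (.loop b p) c' σ' Q from
    H m c σ (Frame.refl _ _) h₀
  intro m
  induction m using Nat.strong_induction_on with
  | _ m ih =>
    intro c' σ' hF hI
    by_cases hb : b.holds σ'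
    · obtain ⟨r, σ'', h, m', hm, hI'⟩ := step m c' σ' hF hI hb
      obtain ⟨r', σ₃, h', hQ⟩ := ih m' hm _ σ'' (hF.trans h.frame) hI'
      exact ⟨_, _, .loop_step hb h h', by convert hQ using 1; ring⟩
    · exact ⟨_, _, .loop_done hb, done m c' σ' hF hI hb⟩

/-- `for x = 0, …, (the content of y) - 1 do p`. -/
def forUp (x y : ℕ) (p : Program) : Program :=
  .seq (.set x (.lit 0))
    (.loop (.lt (.reg x) (.reg y)) (.seq p (.set x (.add (.reg x) (.lit 1)))))

@[simp] theorem forUp_writesReg (x y z : ℕ) (p : Program) :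
    (forUp x y p).writesReg z ↔ z = x ∨ p.writesReg z := by
  simp only [forUp, Program.writesReg]; tauto
@[simp] theorem forUp_writesArr (x y z : ℕ) (p : Program) :
    (forUp x y p).writesArr z ↔ p.writesArr z := by simp [forUp]
@[simp] theorem forUp_writesCost (x y z : ℕ) (p : Program) :
    (forUp x y p).writesCost z ↔ p.writesCost z := by simp [forUp]

/-- The rule for counting loops: `Inv i c σ` has to hold when the counter is about to be compared
with its bound for the `i + 1`-st time. -/
theorem Run.forUp {x y N : ℕ} (Inv : ℕ → ℝ → State → Prop) (hN : σ.reg y = N) (hxy : y ≠ x)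
    (hx : ¬ p.writesReg x) (hy : ¬ p.writesReg y) (h₀ : Inv 0 (c + 1) (σ.setReg x 0))
    (step : ∀ i c' σ', i < N → Frame (SinkPartition.forUp x y p) σ σ' → σ'.reg x = i →
      Inv i c' σ' →
      Run T f t p (c' + 1) σ' fun c'' σ'' => Inv (i + 1) (c'' + 1) (σ''.setReg x (i + 1)))
    (done : ∀ c' σ', Frame (SinkPartition.forUp x y p) σ σ' → Inv N c' σ' → Q (c' + 1) σ') :
    Run T f t (SinkPartition.forUp x y p) c σ Q := by
  have hF0 : Frame (SinkPartition.forUp x y p) σ (σ.setReg x 0) :=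
    ⟨fun z hz => by simp_all, fun _ _ => rfl, fun _ _ => rfl⟩
  rw [SinkPartition.forUp, run_seq, run_set]
  refine Run.loop (fun m c' σ' => ∃ i, i + m = N ∧ σ'.reg x = i ∧ Inv i c' σ') N
    ⟨0, by simp, by simp, h₀⟩ ?_ ?_
  · rintro m c' σ' hF ⟨i, him, hi, hI⟩ hb
    have hF' := hF0.trans (hF.weaken (q := SinkPartition.forUp x y p)
      (by simp; tauto) (by simp) (by simp))
    have hy' : σ'.reg y = N := by rw [hF'.reg y (by simp [hxy, hy]), hN]
    simp only [Test.lt_holds, Exp.eval, hi, hy'] at hb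
    rw [run_seq]
    refine (step i c' σ' hb hF' hi hI).mono fun c'' σ'' hF'' h => ?_
    rw [run_set]
    refine ⟨m - 1, by omega, i + 1, by omega, ?_, ?_⟩
    · simp [hF''.reg x hx, hi]
    · simpa [hF''.reg x hx, hi] using h
  · rintro m c' σ' hF ⟨i, him, hi, hI⟩ hb
    have hF' := hF0.trans (hF.weaken (q := SinkPartition.forUp x y p)
      (by simp; tauto) (by simp) (by simp))
    have hy' : σ'.reg y = N := by rw [hF'.reg y (by simp [hxy, hy]), hN]
    simp only [Test.lt_holds, Exp.eval, hi, hy'] at hb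
    obtain rfl : i = N := by omega
    exact done c' σ' hF' hI

end

/-! ### Rooted trees -/

/-- A rooted tree on `Fin n`, with an order of the vertices in which children precede their
parents. The parent of the root is the root. -/
structure Rooting {n : ℕ} (T : SimpleGraph (Fin n)) where
  root : Fin n
  par : Fin n → Fin n
  ord : Equiv.Perm (Fin n)
  par_root : par root = root
  adj : ∀ u, u ≠ root → T.Adj u (par u)
  edge : ∀ u v, T.Adj u v → par u = v ∨ par v = u
  ord_lt : ∀ u, u ≠ root → ord.symm u < ord.symm (par u)

namespace Rooting

variable {n : ℕ} {T : SimpleGraph (Fin n)} (R : Rooting T)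

/-- `u` is a descendant of `x`, or `x` itself. -/
def Below (u x : Fin n) : Prop := ∃ j, R.par^[j] u = x

theorem Below.refl (u : Fin n) : R.Below u u := ⟨0, rfl⟩

variable {R}

theorem Below.trans {u v w : Fin n} (h : R.Below u v) (h' : R.Below v w) : R.Below u w := by
  obtain ⟨i, rfl⟩ := h
  obtain ⟨j, rfl⟩ := h'
  exact ⟨j + i, by rw [Function.iterate_add_apply]⟩

variable (R)

theorem below_par (u : Fin n) : R.Below u (R.par u) := ⟨1, rfl⟩

variable {R}

theorem Below.par_of_ne {u x : Fin n} (h : R.Below u x) (hne : u ≠ x) : R.Below (R.par u) x := by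
  obtain ⟨j, rfl⟩ := h
  cases j with
  | zero => exact absurd rfl hne
  | succ j => exact ⟨j, rfl⟩

variable (R)

theorem par_ne {u : Fin n} (hu : u ≠ R.root) : R.par u ≠ u := fun h => by
  have := R.ord_lt u hu
  rw [h] at this
  exact lt_irrefl _ this

theorem le_par (u : Fin n) : R.ord.symm u ≤ R.ord.symm (R.par u) := by
  by_cases hu : u = R.root
  · rw [hu, R.par_root]
  · exact (R.ord_lt u hu).le

variable {R}

theorem Below.le {u x : Fin n} (h : R.Below u x) : R.ord.symm u ≤ R.ord.symm x := by
  obtain ⟨j, rfl⟩ := h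
  induction j with
  | zero => exact le_rfl
  | succ j ih =>
    rw [Function.iterate_succ_apply']
    exact ih.trans (R.le_par _)

theorem Below.antisymm {u x : Fin n} (h : R.Below u x) (h' : R.Below x u) : u = x :=
  R.ord.symm.injective (le_antisymm h.le h'.le)

theorem Below.lt {u x : Fin n} (h : R.Below u x) (hne : u ≠ x) :
    R.ord.symm u < R.ord.symm x :=
  lt_of_le_of_ne h.le fun h => hne (R.ord.symm.injective h)

theorem Below.total {s x y : Fin n} (h : R.Below s x) (h' : R.Below s y) :
    R.Below x y ∨ R.Below y x := by
  obtain ⟨i, rfl⟩ := h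
  obtain ⟨j, rfl⟩ := h'
  rcases le_total i j with h | h
  · exact .inl ⟨j - i, by rw [← Function.iterate_add_apply, Nat.sub_add_cancel h]⟩
  · exact .inr ⟨i - j, by rw [← Function.iterate_add_apply, Nat.sub_add_cancel h]⟩

variable (R)

/-- Induction along the order, from the root to the leaves. -/
theorem induction_down {p : Fin n → Prop}
    (h : ∀ u, (∀ v, R.ord.symm u < R.ord.symm v → p v) → p u) (u : Fin n) : p u := by
  suffices H : ∀ m (u : Fin n), n - (R.ord.symm u : ℕ) = m → p u from H _ u rfl
  intro m
  induction m using Nat.strong_induction_on with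
  | _ m ih =>
    intro u hu
    refine h u fun v hv => ih _ ?_ v rfl
    have := (R.ord.symm v).2
    have : (R.ord.symm u : ℕ) < R.ord.symm v := hv
    omega

/-- Induction along the order, from the leaves to the root. -/
theorem induction_up {p : Fin n → Prop}
    (h : ∀ u, (∀ v, R.ord.symm v < R.ord.symm u → p v) → p u) (u : Fin n) : p u := by
  suffices H : ∀ m (u : Fin n), (R.ord.symm u : ℕ) = m → p u from H _ u rfl
  intro m
  induction m using Nat.strong_induction_on with
  | _ m ih =>
    intro u hu
    refine h u fun v hv => ih _ ?_ v rfl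
    have : (R.ord.symm v : ℕ) < R.ord.symm u := hv
    omega

theorem below_root (u : Fin n) : R.Below u R.root := by
  induction u using R.induction_down with
  | _ u ih =>
    by_cases hu : u = R.root
    · rw [hu]; exact Below.refl _ _
    · exact (R.below_par u).trans (ih _ (R.ord_lt u hu))

variable {R}

theorem eq_root_of_root_below {x : Fin n} (h : R.Below R.root x) : x = R.root :=
  (R.below_root x).antisymm h

theorem exists_child_of_below {u x : Fin n} (h : R.Below u x) (hne : u ≠ x) :
    ∃ c, R.Below u c ∧ R.par c = x ∧ c ≠ R.root := by
  induction u using R.induction_down with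
  | _ u ih =>
    have hu : u ≠ R.root := by
      rintro rfl
      exact hne (eq_root_of_root_below h).symm
    by_cases hp : R.par u = x
    · exact ⟨u, Below.refl _ _, hp, hu⟩
    · obtain ⟨c, h₁, h₂⟩ := ih _ (R.ord_lt u hu) (h.par_of_ne hne) hp
      exact ⟨c, (R.below_par u).trans h₁, h₂⟩

theorem isSubtree_of_par_mem (hT : T.IsTree) {U : Finset (Fin n)} {x : Fin n} (hx : x ∈ U)
    (hU : ∀ u ∈ U, R.Below u x) (hpar : ∀ u ∈ U, u ≠ x → R.par u ∈ U) : IsSubtree T U := by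
  have key : ∀ u (hu : u ∈ U), (T.induce (U : Set (Fin n))).Reachable ⟨u, hu⟩ ⟨x, hx⟩ := by
    intro u
    induction u using R.induction_down with
    | _ u ih =>
      intro hu
      by_cases hux : u = x
      · subst hux; exact .refl _
      · have hr : u ≠ R.root := by
          rintro rfl
          exact hux (eq_root_of_root_below (hU _ hu)).symm
        have hadj : (T.induce (U : Set (Fin n))).Adj ⟨u, hu⟩ ⟨R.par u, hpar u hu hux⟩ :=
          R.adj u hr
        exact hadj.reachable.trans (ih _ (R.ord_lt u hr) _)
  exact ⟨{ preconnected := fun u v => (key u u.2).trans (key v v.2).symm, nonempty := ⟨⟨x, hx⟩⟩ },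
    hT.isAcyclic.induce _⟩

theorem par_mem_of_isSubtree {U : Finset (Fin n)} (hU : IsSubtree T U) {u w : Fin n}
    (hu : u ∈ U) (hw : w ∈ U) (h : ¬ R.Below w u) : R.par u ∈ U := by
  by_contra hp
  obtain ⟨p⟩ := hU.connected.preconnected ⟨u, hu⟩ ⟨w, hw⟩
  have key : ∀ {a b : (U : Set (Fin n))} (_ : (T.induce (U : Set (Fin n))).Walk a b),
      R.Below a u → R.Below b u := by
    intro a b p
    induction p with
    | nil => exact id
    | @cons a b c hab p ih =>
      intro ha
      refine ih ?_
      rcases R.edge a b hab with h | h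
      · rw [← h]
        refine ha.par_of_ne fun hau => hp ?_
        rw [← hau, h]
        exact b.2
      · exact Below.trans ⟨1, h⟩ ha
  exact h (key p (Below.refl R u))

/-! ### Blocks -/

variable (R)

/-- The vertices which the sink `s` has to take if it takes its ancestor `x`, provided that
exactly the vertices in `A` can be taken by a sink below them: the path from `s` to `x` and,
recursively, the children outside `A` of vertices that have to be taken. -/
inductive Block (A : Fin n → Prop) (s x : Fin n) : Fin n → Prop
  | path {u : Fin n} : R.Below s u → R.Below u x → Block A s x u
  | hang {u : Fin n} : Block A s x (R.par u) → ¬ A u → Block A s x u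

open Classical in
/-- `Rooting.Block` as a finite set. -/
noncomputable def block (A : Fin n → Prop) (s x : Fin n) : Finset (Fin n) :=
  Finset.univ.filter (R.Block A s x)

variable {R}
variable {A A' : Fin n → Prop} {s x y u : Fin n}

@[simp] theorem mem_block : u ∈ R.block A s x ↔ R.Block A s x u := by simp [block]

theorem Block.below_top (h : R.Block A s x u) : R.Below u x := by
  induction h with
  | path _ h => exact h
  | hang _ _ ih => exact (R.below_par _).trans ih

theorem Block.par_of_ne (h : R.Block A s x u) (hne : u ≠ x) : R.Block A s x (R.par u) := by
  cases h with
  | path h₁ h₂ => exact .path (h₁.trans (R.below_par u)) (h₂.par_of_ne hne)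
  | hang h _ => exact h

theorem block_mono (h : R.Below x y) : R.block A s x ⊆ R.block A s y := by
  intro u hu
  rw [mem_block] at *
  induction hu with
  | path h₁ h₂ => exact .path h₁ (h₂.trans h)
  | hang _ hA ih => exact .hang ih hA

theorem block_congr
    (h : ∀ u, R.Below u x → ¬ R.Below s u → (A u ↔ A' u)) : R.block A s x = R.block A' s x := by
  have key : ∀ {A A' : Fin n → Prop}, (∀ u, R.Below u x → ¬ R.Below s u → (A u ↔ A' u)) →
      ∀ u, R.Block A s x u → R.Block A' s x u := by
    intro A A' h u hu
    induction hu with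
    | path h₁ h₂ => exact .path h₁ h₂
    | @hang u hp hA ih =>
      have hux := (R.below_par u).trans hp.below_top
      by_cases hsu : R.Below s u
      · exact .path hsu hux
      · exact .hang ih (by rwa [← h u hux hsu])
  ext u
  rw [mem_block, mem_block]
  exact ⟨key h u, key (fun u h₁ h₂ => (h u h₁ h₂).symm) u⟩

theorem self_mem_block (h : R.Below s x) : s ∈ R.block A s x :=
  mem_block.2 (.path (Below.refl _ _) h)

theorem top_mem_block (h : R.Below s x) : x ∈ R.block A s x :=
  mem_block.2 (.path h (Below.refl _ _))

theorem isSubtree_block (hT : T.IsTree) (h : R.Below s x) : IsSubtree T (R.block A s x) :=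
  isSubtree_of_par_mem (R := R) hT (top_mem_block h) (fun _ hu => (mem_block.1 hu).below_top)
    fun _ hu hne => mem_block.2 ((mem_block.1 hu).par_of_ne hne)

theorem cost_block_mono {f : Finset (Fin n) → Fin n → ℝ≥0∞} (hf : IsRelaxedMinmaxMonotone T f)
    (hT : T.IsTree) (hx : R.Below s x) (h : R.Below x y) :
    f (R.block A s x) s ≤ f (R.block A s y) s :=
  hf.set_monotone _ _ _ (isSubtree_block hT hx) (isSubtree_block hT (hx.trans h))
    (self_mem_block hx) (block_mono h)

variable (R)

/-- The sink `s` is below `x`, and there is no other sink on the path from `s` to `x`. -/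
def Cand (S : Finset (Fin n)) (s x : Fin n) : Prop :=
  s ∈ S ∧ R.Below s x ∧ ∀ z ∈ S, R.Below s z → R.Below z x → z = s

variable {R} {S : Finset (Fin n)}

theorem Cand.of_below (h : R.Cand S s y) (hx : R.Below s x) (hxy : R.Below x y) : R.Cand S s x :=
  ⟨h.1, hx, fun z hz h₁ h₂ => h.2.2 z hz h₁ (h₂.trans hxy)⟩

theorem cand_self (hs : s ∈ S) : R.Cand S s s :=
  ⟨hs, Below.refl _ _, fun _ _ h₁ h₂ => h₂.antisymm h₁⟩

/-- Completeness of the greedy rule: if all blocks that were refused are too expensive for every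
`c` with `L c`, but there is a partition with costs in `L`, then every sink takes itself. The
block of `s` up to `x` is contained in every part that contains both `s` and `x`. -/
theorem served_of_partition {f : Finset (Fin n) → Fin n → ℝ≥0∞}
    (hf : IsRelaxedMinmaxMonotone T f) (hT : T.IsTree) {L : ℝ≥0∞ → Prop}
    (hL : ∀ c c', c ≤ c' → L c' → L c)
    (hC : ∀ x, ¬ A x → ∀ s, R.Cand S s x → ¬ L (f (R.block A s x) s))
    {Q : Fin n → Finset (Fin n)} (hQ : IsSinkPartition T S Q) (hQL : ∀ s ∈ S, L (f (Q s) s)) :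
    ∀ s ∈ S, A s := by
  have hself : ∀ s ∈ S, s ∈ Q s := fun s hs =>
    (Finset.mem_inter.1 ((hQ.sink s hs).symm ▸ Finset.mem_singleton_self s)).2
  have hcov : ∀ u, ∃ s ∈ S, u ∈ Q s := fun u => by
    have : u ∈ S.biUnion Q := hQ.cover ▸ Finset.mem_univ u
    simpa using this
  have huniq : ∀ u s s', s ∈ S → s' ∈ S → u ∈ Q s → u ∈ Q s' → s = s' := by
    intro u s s' hs hs' h h'
    by_contra hne
    exact Finset.disjoint_left.1 (hQ.disjoint s hs s' hs' hne) h h'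
  have key : ∀ x s, s ∈ S → x ∈ Q s → R.Below s x → A x := by
    intro x
    induction x using R.induction_up with
    | _ x ih =>
      intro s hs hx hsx
      by_contra hA
      -- A part is connected, so it contains the path from its sink up to `x`.
      have hpath : ∀ z, R.Below s z → R.Below z x → z ∈ Q s := by
        have : ∀ j, R.Below (R.par^[j] s) x → R.par^[j] s ∈ Q s := by
          intro j
          induction j with
          | zero => exact fun _ => hself s hs
          | succ j ihj =>
            rw [Function.iterate_succ_apply']
            intro h
            by_cases hb : R.Below x (R.par^[j] s)
            · have h' : R.par (R.par^[j] s) = x :=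
                h.antisymm (hb.trans (R.below_par _))
              rw [h']; exact hx
            · exact par_mem_of_isSubtree (hQ.subtree s hs) (ihj ((R.below_par _).trans h)) hx hb
        rintro z ⟨j, rfl⟩ h
        exact this j h
      have hcand : R.Cand S s x := ⟨hs, hsx, fun z hz h₁ h₂ =>
        huniq z z s hz hs (hself z hz) (hpath z h₁ h₂)⟩
      refine hC x hA s hcand (hL _ _ ?_ (hQL s hs))
      refine hf.set_monotone _ _ _ (isSubtree_block hT hsx) (hQ.subtree s hs)
        (self_mem_block hsx) fun u hu => ?_
      rw [mem_block] at hu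
      induction hu with
      | path h₁ h₂ => exact hpath _ h₁ h₂
      | @hang u hp hAu ihu =>
        by_cases hux : u = x
        · rw [hux]; exact hx
        -- The sink `q` of a hanging vertex `u` is not below `u`, since by induction `u` would be
        -- served. So the part of `q` leaves `u` through the parent, which lies in `Q s`.
        obtain ⟨q, hq, huq⟩ := hcov u
        have hbu : R.Below u x := (R.below_par u).trans hp.below_top
        have hq' : ¬ R.Below q u := fun h => hAu (ih u (hbu.lt hux) q hq huq h)
        have : R.par u ∈ Q q := par_mem_of_isSubtree (hQ.subtree q hq) huq (hself q hq) hq'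
        rwa [huniq _ _ _ hs hq ihu this]
  exact fun s hs => key s s hs (hself s hs) (Below.refl _ _)

end Rooting

/-! ### Key vertices and chains -/

namespace Rooting

variable {n : ℕ} {T : SimpleGraph (Fin n)} (R : Rooting T) (S : Finset (Fin n))

/-- There is a sink below `u`. -/
def Sinkful (u : Fin n) : Prop := ∃ s ∈ S, R.Below s u

open Classical in
/-- The children of `x` with sinks below them. -/
noncomputable def sinkfulKids (x : Fin n) : Finset (Fin n) :=
  Finset.univ.filter fun u => u ≠ R.root ∧ R.par u = x ∧ R.Sinkful S u

/-- Key vertices are sinks and vertices at which paths from sinks to the root meet. -/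
def Key (x : Fin n) : Prop := x ∈ S ∨ 2 ≤ (R.sinkfulKids S x).card

/-- The chain of `v` consists of `v` and the ancestors of `v` below the next key vertex. -/
def OnChain (v x : Fin n) : Prop :=
  ∃ j, R.par^[j] v = x ∧ ∀ i < j, ¬ R.Key S (R.par^[i + 1] v)

variable {R S} {s u v w x : Fin n}

theorem Sinkful.mono (h : R.Sinkful S u) (hux : R.Below u x) : R.Sinkful S x := by
  obtain ⟨s, hs, h⟩ := h
  exact ⟨s, hs, h.trans hux⟩

theorem mem_sinkfulKids :
    u ∈ R.sinkfulKids S x ↔ u ≠ R.root ∧ R.par u = x ∧ R.Sinkful S u := by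
  simp [sinkfulKids]

theorem sinkful_iff : R.Sinkful S x ↔ x ∈ S ∨ 1 ≤ (R.sinkfulKids S x).card := by
  constructor
  · rintro ⟨s, hs, h⟩
    by_cases hsx : s = x
    · exact .inl (hsx ▸ hs)
    · obtain ⟨c, h₁, h₂, h₃⟩ := exists_child_of_below h hsx
      exact .inr (Finset.card_pos.2 ⟨c, mem_sinkfulKids.2 ⟨h₃, h₂, s, hs, h₁⟩⟩)
  · rintro (h | h)
    · exact ⟨x, h, Below.refl _ _⟩
    · obtain ⟨c, hc⟩ := Finset.card_pos.1 h
      obtain ⟨-, rfl, h'⟩ := mem_sinkfulKids.1 hc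
      exact h'.mono (R.below_par c)

theorem Key.sinkful (h : R.Key S v) : R.Sinkful S v :=
  sinkful_iff.2 (h.imp id fun h => by omega)

theorem OnChain.below (h : R.OnChain S v x) : R.Below v x := h.imp fun _ h => h.1

theorem onChain_self : R.OnChain S v v := ⟨0, rfl, by simp⟩

theorem OnChain.sink_below (hr : R.root ∈ S) (hv : R.Key S v) (h : R.OnChain S v x)
    (hs : s ∈ S) (hsx : R.Below s x) : R.Below s v := by
  obtain ⟨j, rfl, hj⟩ := h
  induction j with
  | zero => exact hsx
  | succ j ih =>
    have hk := hj j (by omega)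
    refine ih (fun i hi => hj i (by omega)) ?_
    have hne : s ≠ R.par^[j + 1] v := by
      rintro rfl
      exact hk (.inl hs)
    obtain ⟨c, h₁, h₂, h₃⟩ := exists_child_of_below hsx hne
    have hj' : R.par^[j] v ∈ R.sinkfulKids S (R.par^[j + 1] v) := by
      refine mem_sinkfulKids.2 ⟨fun h => hk ?_, (Function.iterate_succ_apply' _ _ _).symm,
        hv.sinkful.mono ⟨j, rfl⟩⟩
      rw [Function.iterate_succ_apply', h, R.par_root]
      exact .inl hr
    have hc' : c ∈ R.sinkfulKids S (R.par^[j + 1] v) := mem_sinkfulKids.2 ⟨h₃, h₂, s, hs, h₁⟩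
    have : c = R.par^[j] v := by
      refine Finset.card_le_one.1 ?_ _ hc' _ hj'
      exact Nat.lt_succ_iff.1 (not_le.1 fun h => hk (.inr h))
    rwa [← this]

theorem OnChain.eq_of_key (h : R.OnChain S w x) (hwv : R.Below w v) (hvx : R.Below v x)
    (hv : R.Key S v) : v = w := by
  obtain ⟨j, rfl, hj⟩ := h
  obtain ⟨i, rfl⟩ := hwv
  have key : ∀ i ≤ j, R.Key S (R.par^[i] w) → R.par^[i] w = w := by
    intro i hi hk
    cases i with
    | zero => rfl
    | succ i => exact absurd hk (hj i (by omega))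
  rcases le_or_gt i j with h | h
  · exact key i h hv
  · have : R.par^[i] w = R.par^[j] w := hvx.antisymm
      ⟨i - j, by rw [← Function.iterate_add_apply, Nat.sub_add_cancel h.le]⟩
    rw [this] at hv ⊢
    exact key j le_rfl hv

/-- If the chain of `v` meets the subtree of a vertex on the chain of `w`, then `v` is below `w`. -/
theorem OnChain.below_of_below (hr : R.root ∈ S) (hv : R.Key S v) (hw : R.Key S w)
    (hu : R.OnChain S v u) (hx : R.OnChain S w x) (hux : R.Below u x) : R.Below v w := by
  obtain ⟨s, hs, hsv⟩ := hv.sinkful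
  have hvx := hu.below.trans hux
  rcases hsv.total (hx.sink_below hr hw hs (hsv.trans hvx)) with h | h
  · exact h
  · rw [hx.eq_of_key h hvx hv]; exact Below.refl _ _

theorem exists_onChain (hs : s ∈ S) (hsx : R.Below s x) :
    ∃ v, R.Key S v ∧ R.Below s v ∧ R.OnChain S v x := by
  obtain ⟨j, rfl⟩ := hsx
  induction j with
  | zero => exact ⟨s, .inl hs, Below.refl _ _, onChain_self⟩
  | succ j ih =>
    by_cases hk : R.Key S (R.par^[j + 1] s)
    · exact ⟨_, hk, ⟨_, rfl⟩, onChain_self⟩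
    · obtain ⟨v, h₁, h₂, i, hi, h₃⟩ := ih
      refine ⟨v, h₁, h₂, i + 1, by rw [Function.iterate_succ_apply', Function.iterate_succ_apply',
        hi], fun i' hi' => ?_⟩
      rcases Nat.lt_succ_iff_lt_or_eq.1 hi' with h | rfl
      · exact h₃ i' h
      · rwa [Function.iterate_succ_apply', hi, ← Function.iterate_succ_apply' (f := R.par)]

open Classical in
/-- There are at most twice as many key vertices as sinks: count the edges of the subtree formed
by all paths from sinks to the root from their upper ends. -/
theorem card_key_le (hr : R.root ∈ S) :
    (Finset.univ.filter (R.Key S)).card ≤ 2 * S.card := by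
  set F := Finset.univ.filter (R.Sinkful S) with hF
  have hrF : R.root ∈ F := by simp [hF]; exact ⟨_, hr, Below.refl _ _⟩
  have h₁ : (F.erase R.root).card = ∑ x ∈ F, (R.sinkfulKids S x).card := by
    rw [Finset.card_eq_sum_card_fiberwise (f := R.par) (t := F)]
    · refine Finset.sum_congr rfl fun x _ => congrArg _ ?_
      ext u
      rw [mem_sinkfulKids]
      simp [hF]
      tauto
    · intro u hu
      simp [hF] at hu ⊢
      exact hu.1.mono (R.below_par u)
  rw [Finset.card_erase_of_mem hrF] at h₁
  -- A vertex with a sink below it is a sink or has a child with a sink below it, and a key vertex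
  -- that is no sink has two such children.
  have h₂ : ∑ x ∈ F, (1 + if R.Key S x ∧ x ∉ S then 1 else 0) ≤
      ∑ x ∈ F, ((R.sinkfulKids S x).card + if x ∈ S then 1 else 0) := by
    refine Finset.sum_le_sum fun x hx => ?_
    have hx' := (sinkful_iff (R := R) (S := S) (x := x)).1 (by simpa [hF] using hx)
    unfold Key
    by_cases hxS : x ∈ S
    · simp [hxS]
    · simp only [hxS, false_or] at hx' ⊢
      split_ifs <;> simp_all
  rw [Finset.sum_add_distrib, Finset.sum_add_distrib, ← h₁, ← Finset.card_filter,
    ← Finset.card_filter] at h₂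
  simp only [Finset.sum_const, smul_eq_mul, mul_one] at h₂
  have h₃ : (F.filter fun x => x ∈ S).card ≤ S.card :=
    Finset.card_le_card fun x hx => (Finset.mem_filter.1 hx).2
  have h₄ : (Finset.univ.filter (R.Key S)).card ≤
      (F.filter fun x => R.Key S x ∧ x ∉ S).card + S.card := by
    rw [← Finset.card_union_add_card_inter]
    refine (Finset.card_le_card fun x hx => ?_).trans (Nat.le_add_right _ _)
    have hk : R.Key S x := by simpa using hx
    have := hk.sinkful
    simp [hF]; tauto
  omega

end Rooting

/-! ### Listing a block -/

section

variable {n k : ℕ} {I : Input n k}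

/-- The memory describes the rooted tree `R` with the sinks of `I`: the array 6 holds the order of
the vertices, the array 7 the parents, the array 8 marks the sinks, and the array 9 holds the
numbers of children that have sinks below them. -/
structure Env (R : Rooting I.tree) (σ : State) : Prop where
  size : σ.reg 0 = n
  count : σ.reg 1 = k
  sink : ∀ a : Fin k, σ.arr 2 a = I.sink a
  ord : ∀ i : Fin n, σ.arr 6 i = R.ord i
  par : ∀ u : Fin n, σ.arr 7 u = R.par u
  isSink : ∀ u : Fin n, σ.arr 8 u = if u ∈ I.sinks then 1 else 0
  kids : ∀ u : Fin n, σ.arr 9 u = (R.sinkfulKids I.sinks u).card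

/-- The program writes only to registers and arrays from number 20 on. -/
structure IsLocal (p : Program) : Prop where
  reg : ∀ x < 20, ¬ p.writesReg x
  arr : ∀ x < 20, ¬ p.writesArr x

variable {R : Rooting I.tree} {σ σ' : State}

theorem Env.frame (h : Env R σ) {p : Program} (hF : Frame p σ σ') (hp : IsLocal p) : Env R σ' where
  size := by rw [hF.reg 0 (hp.reg _ (by norm_num)), h.size]
  count := by rw [hF.reg 1 (hp.reg _ (by norm_num)), h.count]
  sink := by rw [hF.arr 2 (hp.arr _ (by norm_num))]; exact h.sink
  ord := by rw [hF.arr 6 (hp.arr _ (by norm_num))]; exact h.ord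
  par := by rw [hF.arr 7 (hp.arr _ (by norm_num))]; exact h.par
  isSink := by rw [hF.arr 8 (hp.arr _ (by norm_num))]; exact h.isSink
  kids := by rw [hF.arr 9 (hp.arr _ (by norm_num))]; exact h.kids

theorem Env.setReg (h : Env R σ) {x m : ℕ} (hx : 20 ≤ x) : Env R (σ.setReg x m) :=
  h.frame (p := .set x (.lit m)) ⟨fun y hy => by simp_all, fun _ _ => rfl, fun _ _ => rfl⟩
    ⟨fun y hy => by simp; omega, by simp⟩

theorem Env.setArr (h : Env R σ) {a i m : ℕ} (ha : 20 ≤ a) : Env R (σ.setArr a i m) :=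
  h.frame (p := .store a (.lit i) (.lit m))
    ⟨fun _ _ => rfl, fun y hy => by simp_all, fun _ _ => rfl⟩ ⟨by simp, fun y hy => by simp; omega⟩

theorem Env.setCostReg (h : Env R σ) {x : ℕ} {c : ℝ≥0∞} : Env R (σ.setCostReg x c) :=
  ⟨h.size, h.count, h.sink, h.ord, h.par, h.isSink, h.kids⟩

/-- Given a sink `s` in the register `o + 25` and an ancestor `x` in the register `o + 29`, list
the block of `s` up to `x` in the array `o + 25`, and its length in the register `o + 33`. The
array `o + 20` marks the vertices that can be taken by sinks below them. -/
def listBlock (o : ℕ) : Program :=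
  .seq (forUp (o + 31) 0 (.store (o + 24) (.reg (o + 31)) (.lit 0))) <|
  .seq (.set (o + 30) (.reg (o + 25))) <|
  .seq (.loop (.not (.eq (.reg (o + 30)) (.reg (o + 29))))
    (.seq (.store (o + 24) (.reg (o + 30)) (.lit 1))
      (.set (o + 30) (.arr 7 (.reg (o + 30)))))) <|
  .seq (.store (o + 24) (.reg (o + 29)) (.lit 1)) <|
  .seq (.set (o + 33) (.lit 0)) <|
  forUp (o + 31) 0 <|
    .seq (.set (o + 32) (.arr 6 (.sub (.sub (.reg 0) (.lit 1)) (.reg (o + 31))))) <|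
    .cond (.le (.lit 1) (.add (.arr (o + 24) (.reg (o + 32)))
        (.sub (.arr (o + 24) (.arr 7 (.reg (o + 32)))) (.arr (o + 20) (.reg (o + 32))))))
      (.seq (.store (o + 24) (.reg (o + 32)) (.lit 1)) <|
        .seq (.store (o + 25) (.reg (o + 33)) (.reg (o + 32)))
          (.set (o + 33) (.add (.reg (o + 33)) (.lit 1))))
      .skip

theorem listBlock_writesReg {o x : ℕ} :
    (listBlock o).writesReg x ↔ 30 ≤ x - o ∧ x - o ≤ 33 := by
  simp [listBlock, Test.eq]; omega

theorem listBlock_writesArr {o x : ℕ} :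
    (listBlock o).writesArr x ↔ x = o + 24 ∨ x = o + 25 := by
  simp [listBlock, Test.eq]

theorem listBlock_writesCost {o x : ℕ} : ¬ (listBlock o).writesCost x := by
  simp [listBlock, Test.eq]

theorem listBlock_isLocal (o : ℕ) : IsLocal (listBlock o) :=
  ⟨fun x hx => by rw [listBlock_writesReg]; omega,
    fun x hx => by rw [listBlock_writesArr]; omega⟩

variable {f : Finset (Fin n) → Fin n → ℝ≥0∞} {t : ℕ → ℝ}

open Rooting

theorem one_le_ite_add {P Q A : Prop} [Decidable P] [Decidable Q] [Decidable A] :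
    1 ≤ (if P then 1 else 0) + ((if Q then 1 else 0) - (if A then 1 else 0)) ↔
      P ∨ (Q ∧ ¬ A) := by
  split_ifs <;> simp_all

open Classical in
theorem run_listBlock (hE : Env R σ) {o : ℕ} {s x : Fin n} (hs : σ.reg (o + 25) = s)
    (hx : σ.reg (o + 29) = x) (hsx : R.Below s x) {A : Fin n → Prop}
    (hA : ∀ u : Fin n, σ.arr (o + 20) u = if A u then 1 else 0) {c : ℝ} :
    Run I.tree f t (listBlock o) c σ fun c' σ' => c' ≤ c + 20 * (n + 1) ∧
      σ'.reg (o + 33) ≤ n ∧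
      (Finset.range (σ'.reg (o + 33))).image (σ'.arr (o + 25)) =
        (R.block A s x).image Fin.val := by
  rw [listBlock, run_seq]
  refine Run.forUp (N := n) (fun i c' σ' => c' ≤ c + 1 + 3 * i ∧ ∀ u < i, σ'.arr (o + 24) u = 0)
    hE.size (by omega) (by simp) (by simp) (by simp) ?_ ?_
  · rintro i c' σ' hi hF hreg ⟨hc, h⟩
    rw [run_store]
    refine ⟨by push_cast; linarith, fun u hu => ?_⟩
    simp only [State.setReg_arr, State.setArr_arr, if_true, Function.update_apply, Exp.eval, hreg]
    split_ifs with h'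
    · rfl
    · exact h u (by omega)
  rintro c₁ σ₁ hF₁ ⟨hc₁, hm₁⟩
  have hE₁ : Env R σ₁ := hE.frame hF₁ ⟨by simp; omega, by simp; omega⟩
  have hs₁ : σ₁.reg (o + 25) = s := by rw [hF₁.reg _ (by simp), hs]
  have hx₁ : σ₁.reg (o + 29) = x := by rw [hF₁.reg _ (by simp), hx]
  have hA₁ : ∀ u : Fin n, σ₁.arr (o + 20) u = if A u then 1 else 0 := by
    rw [hF₁.arr _ (by simp)]; exact hA
  rw [run_seq, run_set, run_seq]
  clear hF₁ hE hs hx hA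
  refine Run.loop (fun m c' σ' => ∃ z : Fin n, m + R.ord.symm z = n ∧ σ'.reg (o + 30) = z ∧
    R.Below s z ∧ R.Below z x ∧ c' ≤ c₁ + 2 + 3 * (n - m) ∧
    ∀ u : Fin n, σ'.arr (o + 24) u = if R.Below s u ∧ R.Below u z ∧ u ≠ z then 1 else 0)
    (n - R.ord.symm s) ⟨s, by omega, by simpa using hs₁, Below.refl _ _, hsx, ?_, ?_⟩ ?_ ?_
  · have : ((n - (R.ord.symm s : ℕ) : ℕ) : ℝ) ≤ n := by exact_mod_cast Nat.sub_le _ _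
    linarith
  · intro u
    rw [State.setReg_arr, hm₁ u u.2, if_neg]
    rintro ⟨h₁, h₂, h₃⟩
    exact h₃ (h₂.antisymm h₁)
  · rintro m c' σ' hF ⟨z, hmz, hz, hsz, hzx, hc, hmark⟩ hb
    have hE' : Env R σ' := (hE₁.setReg (by omega)).frame hF
      ⟨fun y hy => by simp; omega, fun y hy => by simp; omega⟩
    have hx' : σ'.reg (o + 29) = x := by rw [hF.reg _ (by simp)]; simpa using hx₁
    have hne : z ≠ x := by
      rintro rfl
      simp [hz, hx'] at hb
    have hzr : z ≠ R.root := by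
      rintro rfl
      exact hne (eq_root_of_root_below hzx).symm
    have hlt : (R.ord.symm z : ℕ) < R.ord.symm (R.par z) := R.ord_lt z hzr
    have := (R.ord.symm (R.par z)).2
    rw [run_seq, run_store, run_set]
    refine ⟨n - R.ord.symm (R.par z), by omega, R.par z, by omega, ?_, hsz.trans (R.below_par _),
      hzx.par_of_ne hne, ?_, fun u => ?_⟩
    · simp [hz, hE'.par]
    · have : ((n - (R.ord.symm (R.par z) : ℕ) : ℕ) : ℝ) + 1 ≤ m := by
        exact_mod_cast (by omega : (n - (R.ord.symm (R.par z) : ℕ) : ℕ) + 1 ≤ m)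
      linarith
    · simp only [Exp.eval, State.setReg_arr, State.setArr_arr, if_true, hz, Function.update_apply,
        hmark, Fin.val_inj]
      have hpz := R.par_ne hzr
      by_cases huz : u = z
      · subst huz
        simp [hsz, R.below_par, hpz.symm]
      · simp only [huz, if_false]
        congr 1
        simp only [ne_eq, not_false_eq_true, and_true, eq_iff_iff, and_congr_right_iff, huz]
        intro hsu
        constructor
        · exact fun h => ⟨h.trans (R.below_par z), fun hu => huz
            (hu ▸ (hu ▸ h : R.Below (R.par z) z).antisymm (R.below_par z))⟩
        · rintro ⟨h₁, h₂⟩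
          rcases hsu.total hsz with h | h
          · exact h
          · exact absurd (h₁.antisymm (h.par_of_ne (Ne.symm huz))) h₂
  rintro m c₂ σ₂ hF₂ ⟨z, hmz, hz, hsz, hzx, hc₂, hmark⟩ hb
  have hE₂ : Env R σ₂ := (hE₁.setReg (by omega)).frame hF₂
    ⟨fun y hy => by simp; omega, fun y hy => by simp; omega⟩
  have hx₂ : σ₂.reg (o + 29) = x := by rw [hF₂.reg _ (by simp)]; simpa using hx₁
  have hA₂ : ∀ u : Fin n, σ₂.arr (o + 20) u = if A u then 1 else 0 := by
    rw [hF₂.arr _ (by simp)]; simpa using hA₁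
  obtain rfl : z = x := by simpa [hz, hx₂, Fin.val_inj] using hb
  have hmn : (0 : ℝ) ≤ m := Nat.cast_nonneg _
  clear hF₂ hb hsz hzx hE₁ hs₁ hx₁ hA₁ hm₁ σ₁ hmz
  rw [run_seq, run_store, run_seq, run_set]
  refine Run.forUp (N := n) (fun i c' σ' => c' ≤ c₂ + 4 + 7 * i ∧ σ'.reg (o + 33) ≤ i ∧
    (∀ u : Fin n, σ'.arr (o + 24) u =
      if (R.Below s u ∧ R.Below u z) ∨ (R.Block A s z u ∧ n ≤ i + R.ord.symm u) then 1 else 0) ∧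
    (Finset.range (σ'.reg (o + 33))).image (σ'.arr (o + 25)) =
      ((R.block A s z).filter fun u => n ≤ i + R.ord.symm u).image Fin.val)
    (by simpa using hE₂.size) (by omega) (by simp) (by simp) ?_ ?_ ?_
  · refine ⟨by norm_num; linarith, by simp, fun u => ?_, ?_⟩
    · have h₁ : ¬ n ≤ 0 + (R.ord.symm u : ℕ) := by have := (R.ord.symm u).2; omega
      simp only [Exp.eval, State.setReg_arr, State.setArr_arr, if_true, hx₂, h₁, and_false,
        or_false, Function.update_apply, hmark, Fin.val_inj]
      by_cases huz : u = z
      · subst huz; simp [hsx, Below.refl]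
      · simp [huz]
    · simp only [Exp.eval, State.setReg_reg]
      symm
      simp only [if_true]
      simp [Finset.filter_eq_empty_iff]
  · rintro i c' σ' hi hF hreg ⟨hc, hlen, hmk, himg⟩
    have hE' : Env R σ' := ((hE₂.setArr (by omega)).setReg (by omega)).frame hF
      ⟨fun y hy => by simp; omega, fun y hy => by simp; omega⟩
    have hA' : ∀ u : Fin n, σ'.arr (o + 20) u = if A u then 1 else 0 := by
      rw [hF.arr _ (by simp)]; simpa using hA₂
    obtain ⟨u, hu⟩ : ∃ u : Fin n, (R.ord.symm u : ℕ) = n - 1 - i :=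
      ⟨R.ord ⟨n - 1 - i, by omega⟩, by simp⟩
    have hord : σ'.arr 6 (n - 1 - i) = u := by
      rw [← hu, hE'.ord (R.ord.symm u)]; simp
    rw [run_seq, run_set]
    simp only [Exp.eval, hE'.size, hreg, hord]
    have hcond : (1 ≤ σ'.arr (o + 24) u + (σ'.arr (o + 24) (R.par u) - σ'.arr (o + 20) u)) ↔
        R.Block A s z u := by
      have h₁ : ¬ n ≤ i + (R.ord.symm u : ℕ) := by omega
      rw [hmk, hmk, hA', one_le_ite_add]
      simp only [h₁, and_false, or_false]
      by_cases hur : u = R.root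
      · rw [hur, R.par_root, ← hur]
        simp only [h₁, and_false, or_false]
        constructor
        · rintro (h | h)
          exacts [.path h.1 h.2, .path h.1.1 h.1.2]
        · intro h
          have h' := h.below_top
          rw [hur] at h'
          rw [hur, ← eq_root_of_root_below h']
          exact .inl ⟨hsx, Below.refl _ _⟩
      · have hlt : (R.ord.symm u : ℕ) < R.ord.symm (R.par u) := R.ord_lt u hur
        have h₂ : n ≤ i + (R.ord.symm (R.par u) : ℕ) := by omega
        simp only [h₂, and_true]
        constructor
        · rintro (h | ⟨h | h, h'⟩)
          exacts [.path h.1 h.2, .hang (.path h.1 h.2) h', .hang h h']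
        · intro h
          cases h with
          | path h₁ h₂ => exact .inl ⟨h₁, h₂⟩
          | hang h h' => exact .inr ⟨.inr h, h'⟩
    have hstep : ∀ v : Fin n, n ≤ i + 1 + (R.ord.symm v : ℕ) ↔
        v = u ∨ n ≤ i + (R.ord.symm v : ℕ) := by
      intro v
      constructor
      · intro h
        by_cases h' : n ≤ i + (R.ord.symm v : ℕ)
        · exact .inr h'
        · exact .inl (R.ord.symm.injective (Fin.ext (by omega)))
      · rintro (rfl | h) <;> omega
    rw [run_cond]
    simp only [Test.holds, Exp.eval, State.setReg_arr, State.setReg_reg, if_true, hE'.par, hcond]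
    constructor
    · intro hB
      simp only [run_seq, run_store, run_set]
      simp only [Exp.eval, State.setReg_arr, State.setReg_reg, State.setArr_arr, State.setArr_reg,
        if_true, Nat.add_left_cancel_iff, Nat.reduceEqDiff, if_false]
      refine ⟨by push_cast; linarith, by omega, fun v => ?_, ?_⟩
      · simp only [Function.update_apply, Fin.val_inj, hmk, hstep]
        by_cases hvu : v = u
        · subst hvu; simp [hB]
        · simp [hvu]
      · rw [Finset.range_add_one, Finset.image_insert, Function.update_self]
        have h₁ : (Finset.range (σ'.reg (o + 33))).image
            (Function.update (σ'.arr (o + 25)) (σ'.reg (o + 33)) u) =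
            (Finset.range (σ'.reg (o + 33))).image (σ'.arr (o + 25)) := by
          refine Finset.image_congr fun l hl => ?_
          rw [Function.update_of_ne (by have := Finset.mem_range.1 (Finset.mem_coe.1 hl); omega)]
        rw [h₁, himg, ← Finset.image_insert]
        congr 1
        ext v
        simp only [Finset.mem_insert, Finset.mem_filter, mem_block, hstep]
        constructor
        · rintro (rfl | h)
          exacts [⟨hB, .inl rfl⟩, ⟨h.1, .inr h.2⟩]
        · rintro ⟨h, rfl | h'⟩
          exacts [.inl rfl, .inr ⟨h, h'⟩]
    · intro hB
      rw [run_skip]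
      simp only [State.setReg_arr, State.setReg_reg, Nat.reduceEqDiff]
      refine ⟨by push_cast; linarith, by simp; omega, fun v => ?_, ?_⟩
      · rw [hmk]
        congr 1
        simp only [hstep, eq_iff_iff]
        by_cases hvu : v = u
        · subst hvu; simp [hB]
        · simp [hvu]
      · simp
        rw [himg]
        congr 1
        ext v
        simp only [Finset.mem_filter, mem_block, hstep]
        constructor
        · rintro ⟨h, h'⟩
          exact ⟨h, .inr h'⟩
        · rintro ⟨h, rfl | h'⟩
          exacts [absurd h hB, ⟨h, h'⟩]
  · rintro c' σ' hF ⟨hc, hlen, -, himg⟩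
    refine ⟨by nlinarith, hlen, ?_⟩
    rw [himg]
    congr 1
    exact Finset.filter_true_of_mem fun v _ => by omega

end

/-! ### The search along a chain -/

section

variable {n k : ℕ} {I : Input n k}

/-- The program `cmp` decides, in time `K`, whether the cost in the register `o + 20` is
acceptable, and puts 1 or 0 into the register `o + 34`. After the answer 1 the cost satisfies
`Yes`, and after the answer 0 it satisfies `No h`, where `h` is the content of the cost register
`q`. This content may decrease, but keeps the property `G`. -/
structure IsCmp (R : Rooting I.tree) (f : Finset (Fin n) → Fin n → ℝ≥0∞) (t : ℕ → ℝ) (o q : ℕ)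
    (cmp : Program) (K : ℝ) (Yes : ℝ≥0∞ → Prop) (No : ℝ≥0∞ → ℝ≥0∞ → Prop) (G : ℝ≥0∞ → Prop) :
    Prop where
  reg : ∀ x, cmp.writesReg x → x = o + 34 ∨ o + 50 ≤ x
  arr : ∀ x, cmp.writesArr x → o + 50 ≤ x
  q_lt : q < 20
  yes_anti : ∀ c c', c ≤ c' → Yes c' → Yes c
  no_mono : ∀ h c c', c ≤ c' → No h c → No h c'
  no_anti : ∀ h h' c, h' ≤ h → No h c → No h' c
  run : ∀ σ c, Env R σ → G (σ.costReg q) → Run I.tree f t cmp c σ fun c' σ' =>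
    c' ≤ c + K ∧ σ'.costReg q ≤ σ.costReg q ∧ G (σ'.costReg q) ∧
      (σ'.reg (o + 34) = 1 ∧ Yes (σ.costReg (o + 20)) ∨
        σ'.reg (o + 34) = 0 ∧ No (σ'.costReg q) (σ.costReg (o + 20)))

/-- One step of the binary search. -/
def probe (o : ℕ) (cmp : Program) : Program :=
  .seq (.set (o + 28) (.half (.add (.reg (o + 26)) (.reg (o + 27))))) <|
  .seq (.set (o + 29) (.arr (o + 23) (.reg (o + 28)))) <|
  .seq (listBlock o) <|
  .seq (.query (o + 20) (o + 25) (.reg (o + 33)) (.reg (o + 25))) <|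
  .seq cmp <|
  .cond (.eq (.reg (o + 34)) (.lit 1))
    (.set (o + 26) (.add (.reg (o + 28)) (.lit 1)))
    (.set (o + 27) (.reg (o + 28)))

/-- The array `o + 23` holds a chain whose length is in the register `o + 22`. Find by binary
search how many vertices on the chain can be taken by the sink with the number in the register
`o + 24`, mark them in the array `o + 20`, and record the sink in the array `o + 21`. -/
def search (o : ℕ) (cmp : Program) : Program :=
  .seq (.set (o + 25) (.arr 2 (.reg (o + 24)))) <|
  .seq (.set (o + 26) (.lit 0)) <|
  .seq (.set (o + 27) (.reg (o + 22))) <|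
  .seq (.loop (.lt (.reg (o + 26)) (.reg (o + 27))) (probe o cmp)) <|
  forUp (o + 31) (o + 26) <|
    .seq (.store (o + 20) (.arr (o + 23) (.reg (o + 31))) (.lit 1))
      (.store (o + 21) (.arr (o + 23) (.reg (o + 31))) (.reg (o + 25)))

variable {R : Rooting I.tree} {f : Finset (Fin n) → Fin n → ℝ≥0∞} {t : ℕ → ℝ} {o q : ℕ}
  {cmp : Program} {K : ℝ} {Yes : ℝ≥0∞ → Prop} {No : ℝ≥0∞ → ℝ≥0∞ → Prop} {G : ℝ≥0∞ → Prop}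

theorem IsCmp.probe_writesReg (hc : IsCmp R f t o q cmp K Yes No G) {x : ℕ}
    (h : (probe o cmp).writesReg x) : (o + 26 ≤ x ∧ x ≤ o + 34) ∨ o + 50 ≤ x := by
  have := hc.reg x
  simp only [probe, Program.writesReg, listBlock_writesReg, false_or] at h
  by_cases hx : cmp.writesReg x
  · have := this hx; omega
  · simp only [hx, false_or] at h; omega

theorem IsCmp.probe_writesArr (hc : IsCmp R f t o q cmp K Yes No G) {x : ℕ}
    (h : (probe o cmp).writesArr x) : x = o + 24 ∨ x = o + 25 ∨ o + 50 ≤ x := by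
  have := hc.arr x
  simp only [probe, Program.writesArr, listBlock_writesArr, false_or, or_false] at h
  tauto

theorem IsCmp.search_writesReg (hc : IsCmp R f t o q cmp K Yes No G) {x : ℕ}
    (h : (search o cmp).writesReg x) : (o + 25 ≤ x ∧ x ≤ o + 34) ∨ o + 50 ≤ x := by
  simp only [search, Program.writesReg, forUp_writesReg, or_false] at h
  by_cases hx : (probe o cmp).writesReg x
  · have := hc.probe_writesReg hx; omega
  · simp only [hx, false_or] at h; omega

theorem IsCmp.search_writesArr (hc : IsCmp R f t o q cmp K Yes No G) {x : ℕ}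
    (h : (search o cmp).writesArr x) :
    x = o + 20 ∨ x = o + 21 ∨ x = o + 24 ∨ x = o + 25 ∨ o + 50 ≤ x := by
  simp only [search, Program.writesArr, forUp_writesArr, false_or] at h
  by_cases hx : (probe o cmp).writesArr x
  · have := hc.probe_writesArr hx; omega
  · simp only [hx, false_or] at h; omega

/-- The time that `probe` needs if oracle calls take time `τ`, and comparisons time `K`. -/
noncomputable def probeTime (n : ℕ) (τ K : ℝ) : ℝ := 20 * (n + 1) + τ + K + 10

/-- The time that `search` needs if oracle calls take time `τ`, and comparisons time `K`. -/
noncomputable def searchTime (n : ℕ) (τ K : ℝ) : ℝ := Nat.size n * probeTime n τ K + 4 * n + 10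

open Rooting Classical in
theorem run_search (hf : IsRelaxedMinmaxMonotone I.tree f) (hc : IsCmp R f t o q cmp K Yes No G)
    {τ : ℝ} (hτ : ∀ m ≤ n, t m ≤ τ) (hτ0 : 0 ≤ τ) (hK : 0 ≤ K) {σ : State} (hE : Env R σ) {m : ℕ}
    (hmn : m ≤ n) (hm : σ.reg (o + 22) = m) {a : Fin k} (ha : σ.reg (o + 24) = a) {v : Fin n}
    (hch : ∀ j < m, σ.arr (o + 23) j = R.par^[j] v) (hv : R.Below (I.sink a) v)
    {A : Fin n → Prop} (hA : ∀ u : Fin n, σ.arr (o + 20) u = if A u then 1 else 0)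
    (hG : G (σ.costReg q)) {c : ℝ} :
    Run I.tree f t (search o cmp) c σ fun c' σ' => c' ≤ c + searchTime n τ K ∧
      σ'.costReg q ≤ σ.costReg q ∧ G (σ'.costReg q) ∧ ∃ l ≤ m,
      (∀ u : Fin n, σ'.arr (o + 20) u = if A u ∨ ∃ j < l, R.par^[j] v = u then 1 else 0) ∧
      (∀ u : Fin n, σ'.arr (o + 21) u =
        if ∃ j < l, R.par^[j] v = u then (I.sink a : ℕ) else σ.arr (o + 21) u) ∧
      (∀ j < l, Yes (f (R.block A (I.sink a) (R.par^[j] v)) (I.sink a))) ∧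
      (l < m → No (σ'.costReg q) (f (R.block A (I.sink a) (R.par^[l] v)) (I.sink a))) := by
  have hbel : ∀ j, R.Below (I.sink a) (R.par^[j] v) := fun j => hv.trans ⟨j, rfl⟩
  have hq := hc.q_lt
  rw [search]
  simp only [run_seq, run_set]
  simp only [Exp.eval, State.setReg_arr, State.setReg_reg, Nat.reduceEqDiff, left_eq_add,
    add_eq_left, OfNat.ofNat_ne_zero, one_ne_zero, ha, hm, hE.sink, if_false]
  set σ₀ := ((σ.setReg (o + 25) (I.sink a)).setReg (o + 26) 0).setReg (o + 27) m with hσ₀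
  have hE₀ : Env R σ₀ := ((hE.setReg (by omega)).setReg (by omega)).setReg (by omega)
  have hprobe : ∀ {σ'}, Frame (probe o cmp) σ₀ σ' → Env R σ' ∧ σ'.reg (o + 25) = I.sink a ∧
      σ'.arr (o + 23) = σ.arr (o + 23) ∧ σ'.arr (o + 20) = σ.arr (o + 20) ∧
      σ'.arr (o + 21) = σ.arr (o + 21) := by
    intro σ' hF
    refine ⟨hE₀.frame hF ⟨fun x hx h => ?_, fun x hx h => ?_⟩, ?_, ?_, ?_, ?_⟩
    · have := hc.probe_writesReg h; omega
    · have := hc.probe_writesArr h; omega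
    · rw [hF.reg _ fun h => by have := hc.probe_writesReg h; omega]
      simp [hσ₀]
    all_goals
      rw [hF.arr _ fun h => by have := hc.probe_writesArr h; omega]
      simp [hσ₀]
  -- Each probe halves the interval from `lo` to `hi`; at most `e` more probes are needed.
  refine Run.loop (fun e c' σ' => e ≤ Nat.size n ∧ c' ≤ c + 3 + (Nat.size n - e) * probeTime n τ K ∧
    σ'.costReg q ≤ σ.costReg q ∧ G (σ'.costReg q) ∧ ∃ lo hi, σ'.reg (o + 26) = lo ∧
    σ'.reg (o + 27) = hi ∧ lo ≤ hi ∧ hi ≤ m ∧ hi - lo < 2 ^ e ∧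
    (∀ j < lo, Yes (f (R.block A (I.sink a) (R.par^[j] v)) (I.sink a))) ∧
    (hi < m → No (σ'.costReg q) (f (R.block A (I.sink a) (R.par^[hi] v)) (I.sink a))))
    (Nat.size n) ⟨le_rfl, by simp; linarith, by simp [hσ₀], by simpa [hσ₀] using hG, 0, m,
      by simp [hσ₀], by simp [hσ₀], by omega, le_rfl, ?_, by simp, by simp⟩ ?_ ?_
  · exact (Nat.sub_le _ _).trans_lt (hmn.trans_lt (Nat.lt_size_self n))
  · rintro e c' σ' hF ⟨heN, hc', hh, hG', lo, hi, hlo, hhi, hlohi, him, he, hyes, hno⟩ hb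
    obtain ⟨hE', hs', hch', hA', hw'⟩ := hprobe hF
    simp only [Test.lt_holds, Exp.eval, hlo, hhi] at hb
    rw [probe]
    simp only [run_seq, run_set]
    simp only [Exp.eval, State.setReg_arr, State.setReg_reg, if_true, Nat.reduceEqDiff, left_eq_add,
      add_eq_left, OfNat.ofNat_ne_zero, one_ne_zero, if_false, hlo, hhi]
    set mid := (lo + hi) / 2 with hmid
    have hmidm : mid < m := by omega
    have hbuild := run_listBlock (f := f) (t := t) (o := o) (s := I.sink a) (x := R.par^[mid] v)
      (σ := (σ'.setReg (o + 28) mid).setReg (o + 29) (σ'.arr (o + 23) mid)) (c := c' + 1 + 1 + 1)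
      ((hE'.setReg (by omega)).setReg (by omega)) (by simpa using hs')
      (by simp [hch', hch mid hmidm]) (hbel mid) (A := A) (by simpa [hA'] using hA)
    refine hbuild.mono ?_
    rintro c₁ σ₁ hF₁ ⟨hc₁, hlen, himg⟩
    have hE₁ : Env R σ₁ := ((hE'.setReg (by omega)).setReg (by omega)).frame hF₁
      (listBlock_isLocal o)
    have hr₁ : ∀ x, x < o + 30 → σ₁.reg x = _ := fun x hx => hF₁.reg x (by
      rw [listBlock_writesReg]; omega)
    refine run_query (R.block A (I.sink a) (R.par^[mid] v)) (I.sink a) himg.symm ?_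
      (isSubtree_block I.isTree (hbel mid)) (self_mem_block (hbel mid)) ?_
    · simp [hr₁ (o + 25), hs']
    have hcost₁ : σ₁.costReg = σ'.costReg := by
      funext x
      rw [hF₁.cost x listBlock_writesCost]
      rfl
    have hqo : q ≠ o + 20 := by omega
    refine (hc.run _ _ hE₁.setCostReg (by simpa [hqo, hcost₁] using hG')).mono ?_
    rintro c₂ σ₂ hF₂ ⟨hc₂, hh₂, hG₂, hres⟩
    simp only [State.setCostReg_costReg, hqo, if_false, hcost₁, if_true] at hh₂ hres
    have ht : t (σ₁.reg (o + 33)) ≤ τ := hτ _ hlen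
    have hr₂ : ∀ x, x < o + 30 → σ₂.reg x = _ := fun x hx =>
      (hF₂.reg x fun h => by have := hc.reg x h; omega).trans (hr₁ x hx)
    have he0 : e ≠ 0 := by
      rintro rfl
      simp at he; omega
    obtain ⟨e, rfl⟩ := Nat.exists_eq_succ_of_ne_zero he0
    have hP : 0 ≤ probeTime n τ K := by unfold probeTime; positivity
    have htime : c₂ + 1 + 1 ≤ c + 3 + (Nat.size n - e) * probeTime n τ K := by
      simp only [Exp.eval] at hc₂
      push_cast at hc'
      have : (Nat.size n - (e : ℝ)) * probeTime n τ K =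
        (Nat.size n - ((e : ℝ) + 1)) * probeTime n τ K + probeTime n τ K := by ring
      rw [this]
      simp only [probeTime] at *
      linarith
    rw [run_cond, run_set, run_set]
    rw [pow_succ] at he
    have hmidr : σ₂.reg (o + 28) = mid := by simp [hr₂ (o + 28)]
    have hlo₂ : σ₂.reg (o + 26) = lo := by simp [hr₂ (o + 26), hlo]
    have hhi₂ : σ₂.reg (o + 27) = hi := by simp [hr₂ (o + 27), hhi]
    constructor
    · intro hflag
      have hY := hres.resolve_right (by simp at hflag; simp [hflag])
      refine ⟨e, by omega, by omega, by linarith, ?_, ?_, mid + 1, hi, ?_, ?_, ?_, him, ?_, ?_, ?_⟩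
      · exact hh₂.trans hh
      · exact hG₂
      · simp [hmidr]
      · simp [hhi₂]
      · omega
      · omega
      · intro j hj
        refine hc.yes_anti _ _ (cost_block_mono hf I.isTree (hbel j) ⟨mid - j, ?_⟩) hY.2
        rw [← Function.iterate_add_apply, Nat.sub_add_cancel (by omega)]
      · exact fun h => hc.no_anti _ _ _ hh₂ (hno h)
    · intro hflag
      have hY := hres.resolve_left (by simp at hflag; simp [hflag])
      refine ⟨e, by omega, by omega, by linarith, ?_, ?_, lo, mid, ?_, ?_, ?_, hmidm.le, ?_, hyes,
        ?_⟩
      · exact hh₂.trans hh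
      · exact hG₂
      · simp [hlo₂]
      · simp [hmidr]
      · omega
      · omega
      · exact fun _ => hY.2
  · rintro e c' σ' hF ⟨heN, hc', hh, hG', lo, hi, hlo, hhi, hlohi, him, he, hyes, hno⟩ hb
    obtain ⟨hE', hs', hch', hA', hw'⟩ := hprobe hF
    simp only [Test.lt_holds, Exp.eval, hlo, hhi] at hb
    obtain rfl : lo = hi := by omega
    refine Run.forUp (N := lo) (fun i c'' σ'' => c'' ≤ c' + 2 + 4 * i ∧
      (∀ u : Fin n, σ''.arr (o + 20) u = if A u ∨ ∃ j < i, R.par^[j] v = u then 1 else 0) ∧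
      (∀ u : Fin n, σ''.arr (o + 21) u =
        if ∃ j < i, R.par^[j] v = u then (I.sink a : ℕ) else σ.arr (o + 21) u))
      hlo (by omega) (by simp) (by simp) ?_ ?_ ?_
    · refine ⟨by simp; linarith, by simpa [hA'] using hA, by simp [hw']⟩
    · rintro i c'' σ'' hi hF'' hreg ⟨hc'', hA'', hw''⟩
      have h23 : σ''.arr (o + 23) i = R.par^[i] v := by
        rw [hF''.arr _ (by simp), hch', hch i (by omega)]
      have h25 : σ''.reg (o + 25) = I.sink a := by
        rw [hF''.reg _ (by simp), hs']
      rw [run_seq, run_store, run_store]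
      simp only [Exp.eval, State.setReg_arr, State.setArr_arr, if_true, Nat.reduceEqDiff, left_eq_add,
        add_eq_left, OfNat.ofNat_ne_zero, one_ne_zero, if_false, hreg, h23, h25,
        Function.update_apply, Fin.val_inj, State.setArr_reg, hA'', hw'', Nat.lt_succ_iff_lt_or_eq]
      refine ⟨by push_cast; linarith, fun u => ?_, fun u => ?_⟩
      · by_cases hu : u = R.par^[i] v
        · rw [if_pos hu, if_pos (.inr ⟨i, .inr rfl, hu.symm⟩)]
        · rw [if_neg hu]
          congr 1
          simp only [eq_iff_iff]
          refine or_congr_right (exists_congr fun j => and_congr_left fun hj => ?_)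
          refine ⟨.inl, Or.rec id ?_⟩
          rintro rfl
          exact absurd hj.symm hu
      · by_cases hu : u = R.par^[i] v
        · rw [if_pos hu, if_pos ⟨i, .inr rfl, hu.symm⟩]
        · rw [if_neg hu]
          congr 1
          simp only [eq_iff_iff]
          refine exists_congr fun j => and_congr_left fun hj => ?_
          refine ⟨.inl, Or.rec id ?_⟩
          rintro rfl
          exact absurd hj.symm hu
    · rintro c'' σ'' hF'' ⟨hc'', hA'', hw''⟩
      have hcost : σ''.costReg = σ'.costReg := by
        funext x
        exact hF''.cost x (by simp)
      rw [hcost]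
      refine ⟨?_, hh, hG', lo, him, hA'', hw'', hyes, hno⟩
      have hlon : (lo : ℝ) ≤ n := by exact_mod_cast him.trans hmn
      have hP : 0 ≤ (e : ℝ) * probeTime n τ K := by unfold probeTime; positivity
      unfold searchTime
      linarith

end

/-! ### Processing a key vertex -/

/-- The test whether a vertex is a key vertex. The array 8 marks the sinks, and the array 9 counts
the children with sinks below them; a sink is counted twice so that it passes in any case. -/
def keyTest (e : Exp) : Test := .le (.lit 2) (.add (.add (.arr 8 e) (.arr 8 e)) (.arr 9 e))

/-- Put the chain of the vertex in the register `o + 21` into the array `o + 23`, its length into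
the register `o + 22`, and its upper end into the register `o + 23`. -/
def listChain (o : ℕ) : Program :=
  .seq (.set (o + 23) (.reg (o + 21))) <|
  .seq (.store (o + 23) (.lit 0) (.reg (o + 21))) <|
  .seq (.set (o + 22) (.lit 1)) <|
  .loop (.not (keyTest (.arr 7 (.reg (o + 23))))) <|
    .seq (.set (o + 23) (.arr 7 (.reg (o + 23)))) <|
    .seq (.store (o + 23) (.reg (o + 22)) (.reg (o + 23))) <|
    .set (o + 22) (.add (.reg (o + 22)) (.lit 1))

section

variable {n k : ℕ} {I : Input n k} {R : Rooting I.tree}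
  {f : Finset (Fin n) → Fin n → ℝ≥0∞} {t : ℕ → ℝ} {o q : ℕ}
  {cmp : Program} {K : ℝ} {Yes : ℝ≥0∞ → Prop} {No : ℝ≥0∞ → ℝ≥0∞ → Prop} {G : ℝ≥0∞ → Prop}

open Rooting

theorem Env.keyTest {σ : State} (hE : Env R σ) {e : Exp} {u : Fin n} (he : e.eval σ = u) :
    (keyTest e).holds σ ↔ R.Key I.sinks u := by
  simp only [SinkPartition.keyTest, Test.holds, Exp.eval, he, hE.isSink, hE.kids, Key]
  split_ifs <;> simp_all

theorem Rooting.block_stable {A A' : Fin n → Prop} {s v w x : Fin n} (hr : R.root ∈ I.sinks)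
    (hv : R.Key I.sinks v) (hw : R.Key I.sinks w) (hwv : R.ord.symm w ≤ R.ord.symm v)
    (hx : R.OnChain I.sinks w x) (hs : s ∈ I.sinks) (hsx : R.Below s x)
    (hoff : ∀ u, ¬ R.OnChain I.sinks v u → (A u ↔ A' u)) : R.block A s x = R.block A' s x := by
  refine block_congr fun u hux hsu => hoff u fun hu => hsu ?_
  have h := hu.below_of_below hr hv hw hx hux
  obtain rfl : v = w := R.ord.symm.injective (le_antisymm h.le hwv)
  exact (hx.sink_below hr hv hs hsx).trans hu.below

theorem Rooting.Cand.onChain {s v x : Fin n} (hr : R.root ∈ I.sinks) (hv : R.Key I.sinks v)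
    (h : R.Cand I.sinks s v) (hx : R.OnChain I.sinks v x) : R.Cand I.sinks s x :=
  ⟨h.1, h.2.1.trans hx.below, fun z hz h₁ h₂ => h.2.2 z hz h₁ (hx.sink_below hr hv hz h₂)⟩

theorem run_listChain {σ : State} (hE : Env R σ) (hr : R.root ∈ I.sinks) {v : Fin n}
    (hv : σ.reg (o + 21) = v) {c : ℝ} :
    Run I.tree f t (listChain o) c σ fun c' σ' => c' ≤ c + 4 * n + 4 ∧ ∃ m ≤ n, 1 ≤ m ∧
      σ'.reg (o + 22) = m ∧ (∀ j < m, σ'.arr (o + 23) j = R.par^[j] v) ∧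
      σ'.reg (o + 23) = R.par^[m - 1] v ∧ (∀ j < m, 0 < j → ¬ R.Key I.sinks (R.par^[j] v)) ∧
      R.Key I.sinks (R.par^[m] v) := by
  rw [listChain]
  simp only [run_seq, run_set, run_store]
  simp only [Exp.eval, State.setReg_arr, State.setReg_reg, State.setArr_reg, Nat.reduceEqDiff,
    left_eq_add, add_eq_left, OfNat.ofNat_ne_zero, one_ne_zero, if_false, hv]
  refine Run.loop (fun e c' σ' => ∃ m : ℕ, 1 ≤ m ∧ c' ≤ c + 4 * m ∧
    m ≤ R.ord.symm (R.par^[m - 1] v) + 1 ∧ e = n - R.ord.symm (R.par^[m - 1] v) ∧ σ'.reg (o + 22) = m ∧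
    (∀ j < m, σ'.arr (o + 23) j = R.par^[j] v) ∧
    σ'.reg (o + 23) = R.par^[m - 1] v ∧ (∀ j < m, 0 < j → ¬ R.Key I.sinks (R.par^[j] v)))
    (n - R.ord.symm v) ⟨1, le_rfl, by norm_num; linarith, by simp, by simp, by simp, by simp,
      by simp, by omega⟩ ?_ ?_
  all_goals
    rintro e c' σ' hF ⟨m, hm, hc', hme, he, hrm, hch, hy, hno⟩ hb
    have hE' : Env R σ' := (((hE.setReg (by omega)).setArr (by omega)).setReg (by omega)).frame hF
      ⟨fun x hx => by simp; omega, fun x hx => by simp; omega⟩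
    rw [Test.holds, hE'.keyTest (u := R.par^[m] v)
      (by simp only [Exp.eval, hy, hE'.par]
          rw [← Function.iterate_succ_apply' (f := R.par), Nat.succ_eq_add_one,
            Nat.sub_add_cancel hm])] at hb
  · have hpar : R.par (R.par^[m - 1] v) = R.par^[m] v := by
      rw [← Function.iterate_succ_apply' (f := R.par), Nat.succ_eq_add_one, Nat.sub_add_cancel hm]
    have hne : R.par^[m - 1] v ≠ R.root := by
      intro h
      rw [← hpar, h, R.par_root] at hb
      exact hb (.inl hr)
    have hlt : (R.ord.symm (R.par^[m - 1] v) : ℕ) < R.ord.symm (R.par^[m] v) := by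
      rw [← hpar]; exact R.ord_lt _ hne
    have := (R.ord.symm (R.par^[m] v)).2
    simp only [run_seq, run_set, run_store]
    refine ⟨n - R.ord.symm (R.par^[m] v), by omega, m + 1, by omega, by push_cast; linarith, ?_, ?_,
      ?_, ?_, ?_, ?_⟩
    · simp only [Nat.add_sub_cancel]; omega
    · simp
    · simp [hrm]
    · intro j hj
      simp only [Exp.eval, State.setReg_arr, State.setArr_arr, if_true, State.setReg_reg, hrm, hy,
        Nat.reduceEqDiff, left_eq_add, add_eq_left, OfNat.ofNat_ne_zero, one_ne_zero, if_false,
        Function.update_apply, hE'.par, hpar]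
      split_ifs with h
      · rw [h]
      · exact hch j (by omega)
    · simp [hy, hE'.par, hpar]
    · intro j hj h0
      rcases Nat.lt_succ_iff_lt_or_eq.1 hj with h | rfl
      · exact hno j h h0
      · exact hb
  · have := (R.ord.symm (R.par^[m - 1] v)).2
    have hmn : m ≤ n := by omega
    have : (m : ℝ) ≤ n := by exact_mod_cast hmn
    exact ⟨by linarith, m, hmn, hm, hrm, hch, hy, hno, not_not.1 hb⟩

/-- Let the sinks that wait at the vertex in the register `o + 21` (a sink with number `a` waits
at the vertex in the cell `a` of the array `o + 22`) take vertices on its chain, until one of them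
takes the whole chain; this sink and those not tried move to the next key vertex, unless this is a
sink, where no other sink can go on: then the number `n`, which is no vertex, is stored. -/
def process (o : ℕ) (cmp : Program) : Program :=
  .seq (listChain o) <|
  forUp (o + 24) 1 <|
    .cond (.eq (.arr (o + 22) (.reg (o + 24))) (.reg (o + 21)))
      (.seq (.cond (.eq (.arr (o + 20) (.reg (o + 23))) (.lit 0)) (search o cmp) .skip) <|
        .cond (.eq (.arr (o + 20) (.reg (o + 23))) (.lit 1))
          (.cond (.le (.lit 1) (.arr 8 (.arr 7 (.reg (o + 23)))))
            (.store (o + 22) (.reg (o + 24)) (.reg 0))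
            (.store (o + 22) (.reg (o + 24)) (.arr 7 (.reg (o + 23)))))
          .skip)
      .skip

theorem listChain_writesReg {x : ℕ} :
    (listChain o).writesReg x ↔ x = o + 22 ∨ x = o + 23 := by
  simp [listChain]; tauto

theorem listChain_writesArr {x : ℕ} : (listChain o).writesArr x ↔ x = o + 23 := by
  simp [listChain]

theorem listChain_writesCost {x : ℕ} : ¬ (listChain o).writesCost x := by simp [listChain]

theorem IsCmp.process_writesReg (hc : IsCmp R f t o q cmp K Yes No G) {x : ℕ}
    (h : (process o cmp).writesReg x) : (o + 22 ≤ x ∧ x ≤ o + 34) ∨ o + 50 ≤ x := by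
  simp only [process, Program.writesReg, forUp_writesReg, or_false, listChain_writesReg] at h
  by_cases hx : (search o cmp).writesReg x
  · have := hc.search_writesReg hx; omega
  · simp only [hx, false_or, or_false] at h; omega

theorem IsCmp.process_writesArr (hc : IsCmp R f t o q cmp K Yes No G) {x : ℕ}
    (h : (process o cmp).writesArr x) : (o + 20 ≤ x ∧ x ≤ o + 25) ∨ o + 50 ≤ x := by
  simp only [process, Program.writesArr, forUp_writesArr, or_false, listChain_writesArr] at h
  by_cases hx : (search o cmp).writesArr x
  · have := hc.search_writesArr hx; omega
  · simp only [hx, false_or, or_false] at h; omega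

/-- The effect of treating the first `a₀` sinks when the key vertex `v`, whose chain ends with
`y`, is processed. The set of marked vertices was `A₀` and is now `A`. -/
structure ProcessInv (R : Rooting I.tree) (f : Finset (Fin n) → Fin n → ℝ≥0∞) (o : ℕ)
    (Yes : ℝ≥0∞ → Prop) (No : ℝ≥0∞ → ℝ≥0∞ → Prop) (v y : Fin n) (A₀ A : Fin n → Prop)
    (h : ℝ≥0∞) (σ₀ : State) (a₀ : ℕ) (σ : State) : Prop where
  off : ∀ u, ¬ R.OnChain I.sinks v u → (A u ↔ A₀ u)
  mark : ∀ u : Fin n, (A u → σ.arr (o + 20) u = 1) ∧ (¬ A u → σ.arr (o + 20) u = 0)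
  wit_off : ∀ u : Fin n, ¬ R.OnChain I.sinks v u → σ.arr (o + 21) u = σ₀.arr (o + 21) u
  yes : ∀ x, R.OnChain I.sinks v x → A x → ∃ s : Fin n, σ.arr (o + 21) x = s ∧
    R.Cand I.sinks s x ∧ Yes (f (R.block A₀ s x) s)
  top : A y → ∀ x, R.OnChain I.sinks v x → A x
  no : ∀ a : Fin k, (a : ℕ) < a₀ → σ₀.arr (o + 22) a = v → ∀ x, R.OnChain I.sinks v x → ¬ A x →
    No h (f (R.block A₀ (I.sink a) x) (I.sink a))
  cur_ge : ∀ a : Fin k, a₀ ≤ a → σ.arr (o + 22) a = σ₀.arr (o + 22) a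
  cur_ne : ∀ a : Fin k, σ₀.arr (o + 22) a ≠ v → σ.arr (o + 22) a = σ₀.arr (o + 22) a
  cur_lt : ∀ a : Fin k, (a : ℕ) < a₀ → σ₀.arr (o + 22) a = v →
    σ.arr (o + 22) a = (if R.par y ∈ I.sinks then n else (R.par y : ℕ)) ∨
    σ.arr (o + 22) a = v ∧ ∃ z, R.OnChain I.sinks v z ∧
      No h (f (R.block A₀ (I.sink a) z) (I.sink a))

open Classical in
theorem run_process (hf : IsRelaxedMinmaxMonotone I.tree f) (hc : IsCmp R f t o q cmp K Yes No G)
    {τ : ℝ} (hτ : ∀ m ≤ n, t m ≤ τ) (hτ0 : 0 ≤ τ) (hK : 0 ≤ K) {σ : State} (hE : Env R σ)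
    (hr : R.root ∈ I.sinks) {v : Fin n} (hv : σ.reg (o + 21) = v) (hkv : R.Key I.sinks v)
    {A₀ : Fin n → Prop} (hA₀ : ∀ u : Fin n, σ.arr (o + 20) u = if A₀ u then 1 else 0)
    (hA₀v : ∀ x, R.OnChain I.sinks v x → ¬ A₀ x)
    (hwait : ∀ a : Fin k, σ.arr (o + 22) a = v → R.Cand I.sinks (I.sink a) v)
    (hG : G (σ.costReg q)) {c : ℝ} :
    Run I.tree f t (process o cmp) c σ fun c' σ' =>
      c' ≤ c + 4 * n + 10 * k + 10 + searchTime n τ K *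
        (1 + (Finset.univ.filter fun a : Fin k => σ'.arr (o + 22) a = v).card) ∧
      σ'.costReg q ≤ σ.costReg q ∧ G (σ'.costReg q) ∧
      ∃ y A, R.OnChain I.sinks v y ∧ R.Key I.sinks (R.par y) ∧
        (∀ x, R.OnChain I.sinks v x → R.Below x y) ∧
        ProcessInv R f o Yes No v y A₀ A (σ'.costReg q) σ k σ' := by
  have hq := hc.q_lt
  have hS : 0 ≤ searchTime n τ K := by unfold searchTime probeTime; positivity
  rw [process, run_seq]
  refine (run_listChain hE hr hv).mono ?_
  rintro c₁ σ₁ hF₁ ⟨hc₁, m, hmn, hm1, hm, hch, hy, hnok, hkey⟩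
  have hE₁ : Env R σ₁ := hE.frame hF₁ ⟨fun x hx => by rw [listChain_writesReg]; omega,
    fun x hx => by rw [listChain_writesArr]; omega⟩
  have hv₁ : σ₁.reg (o + 21) = v := by
    rw [hF₁.reg _ (by rw [listChain_writesReg]; omega), hv]
  have h20₁ : σ₁.arr (o + 20) = σ.arr (o + 20) := hF₁.arr _ (by rw [listChain_writesArr]; omega)
  have h21₁ : σ₁.arr (o + 21) = σ.arr (o + 21) := hF₁.arr _ (by rw [listChain_writesArr]; omega)
  have h22₁ : σ₁.arr (o + 22) = σ.arr (o + 22) := hF₁.arr _ (by rw [listChain_writesArr]; omega)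
  have hq₁ : σ₁.costReg = σ.costReg := funext fun x => hF₁.cost x listChain_writesCost
  set y := R.par^[m - 1] v with hydef
  have hon : ∀ x, R.OnChain I.sinks v x ↔ ∃ j < m, R.par^[j] v = x := by
    intro x
    constructor
    · rintro ⟨j, h, h'⟩
      refine ⟨j, ?_, h⟩
      by_contra hj
      refine h' (m - 1) (by omega) ?_
      rwa [Nat.sub_add_cancel hm1]
    · rintro ⟨j, hj, h⟩
      exact ⟨j, h, fun i hi => hnok _ (by omega) (by omega)⟩
  have hpary : R.par y = R.par^[m] v := by
    rw [hydef, ← Function.iterate_succ_apply' (f := R.par), Nat.succ_eq_add_one,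
      Nat.sub_add_cancel hm1]
  have hony : R.OnChain I.sinks v y := (hon y).2 ⟨m - 1, by omega, rfl⟩
  have hbely : ∀ x, R.OnChain I.sinks v x → R.Below x y := by
    intro x hx
    obtain ⟨j, hj, rfl⟩ := (hon x).1 hx
    exact ⟨m - 1 - j, by rw [← Function.iterate_add_apply, Nat.sub_add_cancel (by omega)]⟩
  refine Run.forUp (N := k) (fun i c' σ' => ∃ A, ProcessInv R f o Yes No v y A₀ A (σ'.costReg q)
      σ i σ' ∧ σ'.costReg q ≤ σ.costReg q ∧ G (σ'.costReg q) ∧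
      c' ≤ c₁ + 1 + 8 * i + searchTime n τ K * ((if A y then 1 else 0) +
        (Finset.univ.filter fun a : Fin k => (a : ℕ) < i ∧ σ'.arr (o + 22) a = v).card))
    hE₁.count (by omega) ?_ ?_ ?_ ?_ ?_
  · intro h
    simp only [Program.writesReg, or_false] at h
    have := hc.search_writesReg h; omega
  · intro h
    simp only [Program.writesReg, or_false] at h
    have := hc.search_writesReg h; omega
  · refine ⟨A₀, ⟨fun _ _ => Iff.rfl, fun u => by simp +contextual [h20₁, hA₀], by simp [h21₁],
      fun x hx h => absurd h (hA₀v x hx), fun h => absurd h (hA₀v y hony), by simp, by simp [h22₁],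
      by simp [h22₁], by simp⟩, by simp [hq₁], by simpa [hq₁] using hG, ?_⟩
    simp [hA₀v y hony]
  · rintro i c' σ' hi hF hreg ⟨A, hP, hh, hG', hc'⟩
    set a : Fin k := ⟨i, hi⟩ with ha
    have hbody : ∀ {x}, (forUp (o + 24) 1 (.cond (.eq (.arr (o + 22) (.reg (o + 24)))
        (.reg (o + 21)))
      (.seq (.cond (.eq (.arr (o + 20) (.reg (o + 23))) (.lit 0)) (search o cmp) .skip) <|
        .cond (.eq (.arr (o + 20) (.reg (o + 23))) (.lit 1))
          (.cond (.le (.lit 1) (.arr 8 (.arr 7 (.reg (o + 23)))))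
            (.store (o + 22) (.reg (o + 24)) (.reg 0))
            (.store (o + 22) (.reg (o + 24)) (.arr 7 (.reg (o + 23)))))
          .skip)
      .skip)).writesReg x → (o + 24 ≤ x ∧ x ≤ o + 34) ∨ o + 50 ≤ x := by
      intro x h
      simp only [Program.writesReg, forUp_writesReg, or_false] at h
      rcases h with rfl | h
      · omega
      · have := hc.search_writesReg h; omega
    have hE' : Env R σ' := by
      refine hE₁.frame hF ⟨fun x hx h => ?_, fun x hx h => ?_⟩
      · have := hbody h; omega
      · simp only [Program.writesArr, forUp_writesArr, or_false, or_self] at h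
        rcases h with h | rfl
        · have := hc.search_writesArr h; omega
        · omega
    have hv' : σ'.reg (o + 21) = v := by
      rw [hF.reg _ fun h => by have := hbody h; omega, hv₁]
    have hy' : σ'.reg (o + 23) = y := by
      rw [hF.reg _ fun h => by have := hbody h; omega, hy]
    have hm' : σ'.reg (o + 22) = m := by
      rw [hF.reg _ fun h => by have := hbody h; omega, hm]
    have hch' : ∀ j < m, σ'.arr (o + 23) j = R.par^[j] v := by
      rw [hF.arr _ fun h => ?_]
      · exact hch
      · simp only [Program.writesArr, forUp_writesArr, or_false, or_self] at h
        rcases h with h | h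
        · have := hc.search_writesArr h; omega
        · omega
    have hcuri : σ'.arr (o + 22) i = σ.arr (o + 22) i := hP.cur_ge a le_rfl
    rw [run_cond]
    simp only [Test.eq_holds, Exp.eval, hreg, hv', hcuri]
    constructor
    swap
    ·
      intro hne
      rw [run_skip]
      refine ⟨A, ⟨hP.off, hP.mark, hP.wit_off, hP.yes, hP.top, ?_, ?_, hP.cur_ne, ?_⟩, hh, hG', ?_⟩
      · intro b hb hbv
        have : (b : ℕ) ≠ i := by rintro h; rw [h] at hbv; exact hne hbv
        exact hP.no b (by omega) hbv
      · exact fun b hb => hP.cur_ge b (by omega)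
      · intro b hb hbv
        have : (b : ℕ) ≠ i := by rintro h; rw [h] at hbv; exact hne hbv
        exact hP.cur_lt b (by omega) hbv
      · have hle : ((Finset.univ.filter fun b : Fin k =>
            (b : ℕ) < i ∧ σ'.arr (o + 22) b = v).card : ℝ) ≤
            (Finset.univ.filter fun b : Fin k =>
            (b : ℕ) < i + 1 ∧ (σ'.setReg (o + 24) (i + 1)).arr (o + 22) b = v).card := by
          refine Nat.cast_le.2 (Finset.card_le_card fun b hb => ?_)
          simp only [Finset.mem_filter, Finset.mem_univ, true_and] at hb ⊢
          exact ⟨by omega, hb.2⟩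
        have := mul_le_mul_of_nonneg_left hle hS
        push_cast
        rw [mul_add (searchTime n τ K)] at hc' ⊢
        linarith
    intro hwi
    have hcand : R.Cand I.sinks (I.sink a) v := hwait a hwi
    -- The state after the optional search.
    rw [run_seq]
    have H : Run I.tree f t (.cond (.eq (.arr (o + 20) (.reg (o + 23))) (.lit 0)) (search o cmp)
        .skip) (c' + 1 + 1) σ' fun c₂ σ₂ => σ₂.costReg q ≤ σ.costReg q ∧ G (σ₂.costReg q) ∧
        Env R σ₂ ∧ σ₂.reg (o + 23) = y ∧ σ₂.reg (o + 24) = i ∧ σ₂.arr (o + 22) = σ'.arr (o + 22) ∧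
        ∃ A₂, ProcessInv R f o Yes No v y A₀ A₂ (σ₂.costReg q) σ i σ₂ ∧
          (A₂ y ∨ (∃ z, R.OnChain I.sinks v z ∧
            No (σ₂.costReg q) (f (R.block A₀ (I.sink a) z) (I.sink a)))) ∧
          (∀ x, R.OnChain I.sinks v x → ¬ A₂ x →
            No (σ₂.costReg q) (f (R.block A₀ (I.sink a) x) (I.sink a))) ∧
          c₂ ≤ c₁ + 1 + 8 * i + 4 + searchTime n τ K * (1 +
        (Finset.univ.filter fun a : Fin k => (a : ℕ) < i ∧ σ'.arr (o + 22) a = v).card) := by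
      rw [run_cond, run_skip]
      simp only [Test.eq_holds, Exp.eval, hy']
      have hmark : ∀ u : Fin n, σ'.arr (o + 20) u = if A u then 1 else 0 := fun u => by
        split_ifs with h
        exacts [(hP.mark u).1 h, (hP.mark u).2 h]
      constructor
      · intro h0
        have hAy : ¬ A y := fun h => by rw [(hP.mark y).1 h] at h0; exact one_ne_zero h0
        refine (run_search hf hc hτ hτ0 hK hE' hmn hm' (a := a) hreg hch' hcand.2.1 hmark
          hG').mono ?_
        rintro c₂ σ₂ hF₂ ⟨hc₂, hh₂, hG₂, l, hlm, hA₂, hw₂, hyes, hno⟩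
        have hb : ∀ j < m, R.block A (I.sink a) (R.par^[j] v) =
            R.block A₀ (I.sink a) (R.par^[j] v) := fun j hj =>
          block_stable hr hkv hkv le_rfl ((hon _).2 ⟨j, hj, rfl⟩) hcand.1
            (hcand.2.1.trans ⟨j, rfl⟩) hP.off
        have hr₂ : ∀ x, x < o + 25 → σ₂.reg x = σ'.reg x := fun x hx =>
          hF₂.reg x fun h => by have := hc.search_writesReg h; omega
        have h22 : σ₂.arr (o + 22) = σ'.arr (o + 22) :=
          hF₂.arr _ fun h => by have := hc.search_writesArr h; omega
        have hfinal : ∀ x, R.OnChain I.sinks v x → ¬ (A x ∨ ∃ j < l, R.par^[j] v = x) →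
            No (σ₂.costReg q) (f (R.block A₀ (I.sink a) x) (I.sink a)) := by
          intro x hx hAx
          obtain ⟨j, hj, rfl⟩ := (hon x).1 hx
          have hlj : l ≤ j := not_lt.1 fun h => hAx (.inr ⟨j, h, rfl⟩)
          have := hno (by omega)
          rw [hb l (by omega)] at this
          refine hc.no_mono _ _ _ (cost_block_mono hf I.isTree (hcand.2.1.trans ⟨l, rfl⟩)
            ⟨j - l, ?_⟩) this
          rw [← Function.iterate_add_apply, Nat.sub_add_cancel hlj]
        refine ⟨hh₂.trans hh, hG₂, hE'.frame hF₂ ⟨fun x hx h => ?_, fun x hx h => ?_⟩, ?_, ?_, h22,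
          fun u => A u ∨ ∃ j < l, R.par^[j] v = u, ⟨?_, ?_, ?_, ?_, ?_, ?_, ?_, ?_, ?_⟩, ?_, hfinal,
          ?_⟩
        · have := hc.search_writesReg h; omega
        · have := hc.search_writesArr h; omega
        · rw [hr₂ _ (by omega), hy']
        · rw [hr₂ _ (by omega), hreg]
        · intro u hu
          rw [← hP.off u hu]
          refine ⟨Or.rec id ?_, .inl⟩
          rintro ⟨j, hj, rfl⟩
          exact absurd ((hon _).2 ⟨j, by omega, rfl⟩) hu
        · intro u
          rw [hA₂]
          exact ⟨fun h => if_pos h, fun h => if_neg h⟩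
        · intro u hu
          rw [hw₂, if_neg, hP.wit_off u hu]
          rintro ⟨j, hj, rfl⟩
          exact hu ((hon _).2 ⟨j, by omega, rfl⟩)
        · intro x hx hAx
          rw [hw₂]
          by_cases hj : ∃ j < l, R.par^[j] v = x
          · rw [if_pos hj]
            obtain ⟨j, hj, rfl⟩ := hj
            refine ⟨_, rfl, hcand.onChain hr hkv hx, ?_⟩
            rw [← hb j (by omega)]
            exact hyes j hj
          · rw [if_neg hj]
            exact hP.yes x hx (hAx.resolve_right hj)
        · rintro hAy₂ x hx
          obtain ⟨j, hj, hjy⟩ := hAy₂.resolve_left hAy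
          have hjm : m ≤ j + 1 := by
            by_contra hjm
            refine hnok (j + 1) (by omega) (by omega) ?_
            rw [Function.iterate_succ_apply', hjy, hpary]
            exact hkey
          obtain ⟨j', hj', rfl⟩ := (hon x).1 hx
          exact .inr ⟨j', by omega, rfl⟩
        · intro b hb hbv x hx hAx
          exact hc.no_anti _ _ _ hh₂ (hP.no b hb hbv x hx fun h => hAx (.inl h))
        · rw [h22]; exact hP.cur_ge
        · rw [h22]; exact hP.cur_ne
        · rw [h22]
          intro b hb hbv
          refine (hP.cur_lt b hb hbv).imp id fun ⟨h, z, hz, h'⟩ => ⟨h, z, hz, ?_⟩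
          exact hc.no_anti _ _ _ hh₂ h'
        · by_cases hAy₂ : A y ∨ ∃ j < l, R.par^[j] v = y
          · exact .inl hAy₂
          · exact .inr ⟨y, hony, hfinal y hony hAy₂⟩
        · rw [if_neg hAy] at hc'
          rw [mul_add (searchTime n τ K)] at hc' ⊢
          linarith
      · intro h0
        have hAy : A y := by_contra fun h => h0 ((hP.mark y).2 h)
        refine ⟨hh, hG', hE', trivial, hreg, trivial, A, hP, .inl hAy,
          fun x hx h => absurd (hP.top hAy x hx) h, ?_⟩
        rw [if_pos hAy] at hc'
        linarith
    refine H.mono ?_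
    rintro c₂ σ₂ - ⟨hh₂, hG₂, hE₂, hy₂, ha₂, h22, A₂, hP₂, htop, hno, hc₂⟩
    have hcard : ∀ (σ₃ : State) (h : ∀ b : Fin k, (b : ℕ) < i → σ'.arr (o + 22) b = v →
        σ₃.arr (o + 22) b = v), (Finset.univ.filter fun b : Fin k =>
            (b : ℕ) < i ∧ σ'.arr (o + 22) b = v) ⊆
            Finset.univ.filter fun b : Fin k =>
            (b : ℕ) < i + 1 ∧ σ₃.arr (o + 22) b = v := by
      intro σ₃ h b hb
      simp only [Finset.mem_filter, Finset.mem_univ, true_and] at hb ⊢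
      exact ⟨by omega, h b hb.1 hb.2⟩
    rw [run_cond, run_skip]
    simp only [Test.eq_holds, Exp.eval, hy₂]
    constructor
    · intro h1
      have hAy : A₂ y := by_contra fun h => by rw [(hP₂.mark y).2 h] at h1; exact zero_ne_one h1
      suffices H : ∀ x, (x = if R.par y ∈ I.sinks then n else (R.par y : ℕ)) → ∀ c₃ ≤ c₂ + 3,
          ∃ A, ProcessInv R f o Yes No v y A₀ A (σ₂.costReg q) σ (i + 1)
            ((σ₂.setArr (o + 22) i x).setReg (o + 24) (i + 1)) ∧
          σ₂.costReg q ≤ σ.costReg q ∧ G (σ₂.costReg q) ∧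
          c₃ + 1 ≤ c₁ + 1 + 8 * (i + 1 : ℕ) + searchTime n τ K * ((if A y then 1 else 0) +
            (Finset.univ.filter fun a : Fin k => (a : ℕ) < i + 1 ∧
              ((σ₂.setArr (o + 22) i x).setReg (o + 24) (i + 1)).arr (o + 22) a = v).card) by
        rw [run_cond, run_store, run_store]
        simp only [Test.holds, Exp.eval, hy₂, hE₂.par, hE₂.isSink, ha₂, hE₂.size]
        constructor
        · intro h
          have h' : R.par y ∈ I.sinks := by
            by_contra h'
            simp [h'] at h
          exact H _ (by rw [if_pos h']) _ (by linarith)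
        · intro h
          have h' : R.par y ∉ I.sinks := by
            intro h'
            simp [h'] at h
          exact H _ (by rw [if_neg h']) _ (by linarith)
      intro x hx c₃ hc₃
      have h22' : ∀ b : Fin k, (b : ℕ) ≠ i →
          ((σ₂.setArr (o + 22) i x).setReg (o + 24) (i + 1)).arr (o + 22) b =
            σ'.arr (o + 22) b := by
        intro b hb
        simp [Function.update_of_ne hb, h22]
      refine ⟨A₂, ⟨hP₂.off, ?_, ?_, ?_, hP₂.top, ?_, ?_, ?_, ?_⟩, hh₂, hG₂, ?_⟩
      · simpa using hP₂.mark
      · simpa using hP₂.wit_off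
      · simpa using hP₂.yes
      · intro b hb hbv x hx hAx
        exact absurd (hP₂.top hAy x hx) hAx
      · intro b hb
        rw [h22' b (by omega)]
        exact hP.cur_ge b (by omega)
      · intro b hbv
        rw [h22' b (by rintro h; rw [h] at hbv; exact hbv hwi)]
        exact hP.cur_ne b hbv
      · intro b hb hbv
        by_cases hbi : (b : ℕ) = i
        · left
          simp [hbi, hx]
        · have := hP₂.cur_lt b (by omega) hbv
          rwa [h22, ← h22' b hbi] at this
      · rw [if_pos hAy]
        have h2 := Finset.card_le_card (hcard ((σ₂.setArr (o + 22) i x).setReg (o + 24) (i + 1))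
          fun b hb h => by rw [h22' b hb.ne, h])
        have h3 := mul_le_mul_of_nonneg_left (Nat.cast_le (α := ℝ).2 h2) hS
        push_cast
        rw [mul_add (searchTime n τ K)] at hc₂ ⊢
        linarith
    · intro h1
      have hAy : ¬ A₂ y := fun h => h1 ((hP₂.mark y).1 h)
      refine ⟨A₂, ⟨hP₂.off, ?_, ?_, ?_, hP₂.top, ?_, ?_, ?_, ?_⟩, hh₂, hG₂, ?_⟩
      · simpa using hP₂.mark
      · simpa using hP₂.wit_off
      · simpa using hP₂.yes
      · intro b hb hbv x hx hAx
        by_cases hbi : (b : ℕ) = i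
        · obtain rfl : b = a := Fin.ext hbi
          exact hno x hx hAx
        · exact hP₂.no b (by omega) hbv x hx hAx
      · intro b hb
        exact hP₂.cur_ge b (by omega)
      · exact hP₂.cur_ne
      · intro b hb hbv
        by_cases hbi : (b : ℕ) = i
        · obtain rfl : b = a := Fin.ext hbi
          right
          refine ⟨?_, htop.resolve_left hAy⟩
          simp only [State.setReg_arr, h22]
          exact hcuri.trans hwi
        · exact hP₂.cur_lt b (by omega) hbv
      · rw [if_neg hAy]
        have := hcard (σ₂.setReg (o + 24) (i + 1)) fun b _ h => by rw [State.setReg_arr, h22, h]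
        have hai : a ∉ Finset.univ.filter fun b : Fin k => (b : ℕ) < i ∧ σ'.arr (o + 22) b = v := by
          simp [ha]
        have h2 := Finset.card_le_card (Finset.insert_subset (a := a) (by
          simp only [Finset.mem_filter, Finset.mem_univ, true_and, ha, h22, State.setReg_arr]
          exact ⟨by omega, hcuri.trans hwi⟩) this)
        rw [Finset.card_insert_of_notMem hai] at h2
        have h3 := mul_le_mul_of_nonneg_left (Nat.cast_le (α := ℝ).2 h2) hS
        push_cast at h3 ⊢
        rw [zero_add]
        rw [mul_add (searchTime n τ K)] at hc₂ h3
        linarith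
  · rintro c' σ' hF ⟨A, hP, hh, hG', hc'⟩
    refine ⟨?_, hh, hG', y, A, hony, hpary ▸ hkey, hbely, hP⟩
    have hle : (if A y then (1 : ℝ) else 0) + (Finset.univ.filter fun b : Fin k =>
        (b : ℕ) < k ∧ σ'.arr (o + 22) b = v).card ≤
        1 + (Finset.univ.filter fun b : Fin k => σ'.arr (o + 22) b = v).card := by
      refine add_le_add (by split_ifs <;> norm_num) (Nat.cast_le.2
        (Finset.card_le_card fun b hb => ?_))
      simp only [Finset.mem_filter, Finset.mem_univ, true_and] at hb ⊢
      exact hb.2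
    have := mul_le_mul_of_nonneg_left hle hS
    have hk0 : (0 : ℝ) ≤ k := Nat.cast_nonneg _
    linarith

end

/-! ### The greedy algorithm -/

section

variable {n k : ℕ} {I : Input n k} {R : Rooting I.tree}
  {f : Finset (Fin n) → Fin n → ℝ≥0∞} {t : ℕ → ℝ} {o q : ℕ}
  {cmp : Program} {K : ℝ} {Yes : ℝ≥0∞ → Prop} {No : ℝ≥0∞ → ℝ≥0∞ → Prop} {G : ℝ≥0∞ → Prop}

open Rooting

/-- The invariant of the greedy algorithm before the key vertices from position `i` on are
processed: `A` is the set of marked vertices. By `no`, the vertices on the chains of processed key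
vertices that are not marked cannot be taken from below. By `arrive`, a sink that could
take `v`, the next unprocessed key vertex on its way, either waits at `v` or has been refused
further below. -/
structure GreedyInv (R : Rooting I.tree) (f : Finset (Fin n) → Fin n → ℝ≥0∞) (o : ℕ)
    (Yes : ℝ≥0∞ → Prop) (No : ℝ≥0∞ → ℝ≥0∞ → Prop) (i : ℕ) (h : ℝ≥0∞) (A : Fin n → Prop)
    (σ : State) : Prop where
  mark : ∀ u : Fin n, (A u → σ.arr (o + 20) u = 1) ∧ (¬ A u → σ.arr (o + 20) u = 0)
  chain : ∀ x, A x → ∃ w, R.Key I.sinks w ∧ (R.ord.symm w : ℕ) < i ∧ R.OnChain I.sinks w x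
  yes : ∀ x, A x → ∃ s : Fin n, σ.arr (o + 21) x = s ∧ R.Cand I.sinks s x ∧
    Yes (f (R.block A s x) s)
  no : ∀ w x s, R.Key I.sinks w → (R.ord.symm w : ℕ) < i → R.OnChain I.sinks w x → ¬ A x →
    R.Cand I.sinks s x → No h (f (R.block A s x) s)
  wait : ∀ (a : Fin k) v, R.Key I.sinks v → i ≤ (R.ord.symm v : ℕ) → σ.arr (o + 22) a = v →
    R.Cand I.sinks (I.sink a) v
  arrive : ∀ (a : Fin k) v, R.Key I.sinks v → i ≤ (R.ord.symm v : ℕ) →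
    R.Cand I.sinks (I.sink a) v →
    (∀ w, R.Key I.sinks w → R.Below (I.sink a) w → R.Below w v → w ≠ v →
      (R.ord.symm w : ℕ) < i) →
    σ.arr (o + 22) a = v ∨ ∃ z, R.Below (I.sink a) z ∧ R.Below z v ∧ z ≠ v ∧
      No h (f (R.block A (I.sink a) z) (I.sink a))

theorem exists_sink_eq {s : Fin n} (hs : s ∈ I.sinks) : ∃ a, I.sink a = s := by
  simpa [Input.sinks] using hs

theorem GreedyInv.skip {i : ℕ} {h : ℝ≥0∞} {A : Fin n → Prop} {σ σ' : State}
    (hI : GreedyInv R f o Yes No i h A σ) {v : Fin n} (hv : (R.ord.symm v : ℕ) = i)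
    (hk : ¬ R.Key I.sinks v) (hσ : σ'.arr = σ.arr) : GreedyInv R f o Yes No (i + 1) h A σ' := by
  have hlt : ∀ w, R.Key I.sinks w → (R.ord.symm w : ℕ) < i + 1 → (R.ord.symm w : ℕ) < i := by
    intro w hw h
    refine lt_of_le_of_ne (by omega) fun h' => hk ?_
    rwa [← R.ord.symm.injective (Fin.ext (h'.trans hv.symm))]
  refine ⟨by rw [hσ]; exact hI.mark, fun x hx => ?_, by rw [hσ]; exact hI.yes, ?_, ?_, ?_⟩
  · obtain ⟨w, h₁, h₂, h₃⟩ := hI.chain x hx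
    exact ⟨w, h₁, by omega, h₃⟩
  · exact fun w x s h₁ h₂ => hI.no w x s h₁ (hlt w h₁ h₂)
  · rw [hσ]
    exact fun a v h₁ h₂ => hI.wait a v h₁ (by omega)
  · rw [hσ]
    exact fun a v h₁ h₂ h₃ h₄ => hI.arrive a v h₁ (by omega) h₃ fun w hw h h' h'' =>
      hlt w hw (h₄ w hw h h' h'')

theorem GreedyInv.step (hf : IsRelaxedMinmaxMonotone I.tree f)
    (hc : IsCmp R f t o q cmp K Yes No G) (hr : R.root ∈ I.sinks) {i : ℕ} {h₀ h : ℝ≥0∞}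
    (hh : h ≤ h₀) {A₀ A : Fin n → Prop} {σ₀ σ σ' : State}
    (hI : GreedyInv R f o Yes No i h₀ A₀ σ₀) {v y : Fin n} (hv : (R.ord.symm v : ℕ) = i)
    (hkv : R.Key I.sinks v) (hy : R.OnChain I.sinks v y) (hky : R.Key I.sinks (R.par y))
    (hxy : ∀ x, R.OnChain I.sinks v x → R.Below x y)
    (hP : ProcessInv R f o Yes No v y A₀ A h σ₀ k σ) (hσ : σ'.arr = σ.arr) :
    GreedyInv R f o Yes No (i + 1) h A σ' := by
  have stab : ∀ {w x s : Fin n}, R.Key I.sinks w → (R.ord.symm w : ℕ) ≤ i →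
      R.OnChain I.sinks w x → s ∈ I.sinks → R.Below s x → R.block A s x = R.block A₀ s x :=
    fun hw hwi hx hs hsx => block_stable hr hkv hw (by rw [← hv] at hwi; exact hwi) hx hs hsx hP.off
  have stab' : ∀ {z s v' : Fin n}, s ∈ I.sinks → R.Below s z → R.Below z v' → z ≠ v' →
      (∀ w, R.Key I.sinks w → R.Below s w → R.Below w v' → w ≠ v' →
        (R.ord.symm w : ℕ) < i + 1) → R.block A s z = R.block A₀ s z := by
    intro z s v' hs hsz hzv hne hw
    obtain ⟨w, h₁, h₂, h₃⟩ := exists_onChain hs hsz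
    refine stab h₁ (Nat.lt_succ_iff.1 (hw w h₁ h₂ (h₃.below.trans hzv) ?_)) h₃ hs hsz
    rintro rfl
    exact hne (hzv.antisymm h₃.below)
  have hpos : ∀ {w : Fin n}, (R.ord.symm w : ℕ) = i → w = v := fun h =>
    R.ord.symm.injective (Fin.ext (h.trans hv.symm))
  -- Every sink that could take `v` either waits at `v` or has been refused below `v`.
  have hat : ∀ a : Fin k, R.Cand I.sinks (I.sink a) v → σ₀.arr (o + 22) a = v ∨
      ∃ z, R.Below (I.sink a) z ∧ R.Below z v ∧ z ≠ v ∧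
        No h₀ (f (R.block A₀ (I.sink a) z) (I.sink a)) := fun a hcand =>
    hI.arrive a v hkv hv.ge hcand fun w _ _ h₂ h₃ => by rw [← hv]; exact h₂.lt h₃
  refine ⟨by rw [hσ]; exact hP.mark, fun x hx => ?_, fun x hx => ?_,
    fun w x s hw hwi hx hA hs => ?_, fun a v' hv' hi hcur => ?_, fun a v' hv' hi hcand hkeys => ?_⟩
  · by_cases hon : R.OnChain I.sinks v x
    · exact ⟨v, hkv, by omega, hon⟩
    · obtain ⟨w, h₁, h₂, h₃⟩ := hI.chain x ((hP.off x hon).1 hx)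
      exact ⟨w, h₁, by omega, h₃⟩
  · rw [hσ]
    by_cases hon : R.OnChain I.sinks v x
    · obtain ⟨s, h₁, h₂, h₃⟩ := hP.yes x hon hx
      exact ⟨s, h₁, h₂, by rwa [stab hkv hv.le hon h₂.1 h₂.2.1]⟩
    · have hx₀ := (hP.off x hon).1 hx
      obtain ⟨s, h₁, h₂, h₃⟩ := hI.yes x hx₀
      obtain ⟨w, hw₁, hw₂, hw₃⟩ := hI.chain x hx₀
      exact ⟨s, by rw [hP.wit_off x hon, h₁], h₂, by rwa [stab hw₁ hw₂.le hw₃ h₂.1 h₂.2.1]⟩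
  · rw [stab hw (by omega) hx hs.1 hs.2.1]
    by_cases hwv : (R.ord.symm w : ℕ) = i
    · obtain rfl := hpos hwv
      obtain ⟨a, rfl⟩ := exists_sink_eq hs.1
      have hsw := hx.sink_below hr hw hs.1 hs.2.1
      rcases hat a (hs.of_below hsw hx.below) with h' | ⟨z, h₁, h₂, h₃, h₄⟩
      · exact hP.no a a.2 h' x hx hA
      · exact hc.no_anti _ _ _ hh (hc.no_mono _ _ _
          (cost_block_mono hf I.isTree h₁ (h₂.trans hx.below)) h₄)
    · have hon : ¬ R.OnChain I.sinks v x := by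
        intro hon
        have h₁ := hon.below_of_below hr hkv hw hx (Below.refl _ _)
        have h₂ := hx.below_of_below hr hw hkv hon (Below.refl _ _)
        exact hwv (by rw [h₂.antisymm h₁, hv])
      exact hc.no_anti _ _ _ hh (hI.no w x s hw (by omega) hx (fun h => hA ((hP.off x hon).2 h)) hs)
  · rw [hσ] at hcur
    by_cases hcv : σ₀.arr (o + 22) a = v
    · have hcand := hI.wait a v hkv hv.ge hcv
      have hne : (v' : ℕ) ≠ v := fun h => by
        obtain rfl : v' = v := Fin.ext h
        omega
      rcases hP.cur_lt a a.2 hcv with h | h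
      · rw [hcur] at h
        split_ifs at h with hpy
        · have := v'.2; omega
        obtain rfl : v' = R.par y := Fin.ext h
        refine ⟨hcand.1, hcand.2.1.trans (hy.below.trans (R.below_par y)), fun z hz h₁ h₂ => ?_⟩
        have hzy : R.Below z y := by
          rcases h₁.total (hcand.2.1.trans hy.below) with h | h
          · exact h
          · by_cases hyz : y = z
            · rw [hyz]; exact Below.refl _ _
            · rw [h₂.antisymm (h.par_of_ne hyz)] at hz
              exact absurd hz hpy
        exact hcand.2.2 z hz h₁ (hy.sink_below hr hkv hz hzy)
      · exact absurd (hcur.symm.trans h.1) hne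
    · rw [hP.cur_ne a hcv] at hcur
      exact hI.wait a v' hv' (by omega) hcur
  · rw [hσ]
    have hvv' : v ≠ v' := by rintro rfl; omega
    by_cases hb : R.Below (I.sink a) v ∧ R.Below v v'
    · obtain ⟨hsv, hvv⟩ := hb
      rcases hat a (hcand.of_below hsv hvv) with h' | ⟨z, h₁, h₂, h₃, h₄⟩
      · have hyv' : R.Below y v' := by
          rcases hy.below.total hvv with h | h
          · exact h
          · exact absurd (hy.eq_of_key hvv h hv').symm hvv'
        have hne : ∀ x, R.OnChain I.sinks v x → x ≠ v' := by
          rintro x hx rfl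
          exact hvv' (hx.eq_of_key hvv (Below.refl _ _) hv').symm
        have hpar : R.par y = v' := by
          by_contra hne'
          have h₁ : R.Below v (R.par y) := hy.below.trans (R.below_par y)
          have := hkeys _ hky (hsv.trans h₁) (hyv'.par_of_ne (hne y hy)) hne'
          have h₂ : (R.ord.symm v : ℕ) ≤ R.ord.symm (R.par y) := h₁.le
          have h₃ : R.par y = v := hpos (by omega)
          have h₄ : y = v := (h₃ ▸ R.below_par y : R.Below y v).antisymm hy.below
          rw [h₄] at h₃
          have hvr : v = R.root := by_contra fun h => R.par_ne h h₃
          rw [hvr] at hvv hvv'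
          exact hvv' (eq_root_of_root_below hvv).symm
        rcases hP.cur_lt a a.2 h' with h | ⟨h, z, hz, hno⟩
        · left
          rw [h, hpar, if_neg]
          intro hv'S
          have := hcand.2.2 v' hv'S hcand.2.1 (Below.refl _ _)
          rw [← this] at hsv
          exact hvv' (hvv.antisymm hsv)
        · right
          refine ⟨z, hsv.trans hz.below, (hxy z hz).trans hyv', hne z hz, ?_⟩
          rwa [stab hkv hv.le hz hcand.1 (hsv.trans hz.below)]
      · right
        have hzv' : z ≠ v' := by
          rintro rfl
          exact hvv' (hvv.antisymm h₂)
        refine ⟨z, h₁, h₂.trans hvv, hzv', ?_⟩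
        rw [stab' hcand.1 h₁ (h₂.trans hvv) hzv' hkeys]
        exact hc.no_anti _ _ _ hh h₄
    · have hkeys' : ∀ w, R.Key I.sinks w → R.Below (I.sink a) w → R.Below w v' → w ≠ v' →
          (R.ord.symm w : ℕ) < i := fun w h₁ h₂ h₃ h₄ => by
        refine lt_of_le_of_ne (Nat.lt_succ_iff.1 (hkeys w h₁ h₂ h₃ h₄)) fun h => hb ?_
        rw [← hpos h]
        exact ⟨h₂, h₃⟩
      rcases hI.arrive a v' hv' (by omega) hcand hkeys' with h | ⟨z, h₁, h₂, h₃, h₄⟩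
      · left
        rw [hP.cur_ne a (by rw [h]; exact fun h => hvv' (Fin.ext h).symm), h]
      · right
        refine ⟨z, h₁, h₂, h₃, ?_⟩
        rw [stab' hcand.1 h₁ h₂ h₃ hkeys]
        exact hc.no_anti _ _ _ hh h₄

/-- Mark in the array `o + 20` the vertices that can be taken by a sink below them, and put such
sinks into the array `o + 21`. The program `cmp` decides which costs are acceptable. -/
def greedy (o : ℕ) (cmp : Program) : Program :=
  .seq (forUp (o + 31) 0 (.store (o + 20) (.reg (o + 31)) (.lit 0))) <|
  .seq (forUp (o + 31) 1 (.store (o + 22) (.reg (o + 31)) (.arr 2 (.reg (o + 31))))) <|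
  forUp (o + 20) 0 <|
    .seq (.set (o + 21) (.arr 6 (.reg (o + 20)))) <|
    .cond (keyTest (.reg (o + 21))) (process o cmp) .skip

theorem IsCmp.greedy_writesReg (hc : IsCmp R f t o q cmp K Yes No G) {x : ℕ}
    (h : (greedy o cmp).writesReg x) : (o + 20 ≤ x ∧ x ≤ o + 34) ∨ o + 50 ≤ x := by
  simp only [greedy, Program.writesReg, forUp_writesReg, or_false] at h
  by_cases hx : (process o cmp).writesReg x
  · have := hc.process_writesReg hx; omega
  · simp only [hx, false_or, or_false] at h; omega

theorem IsCmp.greedy_writesArr (hc : IsCmp R f t o q cmp K Yes No G) {x : ℕ}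
    (h : (greedy o cmp).writesArr x) : (o + 20 ≤ x ∧ x ≤ o + 25) ∨ o + 50 ≤ x := by
  simp only [greedy, Program.writesArr, forUp_writesArr, or_false, false_or] at h
  by_cases hx : (process o cmp).writesArr x
  · have := hc.process_writesArr hx; omega
  · simp only [hx, or_false] at h; omega

/-- The time that `greedy` needs if oracle calls take time `τ`, and comparisons time `K`. Each of
the `2 * k` key vertices pays for listing its chain and for one search that takes the whole chain.
After any other search the sink waits at its key vertex for good; this gives `k` more searches. -/
noncomputable def greedyTime (n k : ℕ) (τ K : ℝ) : ℝ :=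
  10 * n + 4 * k + 10 + 2 * k * (4 * n + 10 * k + 10 + searchTime n τ K) + k * searchTime n τ K

/-- The outcome of the greedy algorithm: `A` is the set of vertices that can be taken by a sink
below them, where `wit` gives such a sink. -/
structure GreedyResult (R : Rooting I.tree) (f : Finset (Fin n) → Fin n → ℝ≥0∞)
    (Yes No : ℝ≥0∞ → Prop) (A : Fin n → Prop) (wit : ℕ → ℕ) : Prop where
  yes : ∀ x, A x → ∃ s : Fin n, wit x = s ∧ R.Cand I.sinks s x ∧ Yes (f (R.block A s x) s)
  no : ∀ x, ¬ A x → ∀ s, R.Cand I.sinks s x → No (f (R.block A s x) s)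

open Classical in
theorem run_greedy (hf : IsRelaxedMinmaxMonotone I.tree f) (hc : IsCmp R f t o q cmp K Yes No G)
    {τ : ℝ} (hτ : ∀ m ≤ n, t m ≤ τ) (hτ0 : 0 ≤ τ) (hK : 0 ≤ K) {σ : State} (hE : Env R σ)
    (hr : R.root ∈ I.sinks) (hG : G (σ.costReg q)) {c : ℝ} :
    Run I.tree f t (greedy o cmp) c σ fun c' σ' => c' ≤ c + greedyTime n k τ K ∧
      G (σ'.costReg q) ∧ σ'.costReg q ≤ σ.costReg q ∧ ∃ A : Fin n → Prop,
      (∀ u : Fin n, σ'.arr (o + 20) u = if A u then 1 else 0) ∧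
      GreedyResult R f Yes (No (σ'.costReg q)) A (σ'.arr (o + 21)) := by
  have hS : 0 ≤ searchTime n τ K := by unfold searchTime probeTime; positivity
  have hq := hc.q_lt
  rw [greedy, run_seq]
  refine Run.forUp (N := n) (fun i c' σ' => c' ≤ c + 1 + 3 * i ∧ ∀ u < i, σ'.arr (o + 20) u = 0)
    hE.size (by omega) (by simp) (by simp) (by simp) ?_ ?_
  · rintro i c' σ' hi hF hreg ⟨hc', h⟩
    rw [run_store]
    refine ⟨by push_cast; linarith, fun u hu => ?_⟩
    simp only [State.setReg_arr, State.setArr_arr, if_true, Function.update_apply, Exp.eval, hreg]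
    split_ifs with h'
    · rfl
    · exact h u (by omega)
  rintro c₁ σ₁ hF₁ ⟨hc₁, hm₁⟩
  have hE₁ : Env R σ₁ := hE.frame hF₁ ⟨by simp; omega, by simp; omega⟩
  have hq₁ : σ₁.costReg = σ.costReg := funext fun x => hF₁.cost x (by simp)
  rw [run_seq]
  refine Run.forUp (N := k) (fun i c' σ' => c' ≤ c₁ + 2 + 3 * i ∧
    ∀ a : Fin k, (a : ℕ) < i → σ'.arr (o + 22) a = I.sink a)
    hE₁.count (by omega) (by simp) (by simp) (by simp; linarith) ?_ ?_
  · rintro i c' σ' hi hF hreg ⟨hc', h⟩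
    have hE' : Env R σ' := hE₁.frame hF ⟨by simp; omega, by simp; omega⟩
    rw [run_store]
    refine ⟨by push_cast; linarith, fun a ha => ?_⟩
    simp only [State.setReg_arr, State.setArr_arr, if_true, Function.update_apply, Exp.eval, hreg]
    split_ifs with h'
    · rw [← h', hE'.sink]
    · exact h a (by omega)
  rintro c₂ σ₂ hF₂ ⟨hc₂, hcur₂⟩
  have hE₂ : Env R σ₂ := hE₁.frame hF₂ ⟨by simp; omega, by simp; omega⟩
  have hq₂ : σ₂.costReg = σ.costReg := (funext fun x => hF₂.cost x (by simp)).trans hq₁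
  have hm₂ : ∀ u : Fin n, σ₂.arr (o + 20) u = 0 := fun u => by
    rw [hF₂.arr _ (by simp)]; exact hm₁ u u.2
  refine Run.forUp (N := n) (fun i c' σ' => ∃ A, GreedyInv R f o Yes No i (σ'.costReg q) A σ' ∧
      G (σ'.costReg q) ∧ σ'.costReg q ≤ σ.costReg q ∧ c' ≤ c₂ + 2 + 5 * i +
      (Finset.univ.filter fun v => R.Key I.sinks v ∧ (R.ord.symm v : ℕ) < i).card *
        (4 * n + 10 * k + 10 + searchTime n τ K) +
      (Finset.univ.filter fun a : Fin k => ∃ v, R.Key I.sinks v ∧ (R.ord.symm v : ℕ) < i ∧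
        σ'.arr (o + 22) a = v).card * searchTime n τ K)
    hE₂.size (by omega) ?_ ?_ ?_ ?_ ?_
  · intro h
    simp only [Program.writesReg, or_false] at h
    rcases h with h | h
    · omega
    · have := hc.process_writesReg h; omega
  · intro h
    simp only [Program.writesReg, or_false] at h
    rcases h with h | h
    · omega
    · have := hc.process_writesReg h; omega
  · refine ⟨fun _ => False, ⟨by simpa using hm₂, by simp, by simp, by simp, ?_, ?_⟩, ?_, ?_, ?_⟩
    · intro a v hv _ hav
      simp only [State.setReg_arr, hcur₂ a a.2] at hav
      obtain rfl := Fin.ext hav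
      exact cand_self (by simp [Input.sinks])
    · intro a v hv _ hcand hkeys
      left
      have : I.sink a = v := by
        by_contra hne
        simpa using hkeys (I.sink a) (.inl hcand.1) (Below.refl _ _) hcand.2.1 hne
      simp [hcur₂ a a.2, this]
    · simpa [hq₂] using hG
    · simp [hq₂]
    · have hB : 0 ≤ 4 * (n : ℝ) + 10 * k + 10 + searchTime n τ K := by positivity
      refine le_trans (le_of_eq ?_) (add_le_add (add_le_add le_rfl
        (mul_nonneg (Nat.cast_nonneg _) hB)) (mul_nonneg (Nat.cast_nonneg _) hS))
      simp only [Nat.cast_zero]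
      ring
  · rintro i c' σ' hi hF hreg ⟨A, hI, hG', hh, hc'⟩
    have hE' : Env R σ' := by
      refine hE₂.frame hF ⟨fun x hx h => ?_, fun x hx h => ?_⟩
      · simp only [Program.writesReg, forUp_writesReg, or_false] at h
        rcases h with h | h | h
        · omega
        · omega
        · have := hc.process_writesReg h; omega
      · simp only [Program.writesArr, forUp_writesArr, or_false, false_or] at h
        have := hc.process_writesArr h; omega
    obtain ⟨v, hv⟩ : ∃ v : Fin n, (R.ord.symm v : ℕ) = i := ⟨R.ord ⟨i, hi⟩, by simp⟩
    have hord : σ'.arr 6 i = v := by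
      rw [← hv, hE'.ord (R.ord.symm v)]; simp
    have hkeymono : (Finset.univ.filter fun v => R.Key I.sinks v ∧ (R.ord.symm v : ℕ) < i) ⊆
        Finset.univ.filter fun v => R.Key I.sinks v ∧ (R.ord.symm v : ℕ) < i + 1 := by
      intro x hx
      simp only [Finset.mem_filter, Finset.mem_univ, true_and] at hx ⊢
      exact ⟨hx.1, by omega⟩
    have hB : 0 ≤ 4 * (n : ℝ) + 10 * k + 10 + searchTime n τ K := by positivity
    rw [run_seq, run_set, run_cond, (hE'.setReg (by omega)).keyTest (u := v)
      (by simp [hreg, hord])]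
    constructor
    · intro hkv
      have hA : ∀ u : Fin n, σ'.arr (o + 20) u = if A u then 1 else 0 := fun u => by
        split_ifs with h
        exacts [(hI.mark u).1 h, (hI.mark u).2 h]
      refine (run_process hf hc hτ hτ0 hK (hE'.setReg (by omega)) hr (v := v)
        (by simp [hreg, hord]) hkv (A₀ := A) (by simpa using hA) ?_ ?_ (by simpa using hG')).mono ?_
      · intro x hx hAx
        obtain ⟨w, h₁, h₂, h₃⟩ := hI.chain x hAx
        have h := hx.below_of_below hr hkv h₁ h₃ (Below.refl _ _)
        have : (R.ord.symm v : ℕ) ≤ R.ord.symm w := h.le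
        omega
      · intro a ha
        exact hI.wait a v hkv hv.ge (by simpa using ha)
      · rintro c₃ σ₃ hF₃ ⟨hc₃, hh₃, hG₃, y, A₃, hony, hky, hxy, hP⟩
        simp only [State.setReg_costReg] at hh₃
        refine ⟨A₃, ?_, hG₃, hh₃.trans hh, ?_⟩
        · refine hI.step hf hc hr hh₃ hv hkv hony hky hxy (σ := σ₃) ?_ rfl
          exact ⟨hP.off, hP.mark, hP.wit_off, hP.yes, hP.top, hP.no, hP.cur_ge, hP.cur_ne,
            hP.cur_lt⟩
        · have h1 : (Finset.univ.filter fun v =>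
              R.Key I.sinks v ∧ (R.ord.symm v : ℕ) < i).card + 1 ≤
              (Finset.univ.filter fun v =>
                R.Key I.sinks v ∧ (R.ord.symm v : ℕ) < i + 1).card := by
            have hnot : v ∉ Finset.univ.filter fun v =>
                R.Key I.sinks v ∧ (R.ord.symm v : ℕ) < i := by simp [hv]
            rw [← Finset.card_insert_of_notMem hnot]
            refine Finset.card_le_card (Finset.insert_subset ?_ hkeymono)
            simp [hv, hkv]
          have h2 : (Finset.univ.filter fun a : Fin k => ∃ v, R.Key I.sinks v ∧
              (R.ord.symm v : ℕ) < i ∧ σ'.arr (o + 22) a = v).card +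
              (Finset.univ.filter fun a : Fin k => σ₃.arr (o + 22) a = v).card ≤
              (Finset.univ.filter fun a : Fin k => ∃ v, R.Key I.sinks v ∧
                (R.ord.symm v : ℕ) < i + 1 ∧
                (σ₃.setReg (o + 20) (i + 1)).arr (o + 22) a = v).card := by
            have hne : ∀ a : Fin k, ∀ w : Fin n, (R.ord.symm w : ℕ) < i →
                σ'.arr (o + 22) a = w → σ₃.arr (o + 22) a = w := by
              intro a w hw haw
              have hwv : (w : ℕ) ≠ v := fun h => by rw [Fin.ext h] at hw; omega
              have := hP.cur_ne a (by simpa [haw] using hwv)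
              simpa [haw] using this
            rw [← Finset.card_union_of_disjoint]
            · refine Finset.card_le_card fun a ha => ?_
              simp only [Finset.mem_union, Finset.mem_filter, Finset.mem_univ, true_and,
                State.setReg_arr] at ha
              rcases ha with ⟨w, h₁, h₂, h₃⟩ | ha
              · exact Finset.mem_filter.2 ⟨Finset.mem_univ _, w, h₁, by omega, hne a w h₂ h₃⟩
              · exact Finset.mem_filter.2 ⟨Finset.mem_univ _, v, hkv, by omega, ha⟩
            · rw [Finset.disjoint_left]
              intro a ha ha'
              simp only [Finset.mem_filter, Finset.mem_univ, true_and] at ha ha'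
              obtain ⟨w, h₁, h₂, h₃⟩ := ha
              have := Fin.ext ((hne a w h₂ h₃).symm.trans ha')
              rw [this] at h₂
              omega
          have h1' := mul_le_mul_of_nonneg_right (Nat.cast_le (α := ℝ).2 h1) hB
          have h2' := mul_le_mul_of_nonneg_right (Nat.cast_le (α := ℝ).2 h2) hS
          push_cast at h1' h2' ⊢
          linarith
    · intro hkv
      rw [run_skip]
      refine ⟨A, hI.skip hv hkv rfl, hG', hh, ?_⟩
      have h1' := mul_le_mul_of_nonneg_right (Nat.cast_le (α := ℝ).2
        (Finset.card_le_card hkeymono)) hB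
      have h2 : (Finset.univ.filter fun a : Fin k => ∃ v, R.Key I.sinks v ∧
          (R.ord.symm v : ℕ) < i ∧ σ'.arr (o + 22) a = v).card ≤
          (Finset.univ.filter fun a : Fin k => ∃ v, R.Key I.sinks v ∧
            (R.ord.symm v : ℕ) < i + 1 ∧
            ((σ'.setReg (o + 21) (Exp.eval σ' (Exp.arr 6 (Exp.reg (o + 20))))).setReg
              (o + 20) (i + 1)).arr (o + 22) a = v).card := by
        refine Finset.card_le_card fun a ha => ?_
        simp only [Finset.mem_filter, Finset.mem_univ, true_and, State.setReg_arr] at ha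
        obtain ⟨w, h₁, h₂, h₃⟩ := ha
        exact Finset.mem_filter.2 ⟨Finset.mem_univ _, w, h₁, by omega, h₃⟩
      have h2' := mul_le_mul_of_nonneg_right (Nat.cast_le (α := ℝ).2 h2) hS
      push_cast at h1' h2' ⊢
      linarith
  · rintro c' σ' hF ⟨A, hI, hG', hh, hc'⟩
    refine ⟨?_, hG', hh, A, fun u => ?_, hI.yes, fun x hx s hs => ?_⟩
    · have h1 : (Finset.univ.filter fun v => R.Key I.sinks v ∧ (R.ord.symm v : ℕ) < n).card ≤
          2 * k := by
        refine (Finset.card_le_card ?_).trans ((R.card_key_le hr).trans (by simp [Input.sinks]))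
        intro x hx
        simp only [Finset.mem_filter, Finset.mem_univ, true_and] at hx ⊢
        exact hx.1
      have h2 : (Finset.univ.filter fun a : Fin k => ∃ v, R.Key I.sinks v ∧
          (R.ord.symm v : ℕ) < n ∧ σ'.arr (o + 22) a = v).card ≤ k :=
        (Finset.card_le_univ _).trans (by simp)
      have hB : 0 ≤ 4 * (n : ℝ) + 10 * k + 10 + searchTime n τ K := by positivity
      have h1' := mul_le_mul_of_nonneg_right (Nat.cast_le (α := ℝ).2 h1) hB
      have h2' := mul_le_mul_of_nonneg_right (Nat.cast_le (α := ℝ).2 h2) hS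
      have hk0 : (0 : ℝ) ≤ k := Nat.cast_nonneg _
      have hn0 : (0 : ℝ) ≤ n := Nat.cast_nonneg _
      push_cast at h1' h2'
      unfold greedyTime
      linarith
    · split_ifs with h
      exacts [(hI.mark u).1 h, (hI.mark u).2 h]
    · obtain ⟨v, h₁, h₂, h₃⟩ := exists_onChain hs.1 hs.2.1
      exact hI.no v x s h₁ (R.ord.symm v).2 h₃ hx hs

end

/-! ### From marks to a partition -/

section

variable {n k : ℕ} {I : Input n k} {R : Rooting I.tree}
  {f : Finset (Fin n) → Fin n → ℝ≥0∞} {Yes No : ℝ≥0∞ → Prop} {A : Fin n → Prop}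
  {wit : ℕ → ℕ}

open Rooting

/-- The state of the top-down assignment of vertices to sinks after `i` vertices have been treated:
the vertices in `D` are assigned to sinks, by the function `out`. The vertices assigned to one sink
form a block. -/
structure AssignInv (R : Rooting I.tree) (A : Fin n → Prop) (wit : ℕ → ℕ) (i : ℕ) (D : Fin n → Prop)
    (out : Fin n → Fin n) : Prop where
  done : ∀ v, n ≤ i + (R.ord.symm v : ℕ) → D v
  up : ∀ v, D v → D (R.par v)
  served : ∀ v, v ≠ R.root → D (R.par v) → ¬ D v → A v
  block : ∀ v, D v → ∃ u, A u ∧ wit u = out v ∧ ∀ x, D x ∧ out x = out v ↔ R.Block A (out v) u x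

theorem AssignInv.init {out : Fin n → Fin n} : AssignInv R A wit 0 (fun _ => False) out :=
  ⟨fun v hv => by have := (R.ord.symm v).2; omega, by simp, by simp, by simp⟩

theorem AssignInv.next {i : ℕ} {D : Fin n → Prop} {out : Fin n → Fin n}
    (h : AssignInv R A wit i D out) {u : Fin n} (hu : (R.ord.symm u : ℕ) = n - 1 - i) (hD : D u) :
    AssignInv R A wit (i + 1) D out := by
  refine ⟨fun v hv => ?_, h.up, h.served, h.block⟩
  by_cases hv' : n ≤ i + (R.ord.symm v : ℕ)
  · exact h.done v hv'
  · obtain rfl : v = u := R.ord.symm.injective (Fin.ext (by omega))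
    exact hD

theorem AssignInv.of_below {i : ℕ} {D : Fin n → Prop} {out : Fin n → Fin n}
    (h : AssignInv R A wit i D out) {x u : Fin n} (hx : D x) (hxu : R.Below x u) : D u := by
  obtain ⟨j, rfl⟩ := hxu
  induction j with
  | zero => exact hx
  | succ j ih => rw [Function.iterate_succ_apply']; exact h.up _ ih

theorem AssignInv.marked {i : ℕ} {D : Fin n → Prop} {out : Fin n → Fin n}
    (h : AssignInv R A wit i D out) (hr : A R.root) {u : Fin n}
    (hu : (R.ord.symm u : ℕ) = n - 1 - i) (hD : ¬ D u) : A u := by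
  by_cases hur : u = R.root
  · rwa [hur]
  · have hlt : (R.ord.symm u : ℕ) < R.ord.symm (R.par u) := R.ord_lt u hur
    exact h.served u hur (h.done _ (by omega)) hD

open Classical in
theorem AssignInv.step {i : ℕ} {D : Fin n → Prop} {out : Fin n → Fin n}
    (h : AssignInv R A wit i D out) (hres : GreedyResult R f Yes No A wit) (hr : A R.root)
    {u s : Fin n} (hu : (R.ord.symm u : ℕ) = n - 1 - i) (hD : ¬ D u) (hs : wit u = s) :
    ¬ D s ∧ AssignInv R A wit (i + 1) (fun x => D x ∨ R.Block A s u x)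
      (fun x => if R.Block A s u x then s else out x) := by
  have hA : A u := h.marked hr hu hD
  obtain ⟨s', hs', hcand, -⟩ := hres.yes u hA
  obtain rfl : s' = s := Fin.ext (hs'.symm.trans hs)
  have hB : ∀ x, R.Block A s' u x → ¬ D x := fun x hx hDx => hD (h.of_below hDx hx.below_top)
  have hDs : ¬ D s' := hB _ (.path (Below.refl _ _) hcand.2.1)
  have hout : ∀ x, D x → out x ≠ s' := by
    intro x hx hxs
    obtain ⟨w, h₁, h₂, h₃⟩ := h.block x hx
    obtain ⟨s'', hs'', hcand', -⟩ := hres.yes w h₁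
    rw [hxs] at h₂ h₃
    obtain rfl : s'' = s' := Fin.ext (hs''.symm.trans h₂)
    exact hDs ((h₃ _).2 (.path (Below.refl _ _) hcand'.2.1)).1
  refine ⟨hDs, fun v hv => ?_, fun v hv => ?_, fun v hv hp hn => ?_, fun v hv => ?_⟩
  · by_cases hv' : n ≤ i + (R.ord.symm v : ℕ)
    · exact .inl (h.done v hv')
    · obtain rfl : v = u := R.ord.symm.injective (Fin.ext (by omega))
      exact .inr (.path hcand.2.1 (Below.refl _ _))
  · rcases hv with hv | hv
    · exact .inl (h.up v hv)
    · by_cases hvu : v = u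
      · by_cases hur : u = R.root
        · have hp : R.par v = v := by rw [hvu, hur, R.par_root]
          right
          rwa [hp]
        · left
          have hlt : (R.ord.symm u : ℕ) < R.ord.symm (R.par u) := R.ord_lt u hur
          rw [hvu]
          exact h.done _ (by omega)
      · exact .inr (hv.par_of_ne hvu)
  · rw [not_or] at hn
    rcases hp with hp | hp
    · exact h.served v hv hp hn.1
    · by_contra hAv
      exact hn.2 (.hang hp hAv)
  · by_cases hvB : R.Block A s' u v
    · refine ⟨u, hA, by rw [if_pos hvB]; exact hs', fun x => ?_⟩
      rw [if_pos hvB]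
      by_cases hxB : R.Block A s' u x
      · simp [hxB]
      · simp only [hxB, or_false, if_false, iff_false, not_and]
        exact hout x
    · have hDv := hv.resolve_right hvB
      obtain ⟨w, h₁, h₂, h₃⟩ := h.block v hDv
      refine ⟨w, h₁, by rw [if_neg hvB]; exact h₂, fun x => ?_⟩
      rw [if_neg hvB, ← h₃]
      by_cases hxB : R.Block A s' u x
      · simp only [hxB, or_true, if_true, true_and]
        exact ⟨fun h => absurd h.symm (hout v hDv), fun h => absurd h.1 (hB x hxB)⟩
      · simp [hxB]

theorem AssignInv.isSinkPartition {D : Fin n → Prop} {out : Fin n → Fin n}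
    (h : AssignInv R A wit n D out) (hres : GreedyResult R f Yes No A wit)
    (hS : ∀ s ∈ I.sinks, A s) :
    IsSinkPartition I.tree I.sinks (fun s => Finset.univ.filter fun v => out v = s) ∧
      ∀ s ∈ I.sinks, Yes (f (Finset.univ.filter fun v => out v = s) s) := by
  have hD : ∀ v, D v := fun v => h.done v (by omega)
  have hcand : ∀ v, ∃ u, (Finset.univ.filter fun x => out x = out v) = R.block A (out v) u ∧
      R.Cand I.sinks (out v) u ∧ Yes (f (R.block A (out v) u) (out v)) := by
    intro v
    obtain ⟨u, h₁, h₂, h₃⟩ := h.block v (hD v)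
    obtain ⟨s, hs, hc, hY⟩ := hres.yes u h₁
    obtain rfl : s = out v := Fin.ext (hs.symm.trans h₂)
    refine ⟨u, ?_, hc, hY⟩
    ext x
    simp [← h₃, hD]
  have hself : ∀ s ∈ I.sinks, out s = s := by
    intro s hs
    obtain ⟨u, h₁, h₂, -⟩ := hcand s
    have hsB : s ∈ R.block A (out s) u := by rw [← h₁]; simp
    rw [mem_block] at hsB
    cases hsB with
    | path h h' => exact (h₂.2.2 s hs h h').symm
    | hang _ h => exact absurd (hS s hs) h
  refine ⟨⟨fun s hs => ?_, fun s hs => ?_, fun s _ s' _ hne => ?_, ?_⟩, fun s hs => ?_⟩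
  · obtain ⟨u, h₁, h₂, -⟩ := hcand s
    rw [hself s hs] at h₁ h₂
    rw [h₁]
    exact isSubtree_block I.isTree h₂.2.1
  · ext z
    simp only [Finset.mem_inter, Finset.mem_filter, Finset.mem_univ, true_and,
      Finset.mem_singleton]
    constructor
    · rintro ⟨hz, h⟩
      rwa [hself z hz] at h
    · rintro rfl
      exact ⟨hs, hself z hs⟩
  · rw [Finset.disjoint_left]
    intro x hx hx'
    simp only [Finset.mem_filter, Finset.mem_univ, true_and] at hx hx'
    exact hne (hx.symm.trans hx')
  · ext v
    obtain ⟨u, -, h₂, -⟩ := hcand v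
    simpa using h₂.1
  · obtain ⟨u, h₁, -, h₂⟩ := hcand s
    rw [hself s hs] at h₁ h₂
    rwa [h₁]

/-- There is a partition in which no part costs more than `c`. -/
def Feasible (I : Input n k) (f : Finset (Fin n) → Fin n → ℝ≥0∞) (c : ℝ≥0∞) : Prop :=
  ∃ P, IsSinkPartition I.tree I.sinks P ∧ ∀ s ∈ I.sinks, f (P s) s ≤ c

theorem GreedyResult.exists_partition (hres : GreedyResult R f Yes No A wit)
    (hr : R.root ∈ I.sinks) (hS : ∀ s ∈ I.sinks, A s) :
    ∃ P, IsSinkPartition I.tree I.sinks P ∧ ∀ s ∈ I.sinks, Yes (f (P s) s) := by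
  have key : ∀ i ≤ n, ∃ D out, AssignInv R A wit i D out := by
    intro i
    induction i with
    | zero => exact fun _ => ⟨_, id, AssignInv.init⟩
    | succ i ih =>
      intro hi
      obtain ⟨D, out, h⟩ := ih (by omega)
      have hu : (R.ord.symm (R.ord ⟨n - 1 - i, by omega⟩) : ℕ) = n - 1 - i := by simp
      by_cases hD : D (R.ord ⟨n - 1 - i, by omega⟩)
      · exact ⟨D, out, h.next hu hD⟩
      · obtain ⟨s, hs, -⟩ := hres.yes _ (h.marked (hS _ hr) hu hD)
        exact ⟨_, _, (h.step hres (hS _ hr) hu hD hs).2⟩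
  obtain ⟨D, out, h⟩ := key n le_rfl
  exact ⟨_, h.isSinkPartition hres hS⟩

/-! ### Testing feasibility -/

/-- The comparison of the cost in the register `o + 20` with the threshold in the register 0. -/
def cmpThreshold (o : ℕ) : Program :=
  .cond (.costLe (.reg (o + 20)) (.reg 0)) (.set (o + 34) (.lit 1)) (.set (o + 34) (.lit 0))

variable {t : ℕ → ℝ}

theorem isCmp_threshold (o : ℕ) (c : ℝ≥0∞) :
    IsCmp R f t o 0 (cmpThreshold o) 2 (· ≤ c) (fun h c' => h < c') (· = c) where
  reg x h := .inl (by simpa [cmpThreshold] using h)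
  arr x h := by simp [cmpThreshold] at h
  q_lt := by norm_num
  yes_anti c₁ c₂ h h' := h.trans h'
  no_mono h c₁ c₂ h₁ h₂ := h₂.trans_le h₁
  no_anti h h' c' h₁ h₂ := h₁.trans_lt h₂
  run σ c' hE hG := by
    rw [cmpThreshold, run_cond, run_set, run_set]
    simp only [Test.holds, CostExp.eval]
    constructor
    · intro h
      exact ⟨by linarith, le_rfl, hG, .inl ⟨by simp [Exp.eval], by rwa [← hG]⟩⟩
    · intro h
      exact ⟨by linarith, le_rfl, hG, .inr ⟨by simp [Exp.eval], not_le.1 h⟩⟩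

theorem greedy_writesCost {o x : ℕ} {cmp : Program} (h : (greedy o cmp).writesCost x) :
    x = o + 20 ∨ cmp.writesCost x := by
  simpa [greedy, process, search, probe, listBlock_writesCost, listChain_writesCost] using h

/-- After the greedy algorithm with threshold, the sinks are marked if and only if the threshold
is feasible. -/
theorem GreedyResult.feasible_iff (hf : IsRelaxedMinmaxMonotone I.tree f) (hr : R.root ∈ I.sinks)
    {c : ℝ≥0∞} (hres : GreedyResult R f (· ≤ c) (c < ·) A wit) :
    Feasible I f c ↔ ∀ s ∈ I.sinks, A s := by
  constructor
  · rintro ⟨P, hP, hPc⟩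
    exact served_of_partition (R := R) hf I.isTree (L := (· ≤ c)) (fun _ _ h h' => h.trans h')
      (fun x hx s hs => not_le.2 (hres.no x hx s hs)) hP hPc
  · exact hres.exists_partition hr

/-- Put 0 into the register `y` if all sinks are marked in the array `o + 20`, and 1 if not. -/
def checkSinks (o y : ℕ) : Program :=
  .seq (.set y (.lit 0)) <|
  forUp (o + 31) 1 <|
    .cond (.eq (.arr (o + 20) (.arr 2 (.reg (o + 31)))) (.lit 0)) (.set y (.lit 1)) .skip

open Classical in
theorem run_checkSinks {σ : State} (hE : Env R σ) {o y : ℕ} (hy : 20 ≤ y) (hy' : y ≠ o + 31)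
    (hA : ∀ u : Fin n, σ.arr (o + 20) u = if A u then 1 else 0) {c : ℝ} :
    Run I.tree f t (checkSinks o y) c σ fun c' σ' => c' ≤ c + 4 * k + 3 ∧
      σ'.reg y = if ∀ s ∈ I.sinks, A s then 0 else 1 := by
  rw [checkSinks, run_seq, run_set]
  refine Run.forUp (N := k) (fun i c' σ' => c' ≤ c + 2 + 4 * i ∧
    σ'.reg y = if ∀ a : Fin k, (a : ℕ) < i → A (I.sink a) then 0 else 1)
    (by simpa [show 1 ≠ y by omega] using hE.count) (by omega) (by simp; omega) (by simp; omega)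
    ?_ ?_ ?_
  · refine ⟨by norm_num; linarith, ?_⟩
    simp [hy']
  · rintro i c' σ' hi hF hreg ⟨hc', hres⟩
    have hE' : Env R σ' := (hE.setReg hy).frame hF ⟨by simp; omega, by simp⟩
    have hA' : ∀ u : Fin n, σ'.arr (o + 20) u = if A u then 1 else 0 := by
      rw [hF.arr _ (by simp)]; simpa using hA
    have hsink := hE'.sink ⟨i, hi⟩
    simp only at hsink
    have hstep : (∀ a : Fin k, (a : ℕ) < i + 1 → A (I.sink a)) ↔
        (∀ a : Fin k, (a : ℕ) < i → A (I.sink a)) ∧ A (I.sink ⟨i, hi⟩) := by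
      constructor
      · exact fun h => ⟨fun a ha => h a (by omega), h _ (by simp)⟩
      · rintro ⟨h, h'⟩ a ha
        rcases Nat.lt_succ_iff_lt_or_eq.1 ha with ha | ha
        · exact h a ha
        · obtain rfl : a = ⟨i, hi⟩ := Fin.ext ha
          exact h'
    rw [run_cond, run_set, run_skip]
    simp only [Test.eq_holds, Exp.eval, hreg, hsink, hA', hstep]
    constructor
    · intro h
      have h' : ¬ A (I.sink ⟨i, hi⟩) := fun h' => by simp [h'] at h
      exact ⟨by push_cast; linarith, by simp [hy', h']⟩
    · intro h
      have h' : A (I.sink ⟨i, hi⟩) := by_contra fun h' => by simp [h'] at h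
      exact ⟨by push_cast; linarith, by simp [hy', h', hres]⟩
  · rintro c' σ' hF ⟨hc', hres⟩
    refine ⟨by linarith, ?_⟩
    rw [hres]
    congr 1
    simp [Input.sinks]

/-! ### The optimum -/

/-- Decide whether the cost in the register 20 is below the optimum, and if it is not, let the
cost in the register 1 be at most this cost. -/
def cmpOptimum : Program :=
  .seq (.setCost 0 (.reg 20)) <|
  .seq (greedy 30 (cmpThreshold 30)) <|
  .seq (checkSinks 30 34) <|
  .cond (.and (.eq (.reg 34) (.lit 0)) (.costLe (.reg 20) (.reg 1))) (.setCost 1 (.reg 20)) .skip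

theorem cmpOptimum_writesReg {x : ℕ} (h : cmpOptimum.writesReg x) : x = 34 ∨ 50 ≤ x := by
  simp only [cmpOptimum, checkSinks, Program.writesReg, forUp_writesReg, or_false, false_or] at h
  by_cases hx : (greedy 30 (cmpThreshold 30)).writesReg x
  · have := hx
    simp [greedy, process, search, probe, listBlock_writesReg, listChain_writesReg, cmpThreshold]
      at this
    omega
  · simp only [hx, false_or] at h; omega

theorem cmpOptimum_writesArr {x : ℕ} (h : cmpOptimum.writesArr x) : 50 ≤ x := by
  simp [cmpOptimum, checkSinks, greedy, process, search, probe, listBlock_writesArr,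
    listChain_writesArr, cmpThreshold] at h
  omega

theorem isCmp_optimum (hf : IsRelaxedMinmaxMonotone I.tree f) (hr : R.root ∈ I.sinks) {τ : ℝ}
    (hτ : ∀ m ≤ n, t m ≤ τ) (hτ0 : 0 ≤ τ) :
    IsCmp R f t 0 1 cmpOptimum (greedyTime n k τ 2 + 4 * k + 10) (fun c => ¬ Feasible I f c)
      (fun h c => h ≤ c) (fun h => h = ⊤ ∨ Feasible I f h) where
  reg x h := by simpa using cmpOptimum_writesReg h
  arr x h := by simpa using cmpOptimum_writesArr h
  q_lt := by norm_num
  yes_anti c₁ c₂ h h' := fun ⟨P, hP, hPc⟩ => h' ⟨P, hP, fun s hs => (hPc s hs).trans h⟩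
  no_mono h c₁ c₂ h₁ h₂ := h₂.trans h₁
  no_anti h h' c' h₁ h₂ := h₁.trans h₂
  run σ c hE hG := by
    classical
    rw [cmpOptimum]
    simp only [run_seq, run_setCost]
    have hc := isCmp_threshold (R := R) (f := f) (t := t) 30 (σ.costReg 20)
    refine (run_greedy hf hc hτ hτ0 (by norm_num) hE.setCostReg hr
      (by simp [CostExp.eval])).mono ?_
    rintro c₁ σ₁ hF₁ ⟨hc₁, hG₁, -, A, hA, hres⟩
    simp only [zero_add] at *
    rw [hG₁] at hres
    have hE₁ : Env R σ₁ := hE.setCostReg.frame hF₁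
      ⟨fun x hx h => by have := hc.greedy_writesReg h; omega,
        fun x hx h => by have := hc.greedy_writesArr h; omega⟩
    have hcost : ∀ x, x ≠ 50 → x ≠ 0 → σ₁.costReg x = σ.costReg x := by
      intro x hx hx'
      rw [hF₁.cost x fun h => by simpa [hx, cmpThreshold] using greedy_writesCost h]
      simp [hx']
    refine (run_checkSinks hE₁ (by norm_num) (by norm_num) hA).mono ?_
    rintro c₂ σ₂ hF₂ ⟨hc₂, hflag⟩
    have hcost₂ : σ₂.costReg = σ₁.costReg := funext fun x => hF₂.cost x (by simp [checkSinks])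
    replace hflag : σ₂.reg 34 = if Feasible I f (σ.costReg 20) then 0 else 1 := by
      rw [hflag]
      exact if_congr (hres.feasible_iff hf hr).symm rfl rfl
    rw [run_cond, run_setCost, run_skip]
    simp only [Test.holds, Test.eq_holds, Exp.eval, CostExp.eval, hcost₂,
      hcost 20 (by norm_num) (by norm_num), hcost 1 (by norm_num) (by norm_num), hflag,
      State.setCostReg_costReg, State.setCostReg_reg, if_true]
    by_cases hfeas : Feasible I f (σ.costReg 20)
    · simp only [hfeas, if_true, true_and, not_true_eq_false, and_false, zero_ne_one, false_and,
        false_or, or_true]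
      constructor
      · intro hle
        exact ⟨by linarith, hle, le_rfl⟩
      · intro hle
        exact ⟨by linarith, le_rfl, hG, (not_le.1 hle).le⟩
    · simp only [hfeas, if_false, one_ne_zero, false_and, false_implies, not_false_eq_true,
        true_implies, true_and, and_true]
      exact ⟨by linarith, le_rfl, hG, .inl trivial⟩

/-- If all costs tested in the outer run are compared with the optimum by `cmpOptimum`, then the
least cost found to be feasible is the optimum: no partition is cheaper. -/
theorem GreedyResult.le_of_partition (hf : IsRelaxedMinmaxMonotone I.tree f)
    (hr : R.root ∈ I.sinks) {h : ℝ≥0∞}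
    (hres : GreedyResult R f (fun c => ¬ Feasible I f c) (h ≤ ·) A wit) {Q : Fin n → Finset (Fin n)}
    (hQ : IsSinkPartition I.tree I.sinks Q) : h ≤ partitionCost f I.sinks Q := by
  by_contra hlt
  rw [not_le] at hlt
  have hS := served_of_partition (R := R) hf I.isTree (L := (· < h))
    (fun _ _ h h' => h.trans_lt h') (fun x hx s hs => not_lt.2 (hres.no x hx s hs)) hQ
    fun s hs => (Finset.le_sup (f := fun s => f (Q s) s) hs).trans_lt hlt
  obtain ⟨P, hP, hPY⟩ := hres.exists_partition hr hS
  obtain ⟨s, hs, hmax⟩ := Finset.exists_max_image I.sinks (fun s => f (P s) s) ⟨_, hr⟩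
  exact hPY s hs ⟨P, hP, hmax⟩

end

/-! ### Writing the partition -/

section

variable {n k : ℕ} {I : Input n k} {R : Rooting I.tree}
  {f : Finset (Fin n) → Fin n → ℝ≥0∞} {Yes No : ℝ≥0∞ → Prop} {A : Fin n → Prop} {t : ℕ → ℝ}

open Rooting

/-- Assign the vertices in the first `reg 63` cells of the array 55 to the sink in the register 55,
and mark them as assigned in the array 10. -/
def assignList : Program :=
  forUp 61 63 <|
    .seq (.store 3 (.arr 55 (.reg 61)) (.reg 55)) (.store 10 (.arr 55 (.reg 61)) (.lit 1))

/-- Go through the vertices from the root to the leaves. When a vertex `u` is not assigned yet,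
assign the block of the sink that can take `u`, up to `u`. -/
def assign : Program :=
  forUp 20 0 <|
    .seq (.set 21 (.arr 6 (.sub (.sub (.reg 0) (.lit 1)) (.reg 20)))) <|
    .cond (.eq (.arr 10 (.reg 21)) (.lit 0))
      (.seq (.set 55 (.arr 51 (.reg 21))) <|
        .seq (.set 59 (.reg 21)) <| .seq (listBlock 30) assignList)
      .skip

theorem Env.of_frame {σ σ' : State} (h : Env R σ) {p : Program} (hF : Frame p σ σ')
    (h₀ : ¬ p.writesReg 0) (h₁ : ¬ p.writesReg 1)
    (ha : ∀ a, p.writesArr a → a = 3 ∨ 10 ≤ a) : Env R σ' where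
  size := by rw [hF.reg 0 h₀, h.size]
  count := by rw [hF.reg 1 h₁, h.count]
  sink := by rw [hF.arr 2 fun h => by have := ha _ h; omega]; exact h.sink
  ord := by rw [hF.arr 6 fun h => by have := ha _ h; omega]; exact h.ord
  par := by rw [hF.arr 7 fun h => by have := ha _ h; omega]; exact h.par
  isSink := by rw [hF.arr 8 fun h => by have := ha _ h; omega]; exact h.isSink
  kids := by rw [hF.arr 9 fun h => by have := ha _ h; omega]; exact h.kids

open Classical in
theorem run_assignList {σ : State} {B : Finset (Fin n)} {s : Fin n} (hs : σ.reg 55 = s)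
    (hB : (Finset.range (σ.reg 63)).image (σ.arr 55) = B.image Fin.val) {D : Fin n → Prop}
    (hD : ∀ u : Fin n, σ.arr 10 u = if D u then 1 else 0) {c : ℝ} :
    Run I.tree f t assignList c σ fun c' σ' => c' ≤ c + 4 * σ.reg 63 + 2 ∧
      (∀ u : Fin n, σ'.arr 10 u = if D u ∨ u ∈ B then 1 else 0) ∧
      ∀ u : Fin n, σ'.arr 3 u = if u ∈ B then (s : ℕ) else σ.arr 3 u := by
  rw [assignList]
  refine Run.forUp (N := σ.reg 63) (fun i c' σ' => c' ≤ c + 1 + 4 * i ∧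
    (∀ u : Fin n, σ'.arr 10 u = if D u ∨ ∃ j < i, σ.arr 55 j = u then 1 else 0) ∧
      ∀ u : Fin n, σ'.arr 3 u = if ∃ j < i, σ.arr 55 j = u then (s : ℕ) else σ.arr 3 u)
    rfl (by norm_num) (by simp) (by simp) ?_ ?_ ?_
  · exact ⟨by norm_num, by simpa using hD, by simp⟩
  · rintro i c' σ' hi hF hreg ⟨hc, h₁, h₂⟩
    have hlist : σ'.arr 55 = σ.arr 55 := hF.arr _ (by simp)
    have hs' : σ'.reg 55 = s := by rw [hF.reg _ (by simp), hs]
    have hex : ∀ u : Fin n, (∃ j < i + 1, σ.arr 55 j = u) ↔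
        (u : ℕ) = σ.arr 55 i ∨ ∃ j < i, σ.arr 55 j = u := by
      intro u
      constructor
      · rintro ⟨j, hj, h⟩
        rcases Nat.lt_succ_iff_lt_or_eq.1 hj with h' | rfl
        · exact .inr ⟨j, h', h⟩
        · exact .inl h.symm
      · rintro (h | ⟨j, hj, h⟩)
        · exact ⟨i, by omega, h.symm⟩
        · exact ⟨j, by omega, h⟩
    rw [run_seq, run_store, run_store]
    refine ⟨by push_cast; linarith, fun u => ?_, fun u => ?_⟩
    · simp only [State.setReg_arr, State.setArr_arr, if_true, Function.update_apply, Exp.eval, hreg,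
        State.setArr_reg, hlist, Nat.reduceEqDiff, if_false, Nat.reduceEqDiff, hex]
      by_cases h : (u : ℕ) = σ.arr 55 i
      · simp [h]
      · simp [h, h₁]
    · simp only [State.setReg_arr, State.setArr_arr, if_true, Function.update_apply, Exp.eval, hreg,
        State.setArr_reg, hlist, Nat.reduceEqDiff, if_false, Nat.reduceEqDiff, hex]
      by_cases h : (u : ℕ) = σ.arr 55 i
      · simp [h, hs']
      · simp [h, h₂]
  · rintro c' σ' hF ⟨hc, h₁, h₂⟩
    have hex : ∀ u : Fin n, (∃ j < σ.reg 63, σ.arr 55 j = u) ↔ u ∈ B := by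
      intro u
      have : (u : ℕ) ∈ (Finset.range (σ.reg 63)).image (σ.arr 55) ↔
          (u : ℕ) ∈ B.image Fin.val := by rw [hB]
      simpa [Fin.val_inj] using this
    simp only [hex] at h₁ h₂
    exact ⟨by linarith, h₁, h₂⟩

open Classical in
/-- The number of sinks in `D`. -/
noncomputable def numSinks (I : Input n k) (D : Fin n → Prop) : ℕ :=
  (Finset.univ.filter fun a : Fin k => D (I.sink a)).card

theorem numSinks_le (D : Fin n → Prop) : numSinks I D ≤ k :=
  (Finset.card_le_univ _).trans (by simp)

theorem numSinks_lt {D D' : Fin n → Prop} (h : ∀ v, D v → D' v) {s : Fin n} (hs : s ∈ I.sinks)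
    (hD : ¬ D s) (hD' : D' s) : numSinks I D < numSinks I D' := by
  obtain ⟨a, rfl⟩ := exists_sink_eq hs
  refine Finset.card_lt_card (Finset.ssubset_iff.2 ⟨a, by simpa using hD, fun x hx => ?_⟩)
  simp only [Finset.mem_insert, Finset.mem_filter, Finset.mem_univ, true_and] at hx ⊢
  rcases hx with rfl | hx
  · exact hD'
  · exact h _ hx

open Classical in
theorem run_assign {σ : State} (hE : Env R σ) {wit : ℕ → ℕ} (hwit : σ.arr 51 = wit)
    (hA : ∀ u : Fin n, σ.arr 50 u = if A u then 1 else 0) (h₀ : ∀ u : Fin n, σ.arr 10 u = 0)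
    (hres : GreedyResult R f Yes No A wit) (hr : A R.root) {c : ℝ} :
    Run I.tree f t assign c σ fun c' σ' => c' ≤ c + 5 * n + 40 * (n + 1) * k + 2 ∧
      ∃ D out, AssignInv R A wit n D out ∧ ∀ u : Fin n, σ'.arr 3 u = out u := by
  rw [assign]
  refine Run.forUp (N := n) (fun i c' σ' => ∃ D out, AssignInv R A wit i D out ∧
    c' ≤ c + 1 + 5 * i + 40 * (n + 1) * numSinks I D ∧
    (∀ u : Fin n, σ'.arr 10 u = if D u then 1 else 0) ∧ ∀ u, D u → σ'.arr 3 u = out u)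
    hE.size (by norm_num) (by simp [listBlock_writesReg, assignList])
    (by simp [listBlock_writesReg, assignList]) ?_ ?_ ?_
  · exact ⟨_, id, AssignInv.init, by simp [numSinks], by simpa using h₀, by simp⟩
  · rintro i c' σ' hi hF hreg ⟨D, out, hI, hc, h₁, h₂⟩
    have hE' : Env R σ' := hE.of_frame hF (by simp [listBlock_writesReg, assignList])
      (by simp [listBlock_writesReg, assignList])
      (by simp [listBlock_writesArr, assignList]; omega)
    have hwit' : σ'.arr 51 = wit := by
      rw [hF.arr _ (by simp [listBlock_writesArr, assignList]), hwit]
    have hA' : ∀ u : Fin n, σ'.arr 50 u = if A u then 1 else 0 := by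
      rw [hF.arr _ (by simp [listBlock_writesArr, assignList])]; exact hA
    have hord := hE'.ord ⟨n - 1 - i, by omega⟩
    set u := R.ord ⟨n - 1 - i, by omega⟩ with hu
    have hui : (R.ord.symm u : ℕ) = n - 1 - i := by simp [hu]
    simp only at hord
    rw [run_seq, run_set, run_cond, run_skip]
    simp only [Test.eq_holds, Exp.eval, State.setReg_arr, State.setReg_reg, if_true, if_false,
      OfNat.zero_ne_ofNat, hE'.size, hreg, hord, h₁]
    constructor
    · intro hDu
      have hD : ¬ D u := fun h => by simp [h] at hDu
      obtain ⟨s, hs, hcand, -⟩ := hres.yes u (hI.marked hr hui hD)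
      obtain ⟨hDs, hI'⟩ := hI.step hres hr hui hD hs
      rw [run_seq, run_set, run_seq, run_set, run_seq]
      simp only [Exp.eval, State.setReg_arr, State.setReg_reg, if_true, if_false,
        Nat.reduceEqDiff, hwit', hs]
      refine (run_listBlock (R := R) (((hE'.setReg (by norm_num)).setReg (by norm_num)).setReg
        (by norm_num)) (s := s) (x := u) (by simp) (by simp) hcand.2.1 (A := A)
        (by simpa using hA')).mono ?_
      rintro c₁ σ₁ hF₁ ⟨hc₁, hlen, hlist⟩
      have hD₁ : ∀ v : Fin n, σ₁.arr 10 v = if D v then 1 else 0 := by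
        rw [hF₁.arr _ (by simp [listBlock_writesArr])]
        simpa using h₁
      refine (run_assignList (s := s) (D := D) ?_ hlist hD₁).mono ?_
      · rw [hF₁.reg _ (by simp [listBlock_writesReg])]; simp
      rintro c₂ σ₂ hF₂ ⟨hc₂, h₃, h₄⟩
      refine ⟨_, _, hI', ?_, ?_, ?_⟩
      · have h5 : (40 * ((n : ℝ) + 1)) * ((numSinks I D : ℝ) + 1) ≤
            40 * ((n : ℝ) + 1) * numSinks I (fun v => D v ∨ R.Block A s u v) := by
          gcongr
          exact_mod_cast Nat.succ_le_of_lt (numSinks_lt (fun v => Or.inl) hcand.1 hDs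
            (Or.inr (Block.path (Below.refl _ _) hcand.2.1)))
        have h6 : (σ₁.reg 63 : ℝ) ≤ n := by exact_mod_cast hlen
        push_cast
        linarith
      · intro v
        rw [h₃]
        simp only [mem_block]
        congr
      · intro v hv
        simp only [State.setReg_arr, h₄, mem_block]
        by_cases hB : R.Block A s u v
        · simp [hB]
        · simp only [hB, if_false]
          rw [hF₁.arr _ (by simp [listBlock_writesArr])]
          simpa using h₂ v (hv.resolve_right hB)
    · intro hDu
      have hD : D u := by_contra fun h => hDu (by simp [h])
      exact ⟨D, out, hI.next hui hD, by push_cast; linarith, by simp, by simpa using h₂⟩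
  · rintro c' σ' hF ⟨D, out, hI, hc, -, h₂⟩
    refine ⟨?_, D, out, hI, fun u => h₂ u (hI.done u (by omega))⟩
    have h5 : 40 * ((n : ℝ) + 1) * numSinks I D ≤
        40 * ((n : ℝ) + 1) * k := by
      gcongr
      exact numSinks_le D
    linarith

end

/-! ### Existence of rootings -/

namespace Rooting

variable {n : ℕ} {T : SimpleGraph (Fin n)}

/-- Every tree can be rooted at every vertex: the parent is the second vertex of the path to the
root, and the vertices are ordered by decreasing distance from the root. -/
theorem exists_root (hT : T.IsTree) (r : Fin n) :
    ∃ R : Rooting T, R.root = r ∧ ∀ u, u ≠ r → T.dist (R.par u) r < T.dist u r := by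
  choose P hP hd using fun u => hT.connected.exists_path_of_dist u r
  have hnil : ∀ u, u ≠ r → ¬ (P u).Nil := fun u hu h => hu h.eq
  have hdist : ∀ u, u ≠ r → T.dist (P u).snd r < T.dist u r := by
    intro u hu
    have h₁ := SimpleGraph.dist_le (P u).tail
    have h₂ := SimpleGraph.Walk.length_tail_add_one (hnil u hu)
    have h₃ := hd u
    omega
  have hpar : ∀ u, u ≠ r → (if u = r then r else (P u).snd) = (P u).snd := fun u hu => if_neg hu
  refine ⟨⟨r, fun u => if u = r then r else (P u).snd,
    Tuple.sort fun u => OrderDual.toDual (T.dist u r), if_pos rfl, fun u hu => ?_, fun u v h => ?_,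
    fun u hu => ?_⟩, rfl, fun u hu => ?_⟩
  · rw [hpar u hu]
    exact (P u).adj_snd (hnil u hu)
  · by_cases hv : v ∈ (P u).support
    · left
      have hu : u ≠ r := by
        rintro rfl
        have : P u = .nil :=
          SimpleGraph.Walk.eq_nil_iff_nil.2 (SimpleGraph.Walk.isPath_iff_nil.1 (hP u))
        rw [this] at hv
        simp only [SimpleGraph.Walk.support_nil, List.mem_singleton] at hv
        exact h.ne hv.symm
      rw [hpar u hu]
      exact (hT.isAcyclic.eq_snd_of_adj_start (hP u) h hv).symm
    · right
      have hvr : v ≠ r := by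
        rintro rfl
        exact hv (P u).end_mem_support
      have := (hT.isAcyclic.subsingleton_path v r).elim ⟨P v, hP v⟩
        ⟨.cons h.symm (P u), (hP u).cons hv⟩
      have h' : P v = .cons h.symm (P u) := congrArg Subtype.val this
      rw [hpar v hvr, h', SimpleGraph.Walk.snd_cons]
  · rw [hpar u hu]
    by_contra hle
    have := Tuple.monotone_sort (fun u => OrderDual.toDual (T.dist u r)) (not_lt.1 hle)
    simp only [Function.comp_apply, Equiv.apply_symm_apply, OrderDual.toDual_le_toDual] at this
    have h₁ := hdist u hu
    omega
  · simp only [hpar u hu]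
    exact hdist u hu

theorem adj_and_dist_lt_iff {R : Rooting T}
    (hR : ∀ u, u ≠ R.root → T.dist (R.par u) R.root < T.dist u R.root) {u v : Fin n} :
    T.Adj u v ∧ T.dist v R.root < T.dist u R.root ↔ u ≠ R.root ∧ R.par u = v := by
  constructor
  · rintro ⟨h, hd⟩
    have hu : u ≠ R.root := by
      rintro rfl
      simp at hd
    refine ⟨hu, (R.edge u v h).resolve_right fun hv => ?_⟩
    by_cases hvr : v = R.root
    · rw [hvr, R.par_root] at hv
      exact hu hv.symm
    · have := hR v hvr
      rw [hv] at this
      omega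
  · rintro ⟨hu, rfl⟩
    exact ⟨R.adj u hu, hR u hu⟩

theorem adj_root_iff {R : Rooting T} {u : Fin n} :
    T.Adj u R.root ↔ u ≠ R.root ∧ R.par u = R.root := by
  constructor
  · intro h
    refine ⟨h.ne, (R.edge _ _ h).resolve_right fun h' => h.ne ?_⟩
    rw [← h', R.par_root]
  · rintro ⟨hu, h⟩
    have := R.adj u hu
    rwa [h] at this

theorem isSubtree_singleton (s : Fin n) : IsSubtree T {s} := by
  have : Subsingleton ((({s} : Finset (Fin n)) : Set (Fin n))) := by
    simp only [Finset.coe_singleton]; infer_instance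
  have : Nonempty ((({s} : Finset (Fin n)) : Set (Fin n))) := ⟨⟨s, by simp⟩⟩
  exact SimpleGraph.IsTree.of_subsingleton

end Rooting

/-! ### The evacuation cost is relaxed minmax monotone -/

section

variable {n : ℕ} {T : SimpleGraph (Fin n)} {R : Rooting T}

open Rooting

open Classical in
/-- The children of `v`. -/
noncomputable def kids (R : Rooting T) (v : Fin n) : Finset (Fin n) :=
  Finset.univ.filter fun u => u ≠ R.root ∧ R.par u = v

open Classical in
/-- The total weight of the vertices below `v`. -/
noncomputable def weightBelow (R : Rooting T) (g : Fin n → ℝ) (v : Fin n) : ℝ :=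
  ∑ x ∈ Finset.univ.filter (R.Below · v), g x

theorem mem_kids {u v : Fin n} : u ∈ kids R v ↔ u ≠ R.root ∧ R.par u = v := by simp [kids]

theorem ne_of_mem_kids {u v : Fin n} (h : u ∈ kids R v) : u ≠ v := by
  obtain ⟨h₁, rfl⟩ := mem_kids.1 h
  exact (R.par_ne h₁).symm

theorem weightBelow_eq (g : Fin n → ℝ) (v : Fin n) :
    weightBelow R g v = g v + ∑ u ∈ kids R v, weightBelow R g u := by
  classical
  have h : Finset.univ.filter (R.Below · v) =
      insert v ((kids R v).biUnion fun u => Finset.univ.filter (R.Below · u)) := by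
    ext x
    simp only [Finset.mem_filter, Finset.mem_univ, true_and, Finset.mem_insert, Finset.mem_biUnion]
    constructor
    · intro h
      by_cases hxv : x = v
      · exact .inl hxv
      · obtain ⟨c, h₁, h₂, h₃⟩ := exists_child_of_below h hxv
        exact .inr ⟨c, mem_kids.2 ⟨h₃, h₂⟩, h₁⟩
    · rintro (rfl | ⟨c, hc, h⟩)
      · exact Below.refl _ _
      · obtain ⟨-, rfl⟩ := mem_kids.1 hc
        exact h.trans (R.below_par c)
  have hv : v ∉ (kids R v).biUnion fun u => Finset.univ.filter (R.Below · u) := by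
    simp only [Finset.mem_biUnion, Finset.mem_filter, Finset.mem_univ, true_and, not_exists,
      not_and]
    intro u hu h
    have h' := h.antisymm (by rw [← (mem_kids.1 hu).2]; exact R.below_par u)
    exact ne_of_mem_kids hu h'.symm
  rw [weightBelow, h, Finset.sum_insert hv, Finset.sum_biUnion]
  · rfl
  · intro a ha b hb hab
    rw [Function.onFun, Finset.disjoint_left]
    intro x hxa hxb
    simp only [Finset.mem_filter, Finset.mem_univ, true_and] at hxa hxb
    have key : ∀ a b, a ∈ kids R v → b ∈ kids R v → R.Below a b → a = b := by
      intro a b ha hb h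
      by_contra hne
      have h' := h.par_of_ne hne
      rw [(mem_kids.1 ha).2] at h'
      have h'' := h'.antisymm (by rw [← (mem_kids.1 hb).2]; exact R.below_par b)
      exact ne_of_mem_kids hb h''.symm
    rcases hxa.total hxb with h | h
    · exact hab (key _ _ ha hb h)
    · exact hab (key _ _ hb ha h).symm

theorem weightBelow_nonneg {g : Fin n → ℝ} (hg : ∀ x, 0 ≤ g x) (v : Fin n) :
    0 ≤ weightBelow R g v := Finset.sum_nonneg fun x _ => hg x

theorem weightBelow_root (g : Fin n → ℝ) : weightBelow R g R.root = ∑ x, g x := by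
  classical
  rw [weightBelow, Finset.filter_true_of_mem fun x _ => R.below_root x]

theorem weightBelow_congr {g g' : Fin n → ℝ} {v : Fin n} (h : ∀ x, R.Below x v → g x = g' x) :
    weightBelow R g v = weightBelow R g' v :=
  Finset.sum_congr rfl fun x hx => h x (by simpa using hx)

open Classical in
/-- The supplies of the vertices in `U`. -/
noncomputable def supply (w : Fin n → ℝ≥0) (U : Finset (Fin n)) (x : Fin n) : ℝ :=
  if x ∈ U then w x else 0

variable {w : Fin n → ℝ≥0} {c τ : Sym2 (Fin n) → ℝ≥0} {U U' : Finset (Fin n)} {θ θ' : ℝ}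
  {D : Fin n → ℝ → ℝ}

theorem supply_nonneg (x : Fin n) : 0 ≤ supply w U x := by
  rw [supply]; split_ifs <;> simp

variable (R) in
/-- A set that is closed under taking parents: a subtree that contains the root, or empty. -/
def ParClosed (U : Finset (Fin n)) : Prop := ∀ u ∈ U, R.par u ∈ U

theorem ParClosed.of_below (h : ParClosed R U) {x u : Fin n} (hx : x ∈ U) (hxu : R.Below x u) :
    u ∈ U := by
  obtain ⟨j, rfl⟩ := hxu
  induction j with
  | zero => exact hx
  | succ j ih => rw [Function.iterate_succ_apply']; exact h _ ih

theorem ParClosed.of_isSubtree (hU : IsSubtree T U) (hr : R.root ∈ U) : ParClosed R U := by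
  intro u hu
  by_cases hur : u = R.root
  · rwa [hur, R.par_root, ← hur]
  · exact par_mem_of_isSubtree hU hu hr fun h => hur (eq_root_of_root_below h)

theorem ParClosed.isSubtree (hT : T.IsTree) (h : ParClosed R U) (hr : R.root ∈ U) :
    IsSubtree T U :=
  isSubtree_of_par_mem (R := R) hT hr (fun u _ => R.below_root u) fun u hu _ => h u hu

theorem weightBelow_eq_zero (h : ParClosed R U) {u : Fin n} (hu : u ∉ U) :
    weightBelow R (supply w U) u = 0 := by
  refine Finset.sum_eq_zero fun x hx => if_neg fun hxU => hu (h.of_below hxU (by simpa using hx))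

open Classical in
/-- Dynamic flows towards the root, in terms of the parent function. The completion condition says
that the whole supply below each child of the root has left that child in time. -/
structure Evac (R : Rooting T) (w : Fin n → ℝ≥0) (c τ : Sym2 (Fin n) → ℝ≥0) (U : Finset (Fin n))
    (θ : ℝ) (D : Fin n → ℝ → ℝ) : Prop where
  start : ∀ v ∈ U, v ≠ R.root → ∀ x ≤ 0, D v x = 0
  monotone : ∀ v ∈ U, v ≠ R.root → Monotone (D v)
  capacity : ∀ v ∈ U, v ≠ R.root → ∀ x y, x ≤ y → D v y - D v x ≤ c s(v, R.par v) * (y - x)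
  conservation : ∀ v ∈ U, v ≠ R.root → ∀ x,
    D v x ≤ w v + ∑ u ∈ (kids R v).filter (· ∈ U), D u (x - τ s(u, v))
  completion : ∀ u ∈ U, u ∈ kids R R.root →
    weightBelow R (supply w U) u ≤ D u (θ - τ s(u, R.root))

theorem le_weightBelow (hroot : ∀ v ∈ U, v ≠ R.root → ∀ x,
      D v x ≤ w v + ∑ u ∈ (kids R v).filter (· ∈ U), D u (x - τ s(u, v)))
    {v : Fin n} (hv : v ∈ U) (hvr : v ≠ R.root) (x : ℝ) :
    D v x ≤ weightBelow R (supply w U) v := by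
  induction v using R.induction_up generalizing x with
  | _ v ih =>
    rw [weightBelow_eq, supply, if_pos hv]
    refine (hroot v hv hvr x).trans (add_le_add le_rfl ?_)
    refine (Finset.sum_le_sum fun u hu => ?_).trans (Finset.sum_le_sum_of_subset_of_nonneg
      (Finset.filter_subset _ _) fun _ _ _ => weightBelow_nonneg supply_nonneg _)
    obtain ⟨hu, huU⟩ := Finset.mem_filter.1 hu
    obtain ⟨hur, rfl⟩ := mem_kids.1 hu
    exact ih u (R.ord_lt u hur) huU hur _

theorem isEvacuation_iff (hR : ∀ u, u ≠ R.root → T.dist (R.par u) R.root < T.dist u R.root)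
    (hU : ParClosed R U) (hr : R.root ∈ U) :
    IsEvacuation T w c τ U R.root θ D ↔ Evac R w c τ U θ D := by
  classical
  have hfilter : ∀ v, (U.filter fun u => T.Adj u v ∧ T.dist v R.root < T.dist u R.root) =
      (kids R v).filter (· ∈ U) := by
    intro v
    ext u
    simp only [Finset.mem_filter, adj_and_dist_lt_iff hR, mem_kids]
    tauto
  have hfilter' : (U.filter fun u => T.Adj u R.root) = (kids R R.root).filter (· ∈ U) := by
    ext u
    simp only [Finset.mem_filter, adj_root_iff, mem_kids]
    tauto
  have hsum : ∑ v ∈ U, (w v : ℝ) = w R.root +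
      ∑ u ∈ (kids R R.root).filter (· ∈ U), weightBelow R (supply w U) u := by
    have h := weightBelow_eq (R := R) (supply w U) R.root
    rw [weightBelow_root, supply, if_pos hr] at h
    rw [Finset.sum_filter_of_ne, ← h]
    · simp [supply]
    · intro u _ hne
      by_contra hu
      exact hne (weightBelow_eq_zero hU hu)
  constructor
  · intro h
    have hcons : ∀ v ∈ U, v ≠ R.root → ∀ x,
        D v x ≤ w v + ∑ u ∈ (kids R v).filter (· ∈ U), D u (x - τ s(u, v)) := by
      intro v hv hvr x
      have := h.conservation v hv hvr x
      convert this using 3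
      convert (hfilter v).symm
    refine ⟨h.start, h.monotone, fun v hv hvr x y hxy => ?_, hcons, fun u hu huk => ?_⟩
    · exact h.capacity v hv hvr _ (R.adj v hvr) (hR v hvr) x y hxy
    · have hle : ∀ u ∈ (kids R R.root).filter (· ∈ U),
          D u (θ - τ s(u, R.root)) ≤ weightBelow R (supply w U) u := fun u hu =>
        le_weightBelow hcons (Finset.mem_filter.1 hu).2
          (mem_kids.1 (Finset.mem_filter.1 hu).1).1 _
      have hcomp := h.completion
      have heq := (Finset.sum_eq_sum_iff_of_le hle).1 (by
        rw [hsum] at hcomp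
        have := add_left_cancel hcomp
        rw [← this]
        refine Finset.sum_congr ?_ fun _ _ => rfl
        convert hfilter'.symm)
      exact (heq u (Finset.mem_filter.2 ⟨huk, hu⟩)).ge
  · intro h
    refine ⟨h.start, h.monotone, fun v hv hvr p hvp hd x y hxy => ?_, fun v hv hvr x => ?_, ?_⟩
    · obtain ⟨-, rfl⟩ := (adj_and_dist_lt_iff hR).1 ⟨hvp, hd⟩
      exact h.capacity v hv hvr x y hxy
    · convert h.conservation v hv hvr x using 3
      convert hfilter v
    · rw [hsum]
      congr 1
      refine (Finset.sum_congr (by convert hfilter') fun _ _ => rfl).trans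
        (Finset.sum_congr rfl fun u hu => ?_)
      obtain ⟨hu, huU⟩ := Finset.mem_filter.1 hu
      exact le_antisymm (le_weightBelow h.conservation huU (mem_kids.1 hu).1 _)
        (h.completion u huU hu)

theorem Evac.mono (h : Evac R w c τ U θ D) (hθ : θ ≤ θ') : Evac R w c τ U θ' D :=
  ⟨h.start, h.monotone, h.capacity, h.conservation, fun u hu hk =>
    (h.completion u hu hk).trans (h.monotone u hu (mem_kids.1 hk).1 (by linarith))⟩

/-- If the supplies outside of a smaller subtree are removed, then the flow that leaves each vertex
can be reduced by the amount of supplies removed below it: let the flow start later. -/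
theorem Evac.restrict (h : Evac R w c τ U' θ D) (hU : ParClosed R U) (hsub : U ⊆ U') :
    Evac R w c τ U θ fun v x =>
      max 0 (D v x - (weightBelow R (supply w U') v - weightBelow R (supply w U) v)) := by
  classical
  have hle : ∀ v, weightBelow R (supply w U) v ≤ weightBelow R (supply w U') v := by
    intro v
    refine Finset.sum_le_sum fun x _ => ?_
    by_cases hx : x ∈ U
    · simp [supply, hx, hsub hx]
    · rw [supply, if_neg hx]; exact supply_nonneg _
  refine ⟨fun v hv hvr x hx => ?_, fun v hv hvr x y hxy => ?_, fun v hv hvr x y hxy => ?_,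
    fun v hv hvr x => ?_, fun u hu hk => ?_⟩
  · have := hle v
    rw [h.start v (hsub hv) hvr x hx, max_eq_left]
    linarith
  · exact max_le_max le_rfl (sub_le_sub_right (h.monotone v (hsub hv) hvr hxy) _)
  · have h₁ := h.capacity v (hsub hv) hvr x y hxy
    have h₂ := h.monotone v (hsub hv) hvr hxy
    have h₃ : (0 : ℝ) ≤ c s(v, R.par v) * (y - x) := by linarith
    rw [sub_le_iff_le_add]
    refine max_le (add_nonneg h₃ (le_max_left _ _)) ?_
    have := le_max_right 0 (D v x - (weightBelow R (supply w U') v - weightBelow R (supply w U) v))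
    linarith
  · refine max_le (add_nonneg (by positivity) (Finset.sum_nonneg fun _ _ => le_max_left _ _)) ?_
    have h₁ := h.conservation v (hsub hv) hvr x
    have h₂ := weightBelow_eq (R := R) (supply w U') v
    have h₃ := weightBelow_eq (R := R) (supply w U) v
    rw [supply, if_pos (hsub hv)] at h₂
    rw [supply, if_pos hv] at h₃
    have key : ∑ u ∈ (kids R v).filter (· ∈ U'), D u (x - τ s(u, v)) +
        ∑ u ∈ kids R v, weightBelow R (supply w U) u ≤
        ∑ u ∈ kids R v, weightBelow R (supply w U') u +
        ∑ u ∈ (kids R v).filter (· ∈ U), max 0 (D u (x - τ s(u, v)) -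
          (weightBelow R (supply w U') u - weightBelow R (supply w U) u)) := by
      rw [Finset.sum_filter, Finset.sum_filter, ← Finset.sum_add_distrib,
        ← Finset.sum_add_distrib]
      refine Finset.sum_le_sum fun u hu => ?_
      by_cases huU : u ∈ U
      · rw [if_pos huU, if_pos (hsub huU)]
        have := le_max_right 0 (D u (x - τ s(u, v)) -
          (weightBelow R (supply w U') u - weightBelow R (supply w U) u))
        linarith
      · rw [if_neg huU, weightBelow_eq_zero hU huU]
        by_cases huU' : u ∈ U'
        · rw [if_pos huU']
          have := le_weightBelow h.conservation huU' (mem_kids.1 hu).1 (x - τ s(u, v))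
          linarith
        · rw [if_neg huU']
          have := weightBelow_nonneg (R := R) (supply_nonneg (w := w) (U := U')) u
          linarith
    linarith
  · refine le_trans ?_ (le_max_right _ _)
    have := h.completion u (hsub hu) hk
    linarith

/-- Flows on the branches at the root can be joined. -/
theorem Evac.join (hU : ParClosed R U) {B : Fin n → Finset (Fin n)}
    (hB : ∀ u v, v ∈ B u ↔ v = R.root ∨ v ∈ U ∧ R.Below v u) {D : Fin n → Fin n → ℝ → ℝ}
    (h : ∀ u ∈ U, u ∈ kids R R.root → Evac R w c τ (B u) θ (D u)) :
    ∃ D', Evac R w c τ U θ D' := by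
  classical
  have hb : ∀ v, ∃ u, v ≠ R.root → u ∈ kids R R.root ∧ R.Below v u := by
    intro v
    by_cases hv : v = R.root
    · exact ⟨v, fun h => absurd hv h⟩
    · obtain ⟨u, h₁, h₂, h₃⟩ := exists_child_of_below (R.below_root v) hv
      exact ⟨u, fun _ => ⟨mem_kids.2 ⟨h₃, h₂⟩, h₁⟩⟩
  choose b hb using hb
  have huniq : ∀ v u, v ≠ R.root → u ∈ kids R R.root → R.Below v u → b v = u := by
    have key : ∀ a b, a ∈ kids R R.root → b ∈ kids R R.root → R.Below a b → a = b := by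
      intro a b ha hb h
      by_contra hne
      have h' := h.par_of_ne hne
      rw [(mem_kids.1 ha).2] at h'
      exact (mem_kids.1 hb).1 (eq_root_of_root_below h')
    intro v u hv hu hvu
    obtain ⟨h₁, h₂⟩ := hb v hv
    rcases h₂.total hvu with h | h
    · exact key _ _ h₁ hu h
    · exact (key _ _ hu h₁ h).symm
  have hv : ∀ v ∈ U, v ≠ R.root → v ∈ B (b v) ∧ Evac R w c τ (B (b v)) θ (D (b v)) := by
    intro v hv hvr
    obtain ⟨h₁, h₂⟩ := hb v hvr
    exact ⟨(hB _ _).2 (.inr ⟨hv, h₂⟩), h _ (hU.of_below hv h₂) h₁⟩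
  refine ⟨fun v => D (b v) v, fun v hvU hvr => (hv v hvU hvr).2.start v (hv v hvU hvr).1 hvr,
    fun v hvU hvr => (hv v hvU hvr).2.monotone v (hv v hvU hvr).1 hvr,
    fun v hvU hvr => (hv v hvU hvr).2.capacity v (hv v hvU hvr).1 hvr, fun v hvU hvr x => ?_,
    fun u hu hk => ?_⟩
  · refine ((hv v hvU hvr).2.conservation v (hv v hvU hvr).1 hvr x).trans (add_le_add le_rfl ?_)
    refine le_of_eq (Finset.sum_congr (Finset.filter_congr fun u hu => ?_) fun u hu => ?_)
    · obtain ⟨hur, rfl⟩ := mem_kids.1 hu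
      rw [hB]
      exact ⟨fun h => (h.resolve_left hur).1,
        fun h => .inr ⟨h, (R.below_par u).trans (hb _ hvr).2⟩⟩
    · obtain ⟨hur, rfl⟩ := mem_kids.1 (Finset.mem_filter.1 hu).1
      rw [huniq u (b (R.par u)) hur (hb _ hvr).1 ((R.below_par u).trans (hb _ hvr).2)]
  · have hur := (mem_kids.1 hk).1
    have hbu := huniq u u hur hk (Below.refl _ _)
    have h₁ := (hv u hu hur).2.completion u (hv u hu hur).1 hk
    simp only [hbu] at h₁ ⊢
    refine le_trans (le_of_eq (weightBelow_congr fun x hx => ?_)) h₁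
    have hxr : x ≠ R.root := fun h => hur (eq_root_of_root_below (h ▸ hx))
    have : x ∈ B u ↔ x ∈ U := by
      rw [hB]
      exact ⟨fun h => (h.resolve_left hxr).1, fun h => .inr ⟨h, hx⟩⟩
    simp [supply, this]

theorem mem_slice_iff (hU : ParClosed R U) {u v : Fin n} (hu : u ∈ U)
    (hk : u ∈ kids R R.root) : v ∈ slice T U R.root u ↔ v ∈ U ∧ R.Below v u := by
  have hur := (mem_kids.1 hk).1
  simp only [slice, Finset.mem_filter, Finset.mem_univ, true_and]
  constructor
  · rintro ⟨p, hp⟩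
    refine ⟨(hp v p.end_mem_support).1, ?_⟩
    have key : ∀ {a b : Fin n} (p : T.Walk a b), (∀ x ∈ p.support, x ∈ U ∧ x ≠ R.root) →
        R.Below a u → R.Below b u := by
      intro a b p
      induction p with
      | nil => exact fun _ => id
      | @cons a b c hab p ih =>
        intro hp ha
        refine ih (fun x hx => hp x (by simp [hx])) ?_
        rcases R.edge a b hab with h | h
        · rw [← h]
          refine ha.par_of_ne fun hau => ?_
          have hbr : b ≠ R.root := (hp b (by simp)).2
          rw [← h, hau, (mem_kids.1 hk).2] at hbr
          exact hbr rfl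
        · rw [← h] at ha
          exact (R.below_par b).trans ha
    exact key p hp (Below.refl _ _)
  · rintro ⟨hv, j, hj⟩
    induction j generalizing v with
    | zero =>
      obtain rfl : v = u := hj
      exact ⟨.nil, fun x hx => by
        obtain rfl : x = v := by simpa using hx
        exact ⟨hv, hur⟩⟩
    | succ j ih =>
      have hvr : v ≠ R.root := by
        rintro rfl
        exact hur (eq_root_of_root_below ⟨_, hj⟩)
      obtain ⟨p, hp⟩ := ih (hU v hv) hj
      refine ⟨p.concat (R.adj v hvr).symm, fun x hx => ?_⟩
      rw [SimpleGraph.Walk.support_concat, List.mem_append] at hx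
      rcases hx with hx | hx
      · exact hp x hx
      · obtain rfl : x = v := by simpa using hx
        exact ⟨hv, hvr⟩

theorem evacuationCost_eq (hR : ∀ u, u ≠ R.root → T.dist (R.par u) R.root < T.dist u R.root)
    (hU : IsSubtree T U) (hr : R.root ∈ U) : evacuationCost T w c τ U R.root =
      ⨅ θ : {θ : ℝ≥0 // ∃ D, Evac R w c τ U θ D}, ((θ : ℝ≥0) : ℝ≥0∞) := by
  rw [evacuationCost, if_pos ⟨hU, hr⟩]
  exact Equiv.iInf_congr (Equiv.subtypeEquivRight fun θ => exists_congr fun D =>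
    isEvacuation_iff hR (ParClosed.of_isSubtree hU hr) hr) fun _ => rfl

theorem evacuationCost_isRelaxedMinmaxMonotone (hT : T.IsTree) (w : Fin n → ℝ≥0)
    (c τ : Sym2 (Fin n) → ℝ≥0) : IsRelaxedMinmaxMonotone T (evacuationCost T w c τ) := by
  classical
  have hmono : ∀ U₁ U₂ s, IsSubtree T U₁ → IsSubtree T U₂ → s ∈ U₁ → U₁ ⊆ U₂ →
      evacuationCost T w c τ U₁ s ≤ evacuationCost T w c τ U₂ s := by
    intro U₁ U₂ s h₁ h₂ hs hsub
    obtain ⟨R, rfl, hR⟩ := exists_root hT s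
    rw [evacuationCost_eq hR h₁ hs, evacuationCost_eq hR h₂ (hsub hs)]
    refine le_iInf fun ⟨θ, D, hD⟩ => ?_
    exact iInf_le_of_le ⟨θ, _, hD.restrict (.of_isSubtree h₁ hs) hsub⟩ le_rfl
  refine ⟨fun s => ?_, fun U s h => if_neg fun h' => h h'.1, fun U s h => if_neg fun h' => h h'.2,
    hmono, fun U s hU hs => ?_⟩
  · obtain ⟨R, rfl, hR⟩ := exists_root hT s
    rw [evacuationCost_eq hR (isSubtree_singleton _) (by simp)]
    refine nonpos_iff_eq_zero.1 (iInf_le_of_le ⟨0, 0, ?_⟩ (by simp))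
    refine ⟨fun v hv hvr => ?_, fun v hv hvr => ?_, fun v hv hvr => ?_, fun v hv hvr => ?_,
      fun v hv hk => ?_⟩
    all_goals rw [Finset.mem_singleton] at hv
    · exact absurd hv hvr
    · exact absurd hv hvr
    · exact absurd hv hvr
    · exact absurd hv hvr
    · exact absurd hv (mem_kids.1 hk).1
  · obtain ⟨R, rfl, hR⟩ := exists_root hT s
    have hUc := ParClosed.of_isSubtree hU hs
    have hkid : ∀ u ∈ U.filter (fun u => T.Adj R.root u), u ∈ U ∧ u ∈ kids R R.root := by
      intro u hu
      obtain ⟨h₁, h₂⟩ := Finset.mem_filter.1 hu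
      exact ⟨h₁, mem_kids.2 (adj_root_iff.1 h₂.symm)⟩
    have hmem : ∀ u ∈ U, u ∈ kids R R.root → ∀ v, v ∈ insert R.root (slice T U R.root u) ↔
        v = R.root ∨ v ∈ U ∧ R.Below v u := by
      intro u h₁ h₂ v
      rw [Finset.mem_insert, mem_slice_iff hUc h₁ h₂]
    have hsub : ∀ u ∈ U, u ∈ kids R R.root →
        IsSubtree T (insert R.root (slice T U R.root u)) := by
      intro u h₁ h₂
      refine ParClosed.isSubtree (R := R) hT (fun v hv => ?_) (Finset.mem_insert_self _ _)
      rw [hmem u h₁ h₂] at hv ⊢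
      rcases hv with rfl | ⟨h₃, h₄⟩
      · exact .inl R.par_root
      · by_cases hvu : v = u
        · left; rw [hvu]; exact (mem_kids.1 h₂).2
        · exact .inr ⟨hUc v h₃, h₄.par_of_ne hvu⟩
    apply le_antisymm
    · refine le_of_forall_gt_imp_ge_of_dense fun a ha => ?_
      induction a using ENNReal.recTopCoe with
      | top => exact le_top
      | coe θ =>
        have hex : ∀ u, ∃ D, u ∈ U → u ∈ kids R R.root →
            Evac R w c τ (insert R.root (slice T U R.root u)) θ D := by
          intro u
          by_cases hu : u ∈ U ∧ u ∈ kids R R.root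
          · have hlt : evacuationCost T w c τ (insert R.root (slice T U R.root u)) R.root < θ := by
              refine (Finset.le_sup (f := fun u => evacuationCost T w c τ
                (insert R.root (slice T U R.root u)) R.root) ?_).trans_lt ha
              exact Finset.mem_filter.2 ⟨hu.1, (adj_root_iff.2 (mem_kids.1 hu.2)).symm⟩
            rw [evacuationCost_eq hR (hsub u hu.1 hu.2) (Finset.mem_insert_self _ _),
              iInf_lt_iff] at hlt
            obtain ⟨⟨θ', D, hD⟩, hlt⟩ := hlt
            exact ⟨D, fun _ _ => hD.mono (by exact_mod_cast hlt.le)⟩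
          · exact ⟨0, fun h h' => absurd ⟨h, h'⟩ hu⟩
        choose D hD using hex
        obtain ⟨D', hD'⟩ := Evac.join hUc
          (B := fun u => Finset.univ.filter fun v => v = R.root ∨ v ∈ U ∧ R.Below v u)
          (by simp) (D := D) (w := w) (c := c) (τ := τ) (θ := θ) (fun u h₁ h₂ => by
            convert hD u h₁ h₂ using 1
            ext v
            simp [hmem u h₁ h₂])
        rw [evacuationCost_eq hR hU hs]
        exact iInf_le_of_le ⟨θ, D', hD'⟩ le_rfl
    · refine Finset.sup_le fun u hu => ?_
      obtain ⟨h₁, h₂⟩ := hkid u hu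
      refine hmono _ _ _ (hsub u h₁ h₂) hU (Finset.mem_insert_self _ _) fun v hv => ?_
      rcases (hmem u h₁ h₂ v).1 hv with rfl | h
      · exact hs
      · exact h.1

end

/-! ### Stripping leaves -/

section

variable {n k : ℕ} {I : Input n k} {T : SimpleGraph (Fin n)} {R : Rooting T} {i m : ℕ}
  {q : ℕ → Fin n}

open Rooting

open Classical in
/-- The children of `u` that are not among the first `i` elements of the queue `q`. -/
noncomputable def remaining (R : Rooting T) (q : ℕ → Fin n) (i : ℕ) (u : Fin n) : Finset (Fin n) :=
  (kids R u).filter fun v => ∀ j < i, q j ≠ v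

/-- The state of the leaf stripping algorithm after the removal of `i` vertices: the first `m` cells
of the queue `q` hold those vertices different from the root all of whose children are removed, and
the removed vertices come first. -/
structure QueueInv (R : Rooting T) (i m : ℕ) (q : ℕ → Fin n) : Prop where
  le : i ≤ m
  inj : ∀ a < m, ∀ b < m, q a = q b → a = b
  mem : ∀ u, (∃ j < m, q j = u) ↔ u ≠ R.root ∧ remaining R q i u = ∅
  kids_lt : ∀ j < i, ∀ v ∈ kids R (q j), ∃ l < j, q l = v

theorem remaining_eq_empty {u : Fin n} :
    remaining R q i u = ∅ ↔ ∀ v ∈ kids R u, ∃ j < i, q j = v := by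
  simp [remaining, Finset.filter_eq_empty_iff]

theorem remaining_zero (u : Fin n) : remaining R q 0 u = kids R u := by
  simp [remaining]

theorem remaining_update {p : Fin n} (h : i ≤ m) (u : Fin n) :
    remaining R (Function.update q m p) i u = remaining R q i u := by
  refine Finset.filter_congr fun v _ => forall₂_congr fun j hj => ?_
  rw [Function.update_of_ne (by omega)]

/-- The queue does not run empty: of the vertices not yet removed, the first one in the order is in
the queue. -/
theorem QueueInv.lt (h : QueueInv R i m q) (hi : i < n - 1) : i < m := by
  classical
  set X := Finset.univ.filter fun u => u ≠ R.root ∧ ∀ j < i, q j ≠ u with hX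
  have hne : X.Nonempty := by
    by_contra hemp
    rw [Finset.not_nonempty_iff_eq_empty] at hemp
    have hsub : Finset.univ ⊆ insert R.root ((Finset.range i).image q) := by
      intro u _
      by_contra hu
      have : u ∈ X := by
        simp only [hX, Finset.mem_filter, Finset.mem_univ, true_and]
        simp only [Finset.mem_insert, Finset.mem_image, Finset.mem_range, not_or, not_exists,
          not_and] at hu
        exact hu
      rw [hemp] at this
      simp at this
    have h₁ := Finset.card_le_card hsub
    have h₂ := Finset.card_insert_le R.root ((Finset.range i).image q)
    have h₃ := Finset.card_image_le (s := Finset.range i) (f := q)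
    simp only [Finset.card_univ, Fintype.card_fin, Finset.card_range] at h₁ h₃
    omega
  obtain ⟨u, hu, hmin⟩ := Finset.exists_min_image X (fun u => R.ord.symm u) hne
  obtain ⟨-, hur, hun⟩ := Finset.mem_filter.1 hu
  obtain ⟨j, hj, hju⟩ := (h.mem u).2 ⟨hur, remaining_eq_empty.2 fun v hv => by
    obtain ⟨hvr, rfl⟩ := mem_kids.1 hv
    by_contra hvn
    push Not at hvn
    exact absurd (hmin v (Finset.mem_filter.2 ⟨Finset.mem_univ _, hvr, hvn⟩))
      (not_le.2 (R.ord_lt v hvr))⟩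
  by_contra hm
  exact hun j (by omega) hju

theorem QueueInv.head (h : QueueInv R i m q) (hi : i < m) :
    q i ≠ R.root ∧ remaining R q i (q i) = ∅ := (h.mem _).1 ⟨i, hi, rfl⟩

theorem QueueInv.head_mem (h : QueueInv R i m q) (hi : i < m) :
    q i ∈ remaining R q i (R.par (q i)) := by
  refine Finset.mem_filter.2 ⟨mem_kids.2 ⟨(h.head hi).1, rfl⟩, fun j hj hji => ?_⟩
  have := h.inj j (by omega) i hi hji
  omega

theorem QueueInv.par_notMem (h : QueueInv R i m q) (hi : i < m) {j : ℕ} (hj : j ≤ i) :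
    q j ≠ R.par (q i) := by
  intro hji
  rcases hj.lt_or_eq with hj | rfl
  · obtain ⟨l, hl, hli⟩ := h.kids_lt j hj (q i) (mem_kids.2 ⟨(h.head hi).1, hji.symm⟩)
    have := h.inj l (by omega) i hi hli
    omega
  · exact R.par_ne (h.head hi).1 hji.symm

theorem remaining_succ (u : Fin n) : remaining R q (i + 1) u = (remaining R q i u).erase (q i) := by
  classical
  ext v
  simp only [remaining, Finset.mem_filter, Finset.mem_erase]
  constructor
  · exact fun ⟨h, h'⟩ => ⟨fun hv => h' i (by omega) hv.symm, h, fun j hj => h' j (by omega)⟩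
  · rintro ⟨h₁, h₂, h₃⟩
    refine ⟨h₂, fun j hj => ?_⟩
    rcases Nat.lt_succ_iff_lt_or_eq.1 hj with h | rfl
    · exact h₃ j h
    · exact h₁.symm

theorem remaining_succ_of_ne {u : Fin n} (hu : u ≠ R.par (q i)) :
    remaining R q (i + 1) u = remaining R q i u := by
  rw [remaining_succ, Finset.erase_eq_of_notMem]
  intro h
  exact hu (mem_kids.1 (Finset.mem_filter.1 h).1).2.symm

theorem QueueInv.kids_lt_succ (h : QueueInv R i m q) (hi : i < m) :
    ∀ j < i + 1, ∀ v ∈ kids R (q j), ∃ l < j, q l = v := by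
  intro j hj
  rcases Nat.lt_succ_iff_lt_or_eq.1 hj with hj | rfl
  · exact h.kids_lt j hj
  · exact remaining_eq_empty.1 (h.head hi).2

theorem QueueInv.step (h : QueueInv R i m q) (hi : i < m)
    (hp : ¬ (R.par (q i) ≠ R.root ∧ remaining R q (i + 1) (R.par (q i)) = ∅)) :
    QueueInv R (i + 1) m q := by
  refine ⟨hi, h.inj, fun u => ?_, h.kids_lt_succ hi⟩
  rw [h.mem]
  by_cases hu : u = R.par (q i)
  · rw [hu]
    refine ⟨fun h' => ?_, fun h' => absurd h' hp⟩
    have := h.head_mem hi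
    rw [h'.2] at this
    simp at this
  · rw [remaining_succ_of_ne hu]

theorem QueueInv.step_push (h : QueueInv R i m q) (hi : i < m)
    (hp : R.par (q i) ≠ R.root ∧ remaining R q (i + 1) (R.par (q i)) = ∅) :
    QueueInv R (i + 1) (m + 1) (Function.update q m (R.par (q i))) := by
  have hmem := h.head_mem hi
  have hnew : ∀ j < m, q j ≠ R.par (q i) := by
    intro j hj hji
    have := (h.mem (R.par (q i))).1 ⟨j, hj, hji⟩
    rw [this.2] at hmem
    simp at hmem
  have hupd : ∀ j < m, Function.update q m (R.par (q i)) j = q j := fun j hj =>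
    Function.update_of_ne (by omega) _ _
  refine ⟨by omega, fun a ha b hb hab => ?_, fun u => ?_, fun j hj v hv => ?_⟩
  · rcases Nat.lt_succ_iff_lt_or_eq.1 ha with ha | rfl <;>
    rcases Nat.lt_succ_iff_lt_or_eq.1 hb with hb | rfl
    · rw [hupd a ha, hupd b hb] at hab
      exact h.inj a ha b hb hab
    · rw [hupd a ha, Function.update_self] at hab
      exact absurd hab (hnew a ha)
    · rw [hupd b hb, Function.update_self] at hab
      exact absurd hab.symm (hnew b hb)
    · rfl
  · rw [remaining_update (by omega)]
    by_cases hu : u = R.par (q i)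
    · rw [hu]
      exact ⟨fun _ => hp, fun _ => ⟨m, by omega, Function.update_self ..⟩⟩
    · rw [remaining_succ_of_ne hu, ← h.mem]
      constructor
      · rintro ⟨j, hj, rfl⟩
        rcases Nat.lt_succ_iff_lt_or_eq.1 hj with hj | rfl
        · exact ⟨j, hj, (hupd j hj).symm⟩
        · rw [Function.update_self] at hu
          exact absurd rfl hu
      · rintro ⟨j, hj, rfl⟩
        exact ⟨j, by omega, hupd j hj⟩
  · rw [hupd j (by omega)] at hv
    obtain ⟨l, hl, rfl⟩ := h.kids_lt_succ hi j hj v hv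
    exact ⟨l, hl, hupd l (by omega)⟩

/-- The order of removal, followed by the root, is a valid order for the rooting. -/
theorem QueueInv.exists_rooting (h : QueueInv R (n - 1) m q) :
    ∃ R' : Rooting T, R'.root = R.root ∧ R'.par = R.par ∧
      ∀ i : Fin n, R'.ord i = if (i : ℕ) < n - 1 then q i else R.root := by
  have hm := h.le
  have hinj : Function.Injective fun i : Fin n => if (i : ℕ) < n - 1 then q i else R.root := by
    intro a b hab
    have hroot : ∀ j < n - 1, q j ≠ R.root := fun j hj => ((h.mem _).1 ⟨j, by omega, rfl⟩).1
    simp only at hab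
    split_ifs at hab with ha hb hb
    · exact Fin.ext (h.inj a (by omega) b (by omega) hab)
    · exact absurd hab (hroot _ ha)
    · exact absurd hab.symm (hroot _ hb)
    · exact Fin.ext (by omega)
  set e := Equiv.ofBijective _ (Finite.injective_iff_bijective.1 hinj) with he
  have hval : ∀ i : Fin n, e i = if (i : ℕ) < n - 1 then q i else R.root := fun i => rfl
  refine ⟨⟨R.root, R.par, e, R.par_root, R.adj, R.edge, fun u hu => ?_⟩, rfl, rfl, hval⟩
  obtain ⟨a, rfl⟩ := e.surjective u
  obtain ⟨b, hb⟩ := e.surjective (R.par (e a))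
  rw [← hb, Equiv.symm_apply_apply, Equiv.symm_apply_apply]
  have ha : (a : ℕ) < n - 1 := by
    by_contra ha
    exact hu (by rw [hval, if_neg ha])
  by_cases hbn : (b : ℕ) < n - 1
  · have hk : e a ∈ kids R (q b) := mem_kids.2 ⟨hu, by rw [← hb, hval, if_pos hbn]⟩
    obtain ⟨l, hl, hla⟩ := h.kids_lt b hbn _ hk
    rw [hval, if_pos ha] at hla
    have := h.inj l (by omega) a (by omega) hla
    exact Fin.lt_def.2 (by omega)
  · exact Fin.lt_def.2 (by omega)

/-- Every edge of the list joins one vertex to its parent, and each vertex different from the root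
occurs once in this way. -/
theorem sum_edges (R : Rooting I.tree) {F : Fin n → Fin n → ℕ} (hF : ∀ a b, F a b = F b a) :
    ∑ i, F (I.edge i).1 (I.edge i).2 = ∑ u : {u // u ≠ R.root}, F u (R.par u) := by
  have hex : ∀ u : {u // u ≠ R.root}, ∃ i, I.edge i = (u.1, R.par u) ∨ I.edge i = (R.par u, u.1) :=
    fun u => (I.adj_iff _ _).1 (R.adj u u.2)
  choose e he using hex
  have hinj : Function.Injective e := by
    intro u v huv
    have h₁ := he u
    have h₂ := he v
    rw [huv] at h₁
    have hcross : ∀ u v : {u // u ≠ R.root}, (u.1, R.par u) ≠ (R.par v, v.1) := by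
      intro u v h
      obtain ⟨h, h'⟩ := Prod.mk.injEq .. ▸ h
      have h₃ := R.ord_lt u u.2
      have h₄ := R.ord_lt v v.2
      rw [h'] at h₃
      rw [← h] at h₄
      exact lt_asymm h₃ h₄
    rcases h₁ with h₁ | h₁ <;> rcases h₂ with h₂ | h₂ <;> rw [h₁] at h₂
    · exact Subtype.ext (Prod.mk.inj h₂).1
    · exact absurd h₂ (hcross _ _)
    · exact absurd h₂.symm (hcross _ _)
    · exact Subtype.ext (Prod.mk.inj h₂).2
  have hbij : Function.Bijective e := by
    rw [Fintype.bijective_iff_injective_and_card]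
    exact ⟨hinj, by simp [Fintype.card_subtype_compl]⟩
  rw [← hbij.sum_comp]
  refine Finset.sum_congr rfl fun u _ => ?_
  rcases he u with h | h <;> rw [h]
  exact hF _ _

theorem sum_edges_endpoint (R : Rooting I.tree) (x : Fin n) (g : Fin n → ℕ) :
    ∑ i, ((if (I.edge i).1 = x then g (I.edge i).2 else 0) +
      (if (I.edge i).2 = x then g (I.edge i).1 else 0)) =
    ∑ u ∈ kids R x, g u + if x = R.root then 0 else g (R.par x) := by
  classical
  rw [sum_edges R (F := fun a b => (if a = x then g b else 0) + (if b = x then g a else 0))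
    (fun a b => add_comm _ _), Finset.sum_add_distrib, add_comm]
  have hsub : ∀ F : Fin n → ℕ, ∑ u : {u // u ≠ R.root}, F u =
      ∑ u ∈ Finset.univ.filter (· ≠ R.root), F u := fun F =>
    (Finset.sum_subtype _ (by simp) _).symm
  congr 1
  · rw [hsub fun u => if R.par u = x then g u else 0, ← Finset.sum_filter, Finset.filter_filter]
    refine Finset.sum_congr ?_ fun _ _ => rfl
    ext u
    simp [mem_kids]
  · rw [hsub fun u => if u = x then g (R.par u) else 0, Finset.sum_ite_eq']
    by_cases hx : x = R.root <;> simp [hx]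

end

/-! ### Rooting the tree on the machine -/

section

variable {n k : ℕ} {I : Input n k} {f : Finset (Fin n) → Fin n → ℝ≥0∞} {t : ℕ → ℝ} {σ : State}
  {c : ℝ}

open Rooting

/-- Compute the degrees of the vertices in the array 4, and the sums of the neighbours in the
array 5. The register 3 holds the number of edges. -/
def countNeighbours : Program :=
  forUp 4 3 <|
    .seq (.set 5 (.arr 0 (.reg 4))) <|
    .seq (.set 6 (.arr 1 (.reg 4))) <|
    .seq (.store 4 (.reg 5) (.add (.arr 4 (.reg 5)) (.lit 1))) <|
    .seq (.store 4 (.reg 6) (.add (.arr 4 (.reg 6)) (.lit 1))) <|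
    .seq (.store 5 (.reg 5) (.add (.arr 5 (.reg 5)) (.reg 6)))
      (.store 5 (.reg 6) (.add (.arr 5 (.reg 6)) (.reg 5)))

theorem run_countNeighbours (R : Rooting I.tree) (h₃ : σ.reg 3 = n - 1)
    (ha : ∀ i : Fin (n - 1), σ.arr 0 i = (I.edge i).1)
    (hb : ∀ i : Fin (n - 1), σ.arr 1 i = (I.edge i).2)
    (h₄ : ∀ x, σ.arr 4 x = 0) (h₅ : ∀ x, σ.arr 5 x = 0) :
    Run I.tree f t countNeighbours c σ fun c' σ' => c' ≤ c + 8 * n + 2 ∧ ∀ u : Fin n,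
      σ'.arr 4 u = (kids R u).card + (if u = R.root then 0 else 1) ∧
      σ'.arr 5 u = ∑ v ∈ kids R u, (v : ℕ) + (if u = R.root then 0 else (R.par u : ℕ)) := by
  rw [countNeighbours]
  refine Run.forUp (N := n - 1) (fun m c' σ' => c' ≤ c + 1 + 8 * m ∧ ∀ x,
    σ'.arr 4 x = ∑ i ∈ Finset.range m, ((if σ.arr 0 i = x then 1 else 0) +
      (if σ.arr 1 i = x then 1 else 0)) ∧
    σ'.arr 5 x = ∑ i ∈ Finset.range m, ((if σ.arr 0 i = x then σ.arr 1 i else 0) +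
      (if σ.arr 1 i = x then σ.arr 0 i else 0)))
    h₃ (by norm_num) (by simp) (by simp) ?_ ?_ ?_
  · exact ⟨by norm_num, by simp [h₄, h₅]⟩
  · rintro m c' σ' hm hF hreg ⟨hc, h⟩
    have h₀ : σ'.arr 0 = σ.arr 0 := hF.arr _ (by simp)
    have h₁ : σ'.arr 1 = σ.arr 1 := hF.arr _ (by simp)
    simp only [run_seq, run_set, run_store]
    refine ⟨by push_cast; linarith, fun x => ?_⟩
    simp only [Finset.sum_range_succ, ← (h x).1, ← (h x).2, Exp.eval, State.setReg_arr,
      State.setReg_reg, State.setArr_arr, State.setArr_reg, hreg, h₀, h₁, if_true, if_false,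
      Nat.reduceEqDiff, OfNat.zero_ne_ofNat, OfNat.one_ne_ofNat, Function.update_apply]
    constructor <;> grind
  · rintro c' σ' hF ⟨hc, h⟩
    have hn : ((n - 1 : ℕ) : ℝ) ≤ n := by exact_mod_cast Nat.sub_le _ _
    refine ⟨by linarith, fun u => ?_⟩
    rw [(h u).1, (h u).2, Finset.sum_range, Finset.sum_range]
    simp only [ha, hb, Fin.val_inj]
    rw [sum_edges_endpoint R u fun _ => 1, sum_edges_endpoint R u fun v => (v : ℕ)]
    simp

/-- Mark the sinks in the array 8. -/
def markSinks : Program := forUp 4 1 (.store 8 (.arr 2 (.reg 4)) (.lit 1))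

theorem run_markSinks (h₁ : σ.reg 1 = k) (h₂ : ∀ a : Fin k, σ.arr 2 a = I.sink a)
    (h₈ : ∀ x, σ.arr 8 x = 0) :
    Run I.tree f t markSinks c σ fun c' σ' => c' ≤ c + 3 * k + 2 ∧
      ∀ u : Fin n, σ'.arr 8 u = if u ∈ I.sinks then 1 else 0 := by
  classical
  rw [markSinks]
  refine Run.forUp (N := k) (fun m c' σ' => c' ≤ c + 1 + 3 * m ∧ ∀ u : Fin n,
    σ'.arr 8 u = if ∃ a : Fin k, (a : ℕ) < m ∧ I.sink a = u then 1 else 0)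
    h₁ (by norm_num) (by simp) (by simp) ?_ ?_ ?_
  · exact ⟨by norm_num, by simp [h₈]⟩
  · rintro m c' σ' hm hF hreg ⟨hc, h⟩
    have h₂' : σ'.arr 2 = σ.arr 2 := hF.arr _ (by simp)
    have hsink := h₂ ⟨m, hm⟩
    simp only at hsink
    rw [run_store]
    refine ⟨by push_cast; linarith, fun u => ?_⟩
    have hex : (∃ a : Fin k, (a : ℕ) < m + 1 ∧ I.sink a = u) ↔
        u = I.sink ⟨m, hm⟩ ∨ ∃ a : Fin k, (a : ℕ) < m ∧ I.sink a = u := by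
      constructor
      · rintro ⟨a, ha, rfl⟩
        rcases Nat.lt_succ_iff_lt_or_eq.1 ha with ha | ha
        · exact .inr ⟨a, ha, rfl⟩
        · obtain rfl : a = ⟨m, hm⟩ := Fin.ext ha
          exact .inl rfl
      · rintro (rfl | ⟨a, ha, rfl⟩)
        · exact ⟨_, by simp, rfl⟩
        · exact ⟨a, by omega, rfl⟩
    simp only [Exp.eval, State.setReg_arr, State.setArr_arr, if_true, hreg, h₂', hsink,
      Function.update_apply, Fin.val_inj, hex]
    by_cases hu : u = I.sink ⟨m, hm⟩
    · simp [hu]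
    · simp [hu, h]
  · rintro c' σ' hF ⟨hc, h⟩
    refine ⟨by linarith, fun u => ?_⟩
    rw [h]
    congr 1
    simp [Input.sinks]

/-- Put the vertex in the register `x` into the queue in the array 6, whose length is in the
register 5, if it has degree 1 and is not the root. -/
def pushLeaf (x : ℕ) : Program :=
  .cond (.and (.eq (.arr 4 (.reg x)) (.lit 1)) (.not (.eq (.reg x) (.reg 2))))
    (.seq (.store 6 (.reg 5) (.reg x)) (.set 5 (.add (.reg 5) (.lit 1)))) .skip

/-- Put all leaves different from the root into the queue. -/
def collectLeaves : Program := .seq (.set 5 (.lit 0)) (forUp 4 0 (pushLeaf 4))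

theorem run_collectLeaves (R : Rooting I.tree) (h₀ : σ.reg 0 = n) (h₂ : σ.reg 2 = R.root)
    (h₄ : ∀ u : Fin n, σ.arr 4 u = (kids R u).card + (if u = R.root then 0 else 1)) :
    Run I.tree f t collectLeaves c σ fun c' σ' => c' ≤ c + 6 * n + 3 ∧
      ∃ q : ℕ → Fin n, QueueInv R 0 (σ'.reg 5) q ∧ ∀ j < σ'.reg 5, σ'.arr 6 j = q j := by
  classical
  rw [collectLeaves, run_seq, run_set]
  refine Run.forUp (N := n) (fun m c' σ' => c' ≤ c + 2 + 6 * m ∧ ∃ q : ℕ → Fin n,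
    (∀ a < σ'.reg 5, ∀ b < σ'.reg 5, q a = q b → a = b) ∧
    (∀ u : Fin n, (∃ j < σ'.reg 5, q j = u) ↔ (u : ℕ) < m ∧ u ≠ R.root ∧ kids R u = ∅) ∧
    ∀ j < σ'.reg 5, σ'.arr 6 j = q j)
    (by simpa using h₀) (by norm_num) (by simp [pushLeaf]) (by simp [pushLeaf]) ?_ ?_ ?_
  · exact ⟨by norm_num; linarith, fun _ => R.root, by simp⟩
  · rintro m c' σ' hm hF hreg ⟨hc, q, hinj, hmem, harr⟩
    have h₂' : σ'.reg 2 = R.root := by rw [hF.reg _ (by simp [pushLeaf])]; simpa using h₂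
    have h₄' : σ'.arr 4 m = (kids R ⟨m, hm⟩).card +
        (if (⟨m, hm⟩ : Fin n) = R.root then 0 else 1) := by
      rw [hF.arr _ (by simp [pushLeaf])]; exact h₄ ⟨m, hm⟩
    have hroot : m = R.root ↔ (⟨m, hm⟩ : Fin n) = R.root := by rw [Fin.ext_iff]
    have hlt : ∀ {u : Fin n}, (u : ℕ) < m + 1 ↔ (u : ℕ) < m ∨ u = ⟨m, hm⟩ := by
      intro u
      rw [Nat.lt_succ_iff_lt_or_eq, Fin.ext_iff]
    rw [pushLeaf, run_cond, run_seq, run_store, run_set, run_skip]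
    simp only [Test.holds, Test.eq_holds, Exp.eval, hreg, h₂', h₄', hroot]
    constructor
    · rintro ⟨h₅, h₆⟩
      rw [if_neg h₆] at h₅
      have hk : kids R ⟨m, hm⟩ = ∅ := Finset.card_eq_zero.1 (by omega)
      have hupd : ∀ j < σ'.reg 5, Function.update q (σ'.reg 5) ⟨m, hm⟩ j = q j := fun j hj =>
        Function.update_of_ne (by omega) _ _
      have hnew : ∀ j < σ'.reg 5, q j ≠ ⟨m, hm⟩ := by
        intro j hj hjm
        have := ((hmem ⟨m, hm⟩).1 ⟨j, hj, hjm⟩).1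
        simp at this
      refine ⟨by push_cast; linarith, Function.update q (σ'.reg 5) ⟨m, hm⟩, ?_, ?_, ?_⟩
      all_goals
        simp only [State.setReg_reg, State.setReg_arr, State.setArr_reg, State.setArr_arr, if_true,
          if_false, Nat.reduceEqDiff]
      · intro a ha b hb hab
        rcases Nat.lt_succ_iff_lt_or_eq.1 ha with ha | rfl <;>
        rcases Nat.lt_succ_iff_lt_or_eq.1 hb with hb | rfl
        · rw [hupd a ha, hupd b hb] at hab
          exact hinj a ha b hb hab
        · rw [hupd a ha, Function.update_self] at hab
          exact absurd hab (hnew a ha)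
        · rw [hupd b hb, Function.update_self] at hab
          exact absurd hab.symm (hnew b hb)
        · rfl
      · intro u
        rw [hlt]
        constructor
        · rintro ⟨j, hj, rfl⟩
          rcases Nat.lt_succ_iff_lt_or_eq.1 hj with hj | rfl
          · rw [hupd j hj]
            obtain ⟨h₇, h₈⟩ := (hmem _).1 ⟨j, hj, rfl⟩
            exact ⟨.inl h₇, h₈⟩
          · rw [Function.update_self]
            exact ⟨.inr rfl, h₆, hk⟩
        · rintro ⟨h₇ | rfl, h₈⟩
          · obtain ⟨j, hj, rfl⟩ := (hmem _).2 ⟨h₇, h₈⟩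
            exact ⟨j, by omega, hupd j hj⟩
          · exact ⟨_, by omega, Function.update_self ..⟩
      · intro j hj
        rcases Nat.lt_succ_iff_lt_or_eq.1 hj with hj | rfl
        · rw [hupd j hj, Function.update_of_ne (by omega), harr j hj]
        · rw [Function.update_self, Function.update_self]
    · intro h₅
      refine ⟨by push_cast; linarith, q, by simpa using hinj, fun u => ?_, by simpa using harr⟩
      simp only [State.setReg_reg, Nat.reduceEqDiff, if_false]
      rw [hmem, hlt]
      refine ⟨fun ⟨h, h'⟩ => ⟨.inl h, h'⟩, ?_⟩
      rintro ⟨h | rfl, h₆, h₇⟩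
      · exact ⟨h, h₆, h₇⟩
      · exact absurd ⟨by rw [h₇, if_neg h₆]; rfl, h₆⟩ h₅
  · rintro c' σ' hF ⟨hc, q, hinj, hmem, harr⟩
    refine ⟨by linarith, q, ⟨by omega, hinj, fun u => ?_, by simp⟩, harr⟩
    rw [hmem, remaining_zero]
    simp

/-- Remove the vertices in the queue, one after the other, store their parents in the array 7, and
put vertices that become leaves into the queue. -/
def stripLeaves : Program :=
  forUp 4 3 <|
    .seq (.set 6 (.arr 6 (.reg 4))) <|
    .seq (.set 7 (.arr 5 (.reg 6))) <|
    .seq (.store 7 (.reg 6) (.reg 7)) <|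
    .seq (.store 5 (.reg 7) (.sub (.arr 5 (.reg 7)) (.reg 6))) <|
    .seq (.store 4 (.reg 7) (.sub (.arr 4 (.reg 7)) (.lit 1)))
      (pushLeaf 7)

/-- The array 4 holds the degrees in the remaining tree, and the array 5 the sums of the remaining
neighbours; for a leaf other than the root, the sum is its parent. -/
theorem run_stripLeaves (R : Rooting I.tree) (h₂ : σ.reg 2 = R.root) (h₃ : σ.reg 3 = n - 1)
    (h₄ : ∀ u : Fin n, σ.arr 4 u = (kids R u).card + (if u = R.root then 0 else 1))
    (h₅ : ∀ u : Fin n,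
      σ.arr 5 u = ∑ v ∈ kids R u, (v : ℕ) + (if u = R.root then 0 else (R.par u : ℕ)))
    {q : ℕ → Fin n} (hq : QueueInv R 0 (σ.reg 5) q) (hq' : ∀ j < σ.reg 5, σ.arr 6 j = q j) :
    Run I.tree f t stripLeaves c σ fun c' σ' => c' ≤ c + 10 * n + 2 ∧
      ∃ m q, QueueInv R (n - 1) m q ∧
        ∀ j < n - 1, σ'.arr 6 j = q j ∧ σ'.arr 7 (q j) = R.par (q j) := by
  classical
  rw [stripLeaves]
  refine Run.forUp (N := n - 1) (fun i c' σ' => c' ≤ c + 1 + 10 * i ∧ ∃ q : ℕ → Fin n,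
    QueueInv R i (σ'.reg 5) q ∧ (∀ j < σ'.reg 5, σ'.arr 6 j = q j) ∧
    (∀ j < i, σ'.arr 7 (q j) = R.par (q j)) ∧
    ∀ u : Fin n, (∀ j < i, q j ≠ u) →
      σ'.arr 4 u = (remaining R q i u).card + (if u = R.root then 0 else 1) ∧
      σ'.arr 5 u = ∑ v ∈ remaining R q i u, (v : ℕ) + (if u = R.root then 0 else (R.par u : ℕ)))
    h₃ (by norm_num) (by simp [pushLeaf]) (by simp [pushLeaf]) ?_ ?_ ?_
  · refine ⟨by norm_num, q, by simpa using hq, by simpa using hq', by simp, fun u _ => ?_⟩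
    rw [remaining_zero]
    exact ⟨h₄ u, h₅ u⟩
  · rintro i c' σ' hi hF hreg ⟨hc, q, hQ, hq, h₇, hrem⟩
    have h₂' : σ'.reg 2 = R.root := by rw [hF.reg _ (by simp [pushLeaf]), h₂]
    have him := hQ.lt hi
    obtain ⟨hvr, hv⟩ := hQ.head him
    have hmem := hQ.head_mem him
    have hpn : ∀ {j}, j ≤ i → q j ≠ R.par (q i) := fun hj => hQ.par_notMem him hj
    have hvn : ∀ j < i, q j ≠ q i := fun j hj h => by
      have := hQ.inj j (by omega) i him h
      omega
    have h₆ : σ'.arr 6 i = q i := hq i him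
    have hp : σ'.arr 5 (q i) = R.par (q i) := by
      rw [(hrem (q i) hvn).2, hv, if_neg hvr]
      simp
    simp only [run_seq, run_set, run_store]
    simp only [pushLeaf, run_cond, run_seq, run_store, run_set, run_skip, Test.holds,
      Test.eq_holds, Exp.eval, State.setReg_arr, State.setReg_reg, State.setArr_arr,
      State.setArr_reg, if_true, if_false, Nat.reduceEqDiff, hreg, h₆, hp, h₂', Fin.val_inj,
      Function.update_self]
    have hdeg : σ'.arr 4 (R.par (q i)) - 1 =
        (remaining R q (i + 1) (R.par (q i))).card + (if R.par (q i) = R.root then 0 else 1) := by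
      have := (hrem (R.par (q i)) fun j hj => hpn hj.le).1
      have h' := Finset.card_pos.2 ⟨_, hmem⟩
      rw [this, remaining_succ, Finset.card_erase_of_mem hmem]
      omega
    have hsum : σ'.arr 5 (R.par (q i)) - q i = ∑ v ∈ remaining R q (i + 1) (R.par (q i)), (v : ℕ) +
        (if R.par (q i) = R.root then 0 else (R.par (R.par (q i)) : ℕ)) := by
      have := (hrem (R.par (q i)) fun j hj => hpn hj.le).2
      rw [this, remaining_succ, ← Finset.add_sum_erase _ _ hmem]
      omega
    have hrem' : ∀ u : Fin n, (∀ j < i + 1, q j ≠ u) →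
        Function.update (σ'.arr 4) (R.par (q i)) (σ'.arr 4 (R.par (q i)) - 1) u =
          (remaining R q (i + 1) u).card + (if u = R.root then 0 else 1) ∧
        Function.update (σ'.arr 5) (R.par (q i)) (σ'.arr 5 (R.par (q i)) - q i) u =
          ∑ v ∈ remaining R q (i + 1) u, (v : ℕ) + (if u = R.root then 0 else (R.par u : ℕ)) := by
      intro u hu
      by_cases hup : u = R.par (q i)
      · rw [hup, Function.update_self, Function.update_self]
        exact ⟨hdeg, hsum⟩
      · have hup' : (u : ℕ) ≠ R.par (q i) := fun h => hup (Fin.ext h)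
        rw [Function.update_of_ne hup', Function.update_of_ne hup', remaining_succ_of_ne hup]
        exact hrem u fun j hj => hu j (by omega)
    have h₇' : ∀ j < i + 1,
        Function.update (σ'.arr 7) (q i) (R.par (q i) : ℕ) (q j) = R.par (q j) := by
      intro j hj
      rcases Nat.lt_succ_iff_lt_or_eq.1 hj with hj | rfl
      · rw [Function.update_of_ne fun h => hvn j hj (Fin.ext h), h₇ j hj]
      · rw [Function.update_self]
    have hiff : (σ'.arr 4 (R.par (q i)) - 1 = 1 ∧ ¬ R.par (q i) = R.root) ↔
        (R.par (q i) ≠ R.root ∧ remaining R q (i + 1) (R.par (q i)) = ∅) := by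
      rw [hdeg, ← Finset.card_eq_zero]
      by_cases h : R.par (q i) = R.root
      · simp [h]
      · simp [h]
    rw [hiff]
    constructor
    · intro hpush
      refine ⟨by push_cast; linarith, _, hQ.step_push him hpush, fun j hj => ?_, fun j hj => ?_,
        fun u hu => ?_⟩
      · rcases Nat.lt_succ_iff_lt_or_eq.1 hj with hj | rfl
        · rw [Function.update_of_ne (by omega), Function.update_of_ne (by omega), hq j hj]
        · rw [Function.update_self, Function.update_self]
      · rw [Function.update_of_ne (by omega : j ≠ σ'.reg 5) (R.par (q i)) q]
        exact h₇' j hj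
      · rw [remaining_update (by omega)]
        refine hrem' u fun j hj => ?_
        have := hu j hj
        rwa [Function.update_of_ne (by omega)] at this
    · intro hpush
      exact ⟨by push_cast; linarith, q, hQ.step him hpush, hq, h₇', hrem'⟩
  · rintro c' σ' hF ⟨hc, q, hQ, hq, h₇, -⟩
    have hn : ((n - 1 : ℕ) : ℝ) ≤ n := by exact_mod_cast Nat.sub_le _ _
    have := hQ.le
    exact ⟨by linarith, _, q, hQ, fun j hj => ⟨hq j (by omega), h₇ j hj⟩⟩

/-- Count the children with sinks below them in the array 9. -/
def countKids : Program :=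
  forUp 4 3 <|
    .seq (.set 6 (.arr 6 (.reg 4))) <|
    .cond (.le (.lit 1) (.add (.arr 8 (.reg 6)) (.arr 9 (.reg 6))))
      (.store 9 (.arr 7 (.reg 6)) (.add (.arr 9 (.arr 7 (.reg 6))) (.lit 1)))
      .skip

open Classical in
/-- The children of `x` with sinks below them, among the first `i` vertices. -/
noncomputable def sinkfulKidsBefore (R : Rooting I.tree) (x : Fin n) (i : ℕ) : Finset (Fin n) :=
  (R.sinkfulKids I.sinks x).filter fun u => (R.ord.symm u : ℕ) < i

theorem sinkfulKidsBefore_eq (R : Rooting I.tree) {x : Fin n} {i : ℕ}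
    (hx : (R.ord.symm x : ℕ) ≤ i) : sinkfulKidsBefore R x i = R.sinkfulKids I.sinks x := by
  refine Finset.filter_true_of_mem fun u hu => ?_
  obtain ⟨hur, rfl, -⟩ := mem_sinkfulKids.1 hu
  exact (Fin.lt_def.1 (R.ord_lt u hur)).trans_le hx

theorem run_countKids (R : Rooting I.tree) (h₃ : σ.reg 3 = n - 1)
    (h₆ : ∀ i : Fin n, σ.arr 6 i = R.ord i) (h₇ : ∀ u : Fin n, σ.arr 7 u = R.par u)
    (h₈ : ∀ u : Fin n, σ.arr 8 u = if u ∈ I.sinks then 1 else 0) (h₉ : ∀ x, σ.arr 9 x = 0) :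
    Run I.tree f t countKids c σ fun c' σ' => c' ≤ c + 5 * n + 2 ∧
      ∀ u : Fin n, σ'.arr 9 u = (R.sinkfulKids I.sinks u).card := by
  classical
  rw [countKids]
  refine Run.forUp (N := n - 1) (fun i c' σ' => c' ≤ c + 1 + 5 * i ∧
    ∀ u : Fin n, σ'.arr 9 u = (sinkfulKidsBefore R u i).card)
    h₃ (by norm_num) (by simp) (by simp) ?_ ?_ ?_
  · refine ⟨by norm_num, fun u => ?_⟩
    simp [h₉, sinkfulKidsBefore]
  · rintro i c' σ' hi hF hreg ⟨hc, h⟩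
    have h₆' : σ'.arr 6 = σ.arr 6 := hF.arr _ (by simp)
    have h₇' : σ'.arr 7 = σ.arr 7 := hF.arr _ (by simp)
    have h₈' : σ'.arr 8 = σ.arr 8 := hF.arr _ (by simp)
    have hord := h₆ ⟨i, by omega⟩
    set u := R.ord ⟨i, by omega⟩ with hu
    have hui : (R.ord.symm u : ℕ) = i := by simp [hu]
    simp only at hord
    have hur : u ≠ R.root := by
      intro hur
      have h₁ := (R.below_root (R.ord ⟨n - 1, by omega⟩)).le
      rw [← hur, hu, Equiv.symm_apply_apply, Equiv.symm_apply_apply, Fin.le_def] at h₁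
      simp only at h₁
      omega
    have hmem : ∀ x v, v ∈ sinkfulKidsBefore R x (i + 1) ↔ v ∈ sinkfulKidsBefore R x i ∨
        v = u ∧ u ∈ R.sinkfulKids I.sinks x := by
      intro x v
      simp only [sinkfulKidsBefore, Finset.mem_filter]
      have : v = u ↔ (R.ord.symm v : ℕ) = i := by
        rw [← hui, Fin.val_inj, R.ord.symm.injective.eq_iff]
      rw [Nat.lt_succ_iff_lt_or_eq, and_or_left, ← this]
      constructor
      · rintro (h | ⟨h, rfl⟩)
        · exact .inl h
        · exact .inr ⟨rfl, h⟩
      · rintro (h | ⟨rfl, h⟩)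
        · exact .inl h
        · exact .inr ⟨h, rfl⟩
    have hnot : ∀ x, u ∉ sinkfulKidsBefore R x i := fun x hx => by
      have := (Finset.mem_filter.1 hx).2
      omega
    have hsame : ∀ x, u ∉ R.sinkfulKids I.sinks x →
        sinkfulKidsBefore R x (i + 1) = sinkfulKidsBefore R x i := by
      intro x hx
      ext v
      simp [hmem, hx]
    have hkid : R.Sinkful I.sinks u → ∀ x, u ∈ R.sinkfulKids I.sinks x ↔ x = R.par u := by
      intro hs x
      rw [mem_sinkfulKids]
      exact ⟨fun h => h.2.1.symm, fun h => ⟨hur, h.symm, hs⟩⟩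
    have htest : 1 ≤ (if u ∈ I.sinks then 1 else 0) + (sinkfulKidsBefore R u i).card ↔
        R.Sinkful I.sinks u := by
      rw [sinkfulKidsBefore_eq R hui.le, sinkful_iff]
      by_cases hs : u ∈ I.sinks <;> simp [hs]
    rw [run_seq, run_set, run_cond, run_store, run_skip]
    simp only [Test.holds, Exp.eval, State.setReg_arr, State.setReg_reg, State.setArr_arr, if_true,
      hreg, h₆', h₇', h₈', hord, h₇, h₈, h, htest]
    constructor
    · intro hs
      refine ⟨by push_cast; linarith, fun x => ?_⟩
      rw [Function.update_apply]
      by_cases hx : x = R.par u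
      · have : sinkfulKidsBefore R x (i + 1) = insert u (sinkfulKidsBefore R x i) := by
          ext v
          rw [hmem, Finset.mem_insert, (hkid hs x)]
          tauto
        rw [if_pos (by rw [hx]), this, Finset.card_insert_of_notMem (hnot x), hx]
      · rw [if_neg fun h => hx (Fin.ext h), hsame x (mt (hkid hs x).1 hx), h]
    · intro hs
      refine ⟨by push_cast; linarith, fun x => ?_⟩
      rw [hsame x fun hx => hs (mem_sinkfulKids.1 hx).2.2]
  · rintro c' σ' hF ⟨hc, h⟩
    have hn : ((n - 1 : ℕ) : ℝ) ≤ n := by exact_mod_cast Nat.sub_le _ _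
    refine ⟨by linarith, fun u => ?_⟩
    rw [h, sinkfulKidsBefore_eq R (by omega)]

/-- Root the tree at the first sink and prepare all the data described in `Env`. -/
def prepare : Program :=
  .seq (.set 2 (.arr 2 (.lit 0))) <|
  .seq (.set 3 (.sub (.reg 0) (.lit 1))) <|
  .seq countNeighbours <|
  .seq markSinks <|
  .seq collectLeaves <|
  .seq stripLeaves <|
  .seq (.store 6 (.reg 3) (.reg 2)) <|
  .seq (.store 7 (.reg 2) (.reg 2)) countKids

theorem run_prepare (hk : 0 < k) :
    Run I.tree f t prepare c I.init fun c' σ => c' ≤ c + 29 * n + 3 * k + 15 ∧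
      (∀ x, σ.arr 10 x = 0) ∧ ∃ R : Rooting I.tree, R.root ∈ I.sinks ∧ Env R σ := by
  obtain ⟨R, hr, -⟩ := exists_root I.isTree (I.sink ⟨0, hk⟩)
  have hn : 0 < n := R.root.pos
  simp only [prepare, run_seq, run_set]
  refine (run_countNeighbours R (by simp [Input.init]) (fun i => ?_) (fun i => ?_)
    (by simp [Input.init]) (by simp [Input.init])).mono ?_
  · simp [Input.init]
  · simp [Input.init]
  rintro c₁ σ₁ hF₁ ⟨hc₁, hdeg⟩
  refine (run_markSinks (I := I) ?_ (fun a => ?_) fun x => ?_).mono ?_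
  · rw [hF₁.reg _ (by simp [countNeighbours])]; simp [Input.init]
  · rw [hF₁.arr _ (by simp [countNeighbours])]; simp [Input.init]
  · rw [hF₁.arr _ (by simp [countNeighbours])]; simp [Input.init]
  rintro c₂ σ₂ hF₂ ⟨hc₂, hsink⟩
  have hroot₂ : σ₂.reg 2 = R.root := by
    rw [hF₂.reg _ (by simp [markSinks]), hF₁.reg _ (by simp [countNeighbours])]
    simp [Input.init, hr, hk]
  have hdeg₂ : ∀ u : Fin n, σ₂.arr 4 u = (kids R u).card + (if u = R.root then 0 else 1) := by
    rw [hF₂.arr _ (by simp [markSinks])]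
    exact fun u => (hdeg u).1
  refine (run_collectLeaves R ?_ hroot₂ hdeg₂).mono ?_
  · rw [hF₂.reg _ (by simp [markSinks]), hF₁.reg _ (by simp [countNeighbours])]
    simp [Input.init]
  rintro c₃ σ₃ hF₃ ⟨hc₃, q, hq, hq'⟩
  have hroot₃ : σ₃.reg 2 = R.root := by
    rw [hF₃.reg _ (by simp [collectLeaves, pushLeaf]), hroot₂]
  have hn₃ : σ₃.reg 3 = n - 1 := by
    rw [hF₃.reg _ (by simp [collectLeaves, pushLeaf]), hF₂.reg _ (by simp [markSinks]),
      hF₁.reg _ (by simp [countNeighbours])]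
    simp [Input.init]
  refine (run_stripLeaves R hroot₃ hn₃ ?_ ?_ hq hq').mono ?_
  · rw [hF₃.arr _ (by simp [collectLeaves, pushLeaf])]
    exact hdeg₂
  · rw [hF₃.arr _ (by simp [collectLeaves, pushLeaf]), hF₂.arr _ (by simp [markSinks])]
    exact fun u => (hdeg u).2
  rintro c₄ σ₄ hF₄ ⟨hc₄, m, q', hQ, harr⟩
  obtain ⟨R', hroot', hpar', hord'⟩ := hQ.exists_rooting
  have hroot₄ : σ₄.reg 2 = R.root := by
    rw [hF₄.reg _ (by simp [stripLeaves, pushLeaf]), hroot₃]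
  have hn₄ : σ₄.reg 3 = n - 1 := by rw [hF₄.reg _ (by simp [stripLeaves, pushLeaf]), hn₃]
  have hother : ∀ a, a = 0 ∨ a = 1 ∨ a = 2 ∨ 9 ≤ a → σ₄.arr a = I.init.arr a := by
    intro a ha
    rw [hF₄.arr _ (by simp [stripLeaves, pushLeaf]; omega),
      hF₃.arr _ (by simp [collectLeaves, pushLeaf]; omega),
      hF₂.arr _ (by simp [markSinks]; omega), hF₁.arr _ (by simp [countNeighbours]; omega)]
    rfl
  have hord : ∀ i : Fin n, Function.update (σ₄.arr 6) (n - 1) (R.root : ℕ) i = R'.ord i := by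
    intro i
    rw [hord']
    by_cases hi : (i : ℕ) < n - 1
    · rw [if_pos hi, Function.update_of_ne (by omega), (harr i hi).1]
    · rw [if_neg hi, show (i : ℕ) = n - 1 by omega, Function.update_self]
  have hpar : ∀ u : Fin n, Function.update (σ₄.arr 7) R.root (R.root : ℕ) u = R'.par u := by
    intro u
    by_cases hu : u = R.root
    · rw [hu, Function.update_self, ← hroot', R'.par_root]
    · rw [Function.update_of_ne fun h => hu (Fin.ext h), hpar']
      obtain ⟨i, rfl⟩ := R'.ord.surjective u
      have hi : (i : ℕ) < n - 1 := by
        by_contra hi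
        exact hu (by rw [hord', if_neg hi])
      rw [hord', if_pos hi]
      exact (harr i hi).2
  have hsink₄ : ∀ u : Fin n, σ₄.arr 8 u = if u ∈ I.sinks then 1 else 0 := by
    rw [hF₄.arr _ (by simp [stripLeaves, pushLeaf]), hF₃.arr _ (by simp [collectLeaves, pushLeaf])]
    exact hsink
  simp only [run_store, Exp.eval, State.setArr_reg, hroot₄, hn₄]
  refine (run_countKids R' (by simpa using hn₄) (by simpa using hord) (by simpa using hpar)
    (by simpa using hsink₄) fun x => ?_).mono ?_
  · simp [hother, Input.init]
  rintro c₅ σ₅ hF₅ ⟨hc₅, hkids⟩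
  refine ⟨by linarith, fun x => ?_, R', ?_, ?_, ?_, fun a => ?_, fun i => ?_, fun u => ?_,
    fun u => ?_, hkids⟩
  · rw [hF₅.arr _ (by simp [countKids])]
    simp [hother, Input.init]
  · rw [hroot', hr]; simp [Input.sinks]
  · rw [hF₅.reg _ (by simp [countKids]), State.setArr_reg, State.setArr_reg,
      hF₄.reg _ (by simp [stripLeaves, pushLeaf]), hF₃.reg _ (by simp [collectLeaves, pushLeaf]),
      hF₂.reg _ (by simp [markSinks]), hF₁.reg _ (by simp [countNeighbours])]
    simp [Input.init]
  · rw [hF₅.reg _ (by simp [countKids]), State.setArr_reg, State.setArr_reg,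
      hF₄.reg _ (by simp [stripLeaves, pushLeaf]), hF₃.reg _ (by simp [collectLeaves, pushLeaf]),
      hF₂.reg _ (by simp [markSinks]), hF₁.reg _ (by simp [countNeighbours])]
    simp [Input.init]
  · rw [hF₅.arr _ (by simp [countKids])]
    simp [hother, Input.init]
  · rw [hF₅.arr _ (by simp [countKids])]
    simpa using hord i
  · rw [hF₅.arr _ (by simp [countKids])]
    simpa using hpar u
  · rw [hF₅.arr _ (by simp [countKids])]
    simpa using hsink₄ u

end

/-! ### The algorithm -/

section

variable {n k : ℕ} {I : Input n k} {f : Finset (Fin n) → Fin n → ℝ≥0∞} {t : ℕ → ℝ}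

open Rooting

/-- The algorithm: root the tree, find the optimal cost, and write down a partition of this cost. -/
def fixedSink : Program :=
  .seq prepare <|
  .seq (.setCost 1 .top) <|
  .seq (greedy 0 cmpOptimum) <|
  .seq (.setCost 0 (.reg 1)) <|
  .seq (greedy 30 (cmpThreshold 30)) assign

/-- The time that `fixedSink` needs if oracle calls take time `τ`. -/
noncomputable def fixedSinkTime (n k : ℕ) (τ : ℝ) : ℝ :=
  29 * n + 3 * k + 15 + 1 + greedyTime n k τ (greedyTime n k τ 2 + 4 * k + 10) + 1 +
    greedyTime n k τ 2 + (5 * n + 40 * (n + 1) * k + 2)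

theorem greedyTime_nonneg {τ K : ℝ} (hτ : 0 ≤ τ) (hK : 0 ≤ K) : 0 ≤ greedyTime n k τ K := by
  unfold greedyTime searchTime probeTime; positivity

theorem exists_solves (hk : 0 < k) (hf : IsRelaxedMinmaxMonotone I.tree f) {τ : ℝ}
    (hτ : ∀ m ≤ n, t m ≤ τ) (hτ0 : 0 ≤ τ) :
    ∃ r, Solves fixedSink I f t r ∧ r ≤ fixedSinkTime n k τ := by
  classical
  suffices H : Run I.tree f t fixedSink 0 I.init fun c σ => c ≤ fixedSinkTime n k τ ∧
      IsOptimalPartition I.tree f I.sinks (σ.output n) by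
    obtain ⟨r, σ, h, h₁, h₂⟩ := H
    exact ⟨r, ⟨σ, h, h₂⟩, by simpa using h₁⟩
  rw [fixedSink]
  simp only [run_seq, run_setCost]
  refine (run_prepare hk).mono ?_
  rintro c₁ σ₁ - ⟨hc₁, hzero₁, R, hr, hE₁⟩
  have hopt := isCmp_optimum (R := R) hf hr hτ hτ0
  have hthr := fun c => isCmp_threshold (R := R) (f := f) (t := t) 30 c
  have hT := greedyTime_nonneg (n := n) (k := k) hτ0 (K := 2) (by norm_num)
  refine (run_greedy hf hopt hτ hτ0 (by positivity) hE₁.setCostReg hr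
    (.inl (by simp))).mono ?_
  rintro c₂ σ₂ hF₂ ⟨hc₂, hG₂, -, A₂, -, hres₂⟩
  have hE₂ : Env R σ₂ := hE₁.setCostReg.frame hF₂
    ⟨fun x hx h => by have := hopt.greedy_writesReg h; omega,
      fun x hx h => by have := hopt.greedy_writesArr h; omega⟩
  refine (run_greedy hf (hthr (σ₂.costReg 1)) hτ hτ0 (by norm_num) hE₂.setCostReg hr
    (by simp)).mono ?_
  rintro c₃ σ₃ hF₃ ⟨hc₃, hG₃, -, A₃, hA₃, hres₃⟩
  have hw := fun x => (hthr (σ₂.costReg 1)).greedy_writesArr (x := x)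
  have hE₃ : Env R σ₃ := hE₂.setCostReg.frame hF₃
    ⟨fun x hx h => by have := (hthr (σ₂.costReg 1)).greedy_writesReg h; omega,
      fun x hx h => by have := hw _ h; omega⟩
  rw [hG₃] at hres₃
  have hS : ∀ s ∈ I.sinks, A₃ s := by
    rcases hG₂ with htop | hfeas
    · -- If the least feasible cost is `⊤`, then the second run can refuse nothing.
      intro s hs
      by_contra hA
      have := hres₃.no s hA s (cand_self hs)
      rw [htop] at this
      exact not_top_lt this
    · exact (hres₃.feasible_iff hf hr).1 hfeas
  refine (run_assign hE₃ rfl hA₃ (fun u => ?_) hres₃ (hS _ hr)).mono ?_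
  · rw [hF₃.arr 10 fun h => by have := hw _ h; omega]
    simp only [State.setCostReg_arr]
    rw [hF₂.arr 10 fun h => by have := hopt.greedy_writesArr h; omega]
    exact hzero₁ _
  rintro c₄ σ₄ - ⟨hc₄, D, out, hI, hout⟩
  refine ⟨by unfold fixedSinkTime; linarith, ?_⟩
  obtain ⟨hP, hcost⟩ := hI.isSinkPartition hres₃ hS
  have houtput : σ₄.output n = fun s => Finset.univ.filter fun v => out v = s := by
    funext s
    ext v
    simp [State.output, hout, Fin.val_inj]
  rw [houtput]
  exact ⟨hP, fun Q hQ => (Finset.sup_le hcost).trans (hres₂.le_of_partition hf hr hQ)⟩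

/-! ### Time bounds -/

theorem greedyTime_le {τ K : ℝ} (hτ : 0 ≤ τ) (hk : 0 < k) (hkn : k ≤ n) :
    greedyTime n k τ K ≤ k * Nat.size n * (162 * (n + τ + 1) + 3 * K) := by
  have hk' : (1 : ℝ) ≤ k := by exact_mod_cast hk
  have hkn' : (k : ℝ) ≤ n := by exact_mod_cast hkn
  have hL : (1 : ℝ) ≤ Nat.size n := by
    exact_mod_cast Nat.size_pos.2 (by omega)
  set L : ℝ := (Nat.size n : ℝ)
  set M : ℝ := n + τ + 1 with hM
  have h₁ : probeTime n τ K ≤ 30 * M + K := by unfold probeTime; linarith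
  have h₂ : searchTime n τ K ≤ L * (40 * M + K) := by
    have h := mul_le_mul_of_nonneg_left h₁ (by positivity : 0 ≤ L)
    have h' := mul_le_mul_of_nonneg_right hL (by positivity : 0 ≤ M)
    unfold searchTime
    linarith
  have h₃ := mul_le_mul_of_nonneg_left h₂ (by positivity : 0 ≤ 3 * (k : ℝ))
  have h₄ : (10 * n + 4 * k + 10 : ℝ) ≤ k * (14 * M) := by
    have := mul_le_mul_of_nonneg_right hk' (by positivity : 0 ≤ 14 * M)
    linarith
  have h₅ : 2 * (k : ℝ) * (4 * n + 10 * k + 10) ≤ 2 * k * (14 * M) := by gcongr; linarith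
  have h₆ := mul_le_mul_of_nonneg_right hL (by positivity : 0 ≤ k * (42 * M))
  unfold greedyTime
  linarith

theorem fixedSinkTime_le {τ : ℝ} (hτ : 0 ≤ τ) (hk : 0 < k) (hkn : k ≤ n) :
    fixedSinkTime n k τ ≤ 1100 * ((k : ℝ) ^ 2 * (n + τ + 1) * Nat.size n ^ 2) := by
  have hk' : (1 : ℝ) ≤ k := by exact_mod_cast hk
  have hkn' : (k : ℝ) ≤ n := by exact_mod_cast hkn
  have hL : (1 : ℝ) ≤ Nat.size n := by
    exact_mod_cast Nat.size_pos.2 (by omega)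
  have hT := greedyTime_nonneg (n := n) (k := k) hτ (K := 2) (by norm_num)
  have h₁ := greedyTime_le hτ (K := 2) hk hkn
  have h₂ := greedyTime_le hτ (K := greedyTime n k τ 2 + 4 * k + 10) hk hkn
  unfold fixedSinkTime
  set L : ℝ := (Nat.size n : ℝ)
  set M : ℝ := n + τ + 1 with hM
  have hkL : 1 ≤ k * L := one_le_mul_of_one_le_of_one_le hk' hL
  have hM1 : 1 ≤ M := by linarith
  have hkLM : M ≤ k * L * M := le_mul_of_one_le_left (by positivity) hkL
  have h₃ : greedyTime n k τ 2 ≤ 168 * (k * L * M) := by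
    have := mul_le_mul_of_nonneg_left hM1 (by positivity : 0 ≤ 6 * (k * L))
    linarith
  have h₄ : k * L * M ≤ k * L * (k * L * M) := le_mul_of_one_le_left (by positivity) hkL
  have h₅ : k * L * (162 * M + 3 * (greedyTime n k τ 2 + 4 * k + 10)) ≤
      k * L * (708 * (k * L * M)) := by
    gcongr
    linarith
  have h₆ : (n + 1 : ℝ) * k ≤ k * L * M := by
    have h : (n + 1 : ℝ) ≤ M := by linarith
    have h' := mul_le_mul_of_nonneg_right h (by positivity : (0 : ℝ) ≤ k)
    have h'' := mul_le_mul_of_nonneg_right hL (by positivity : 0 ≤ M * k)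
    linarith
  linarith

theorem size_le_log (hn : 2 ≤ n) : (Nat.size n : ℝ) ≤ 4 * Real.log n := by
  have hpos : 0 < Nat.size n := Nat.size_pos.2 (by omega)
  have h₁ : 2 ^ (Nat.size n - 1) ≤ n := Nat.lt_size.1 (by omega)
  have h₂ : ((Nat.size n - 1 : ℕ) : ℝ) * Real.log 2 ≤ Real.log n := by
    rw [← Real.log_pow]
    exact Real.log_le_log (by positivity) (by exact_mod_cast h₁)
  have h₃ : Real.log 2 ≤ Real.log n := Real.log_le_log (by norm_num) (by exact_mod_cast hn)
  have h₄ : (0.6931471803 : ℝ) < Real.log 2 := Real.log_two_gt_d9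
  have h₅ : (Nat.size n : ℝ) = ((Nat.size n - 1 : ℕ) : ℝ) + 1 := by
    exact_mod_cast (Nat.sub_add_cancel hpos).symm
  have h₆ : (0 : ℝ) ≤ ((Nat.size n - 1 : ℕ) : ℝ) := Nat.cast_nonneg _
  have h₇ : ((Nat.size n - 1 : ℕ) : ℝ) * (1 / 2) ≤ ((Nat.size n - 1 : ℕ) : ℝ) * Real.log 2 :=
    mul_le_mul_of_nonneg_left (by linarith) h₆
  linarith

theorem exists_solves_le_log (hk : 0 < k) (hf : IsRelaxedMinmaxMonotone I.tree f) {τ : ℝ}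
    (hτ : ∀ m ≤ n, t m ≤ τ) (hτ0 : 0 ≤ τ) :
    ∃ r, Solves fixedSink I f t r ∧
      (2 ≤ n → r ≤ 17600 * ((k : ℝ) ^ 2 * (n + τ + 1) * Real.log n ^ 2)) := by
  obtain ⟨r, hr, hle⟩ := exists_solves hk hf hτ hτ0
  have hkn : k ≤ n := by simpa using Fintype.card_le_of_embedding I.sink
  refine ⟨r, hr, fun hn => hle.trans ((fixedSinkTime_le hτ0 hk hkn).trans ?_)⟩
  have h : (Nat.size n : ℝ) ^ 2 ≤ (4 * Real.log n) ^ 2 := by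
    gcongr
    exact size_le_log hn
  calc 1100 * ((k : ℝ) ^ 2 * (n + τ + 1) * Nat.size n ^ 2)
      ≤ 1100 * ((k : ℝ) ^ 2 * (n + τ + 1) * (4 * Real.log n) ^ 2) := by gcongr
    _ = _ := by ring

theorem exists_time_bound (ht : ∀ m, 0 ≤ t m) (hlin : (fun m : ℕ => (m : ℝ)) =O[atTop] t) :
    ∃ (C : ℝ) (n₀ : ℕ), 0 ≤ C ∧ ∀ m, n₀ ≤ m → m + t m + 1 ≤ C * t m := by
  obtain ⟨C, hC, h⟩ := hlin.exists_pos
  obtain ⟨n₀, h⟩ := eventually_atTop.1 h.bound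
  refine ⟨2 * C + 1, n₀ + 1, by positivity, fun m hm => ?_⟩
  have h₁ := h m (by omega)
  rw [Real.norm_of_nonneg (Nat.cast_nonneg _), Real.norm_of_nonneg (ht m)] at h₁
  have h₂ : (1 : ℝ) ≤ m := by exact_mod_cast (by omega : 1 ≤ m)
  linarith

/-- A time bound that holds for large arguments holds for all arguments up to a constant. -/
theorem exists_oracle_bound (ht : ∀ m, 0 ≤ t m)
    (hO : t =O[atTop] fun m : ℕ => (m : ℝ) * Real.log m ^ 2) :
    ∃ B : ℝ, 0 ≤ B ∧ ∀ n, ∀ m ≤ n, t m ≤ B + B * (n * Real.log n ^ 2) := by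
  obtain ⟨C, hC, h⟩ := hO.exists_pos
  obtain ⟨n₀, h⟩ := eventually_atTop.1 h.bound
  have hS : 0 ≤ ∑ i ∈ Finset.range n₀, t i := Finset.sum_nonneg fun i _ => ht i
  refine ⟨C + ∑ i ∈ Finset.range n₀, t i, by positivity, fun n m hmn => ?_⟩
  have hlog : 0 ≤ (n : ℝ) * Real.log n ^ 2 := by positivity
  by_cases hm : m < n₀
  · have h₁ : t m ≤ ∑ i ∈ Finset.range n₀, t i :=
      Finset.single_le_sum (f := t) (fun i _ => ht i) (Finset.mem_range.2 hm)
    have h₂ : 0 ≤ (C + ∑ i ∈ Finset.range n₀, t i) * (n * Real.log n ^ 2) := by positivity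
    linarith
  · have h₁ := h m (by omega)
    rw [Real.norm_of_nonneg (ht m), Real.norm_of_nonneg (by positivity)] at h₁
    have h₂ : (m : ℝ) * Real.log m ^ 2 ≤ n * Real.log n ^ 2 := by
      rcases Nat.eq_zero_or_pos m with rfl | hm0
      · simpa using hlog
      · have : 0 ≤ Real.log m := Real.log_natCast_nonneg m
        gcongr
    have h₃ := mul_le_mul_of_nonneg_left h₂ hC.le
    have h₄ : 0 ≤ (∑ i ∈ Finset.range n₀, t i) * (n * Real.log n ^ 2) := by positivity
    linarith

end

end SinkPartition

theorem theorem4 :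
    ∃ p : Program,
      (∀ t : ℕ → ℝ, IsAsymptoticallySubadditive t →
        (fun n : ℕ => t (2 * n)) =O[atTop] t →
        ∃ (C : ℝ) (n₀ : ℕ), ∀ (n k : ℕ), 0 < k → ∀ (I : Input n k)
          (f : Finset (Fin n) → Fin n → ℝ≥0∞), IsRelaxedMinmaxMonotone I.tree f →
          ∃ r : ℝ, Solves p I f t r ∧
            (n₀ ≤ n → r ≤ C * ((k : ℝ) ^ 2 * t n * Real.log n ^ 2))) ∧
      (∀ t : ℕ → ℝ, (∀ n, 0 ≤ t n) →
        t =O[atTop] (fun n : ℕ => (n : ℝ) * Real.log n ^ 2) →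
        ∃ (C : ℝ) (n₀ : ℕ), ∀ (n k : ℕ), 0 < k → ∀ (I : Input n k)
          (w : Fin n → ℝ≥0) (c τ : Sym2 (Fin n) → ℝ≥0),
          ∃ r : ℝ, Solves p I (evacuationCost I.tree w c τ) t r ∧
            (n₀ ≤ n → r ≤ C * ((n : ℝ) * (k : ℝ) ^ 2 * Real.log n ^ 4))) := by

  refine ⟨fixedSink, fun t ht _ => ?_, fun t ht hO => ?_⟩
  · obtain ⟨C, n₀, hC, h⟩ := exists_time_bound ht.nonneg ht.linear_lower
    refine ⟨17600 * C, n₀ + 2, fun n k hk I f hf => ?_⟩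
    obtain ⟨r, hr, hle⟩ := exists_solves_le_log hk hf (fun m hm => ht.monotone hm) (ht.nonneg n)
    refine ⟨r, hr, fun hn => (hle (by omega)).trans ?_⟩
    calc 17600 * ((k : ℝ) ^ 2 * (n + t n + 1) * Real.log n ^ 2)
        ≤ 17600 * ((k : ℝ) ^ 2 * (C * t n) * Real.log n ^ 2) := by
          gcongr
          exact h n (by omega)
      _ = _ := by ring
  · obtain ⟨B, hB, h⟩ := exists_oracle_bound ht hO
    refine ⟨17600 * (2 + 2 * B), 3, fun n k hk I w c τ => ?_⟩
    obtain ⟨r, hr, hle⟩ := exists_solves_le_log hk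
      (evacuationCost_isRelaxedMinmaxMonotone I.isTree w c τ) (h n) (by positivity)
    refine ⟨r, hr, fun hn => (hle (by omega)).trans ?_⟩
    have hn' : (3 : ℝ) ≤ n := by exact_mod_cast hn
    -- `1 ≤ log n`, so that `n + 1` and the constant in the bound are dominated by `n * log n ^ 2`.
    have hlog : 1 ≤ Real.log n := by
      rw [Real.le_log_iff_exp_le (by positivity)]
      exact Real.exp_one_lt_d9.le.trans (by linarith)
    have hlog2 : 1 ≤ Real.log n ^ 2 := one_le_pow₀ hlog
    have h₁ : (n : ℝ) ≤ n * Real.log n ^ 2 := le_mul_of_one_le_right (by positivity) hlog2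
    have h₂ : B ≤ B * (n * Real.log n ^ 2) := le_mul_of_one_le_right hB (by linarith)
    calc 17600 * ((k : ℝ) ^ 2 * (n + (B + B * (n * Real.log n ^ 2)) + 1) * Real.log n ^ 2)
        ≤ 17600 * ((k : ℝ) ^ 2 * ((2 + 2 * B) * (n * Real.log n ^ 2)) * Real.log n ^ 2) := by
          gcongr
          linarith
      _ = _ := by ring
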